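/- Algebras are associative, not necessarily unital, over $\mathbb{C}$; $M(B)$ denotes the multiplier algebra of $B$. Let $(A,\Delta)$ be a weak multiplier Hopf algebra (not necessarily regular). That is, $A$ has a non-degenerate product and $A^2=A$; $\Delta:A\to M(A\otimes A)$ is a homomorphism such that $T_1(a\otimes b)=\Delta(a)(1\otimes b)$ and $T_2(a\otimes b)=(a\otimes 1)\Delta(b)$ lie in $A\otimes A$, which is coassociative, $(c\otimes1\otimes1)(\Delta\otimes\iota)(\Delta(a)(1\otimes b))=(\iota\otimes\Delta)((c\otimes1)\Delta(a))(1\otimes1\otimes b)$, and full (the smallest subspaces $V,W\subseteq A$ with $\Delta(A)(1\otimes A)\subseteq V\otimes A$ and $(A\otimes 1)\Delta(A)\subseteq A\otimes W$ are $A$); there is a counit, i.e. a linear map $\varepsilon:A\to\mathbb{C}$ with $(\varepsilon\otimes\iota)(\Delta(a)(1\otimes b))=ab=(\iota\otimes\varepsilon)((a\otimes1)\Delta(b))$; there is an idempotent $E\in M(A\otimes A)$ with $E(A\otimes A)=T_1(A\otimes A)$, $(A\otimes A)E=T_2(A\otimes A)$ and $(\iota\otimes\Delta)E=(E\otimes1)(1\otimes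 E)=(1\otimes E)(E\otimes1)$ (where $\iota\otimes\Delta$ is extended to $M(A\otimes A)$ with $1\mapsto 1\otimes E$); and $\operatorname{Ker}T_i=(1-G_i)(A\otimes A)$ for $i=1,2$, where the linear maps $G_1,G_2$ on $A\otimes A$ are given by $(G_1\otimes\iota)(\Delta_{13}(a)(1\otimes b\otimes c))=\Delta_{13}(a)(1\otimes E)(1\otimes b\otimes c)$ and $(\iota\otimes G_2)((a\otimes b\otimes1)\Delta_{13}(c))=(a\otimes b\otimes1)(E\otimes1)\Delta_{13}(c)$. Let $R_1,R_2$ be the generalized inverses of $T_1,T_2$ determined by $T_1R_1=E\,\cdot\,$, $R_1T_1=G_1$, $R_1T_1R_1=R_1$ and $T_2R_2=\,\cdot\,E$, $R_2T_2=G_2$, $R_2T_2R_2=R_2$. The antipode $S:A\to M(A)$ is given by $S(a)b=(\varepsilon\otimes\iota)R_1(a\otimes b)$ and $bS(a)=(\iota\otimes\varepsilon)R_2(b\otimes a)$; it is extended to $M(A)$ by $S(m)S(a)=S(am)$ and $S(a)S(m)=S(ma)$ for $a\in A$. The source map is $\varepsilon_s:A\to M(A)$, $\varepsilon_s(a)=(\iota\otimes\varepsilon)((1\otimes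 a)E)$, and $\varepsilon_s(A)$ is the source algebra. Let $R$ be a left $A$-module algebra: an algebra $R$ with a bilinear action $a\otimes r\mapsto a\rhd r$ satisfying $(ab)\rhd r=a\rhd(b\rhd r)$, which is unital ($R$ is spanned by the elements $a\rhd r$), and such that $$a\rhd (xy)=m(\Delta(a)\rhd(x\otimes y))\qquad (a\in A,\ x,y\in R),$$ where $m:R\otimes R\to R$ is the multiplication of $R$. Here a multiplier $\mu\in M(B)$ acts on a unital left $B$-module by $\mu\rhd(b\rhd x)=(\mu b)\rhd x$, and this is applied to the $A$-module $R$ and to the $A\otimes A$-module $R\otimes R$ with $(a\otimes b)\rhd(r\otimes r')=(a\rhd r)\otimes(b\rhd r')$. Then for all $r,r'\in R$ and all $y\in\varepsilon_s(A)$, $$m(E\rhd(r\otimes r'))=rr'\qquad\text{and}\qquad (y\rhd r)\,r'=r\,(S(y)\rhd r').$$ -/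

import Mathlib

open scoped TensorProduct

noncomputable section

namespace WMHA

section Multipliers

/-- The multiplier algebra `M(B)` of a (possibly non-unital) complex algebra `B`. A multiplier is
a pair `(l, r)` of a left multiplier `l` and a right multiplier `r` with `r(a) b = a l(b)`. The
second component lives in the opposite algebra, so that the product is
`(l, r)(l', r') = (l ∘ l', r' ∘ r)`. -/
def multiplierAlgebra (B : Type*) [NonUnitalRing B] [Module ℂ B] [IsScalarTower ℂ B B]
    [SMulCommClass ℂ B B] : Subalgebra ℂ (Module.End ℂ B × (Module.End ℂ B)ᵐᵒᵖ) where
  carrier := {p | (∀ a b, p.1 (a * b) = p.1 a * b) ∧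
    (∀ a b, p.2.unop (a * b) = a * p.2.unop b) ∧ ∀ a b, p.2.unop a * b = a * p.1 b}
  mul_mem' := by
    rintro p q ⟨h1, h2, h3⟩ ⟨k1, k2, k3⟩
    refine ⟨fun a b => ?_, fun a b => ?_, fun a b => ?_⟩
    · simp [k1, h1]
    · simp [k2, h2]
    · simp [k3, h3]
  add_mem' := by
    rintro p q ⟨h1, h2, h3⟩ ⟨k1, k2, k3⟩
    refine ⟨fun a b => ?_, fun a b => ?_, fun a b => ?_⟩
    · simp [k1, h1, add_mul]
    · simp [k2, h2, mul_add]
    · simp [k3, h3, add_mul, mul_add]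
  algebraMap_mem' := by
    intro z
    refine ⟨fun a b => ?_, fun a b => ?_, fun a b => ?_⟩
    · simp [Algebra.algebraMap_eq_smul_one, smul_mul_assoc]
    · simp [Algebra.algebraMap_eq_smul_one, mul_smul_comm]
    · simp [Algebra.algebraMap_eq_smul_one, smul_mul_assoc, mul_smul_comm]

/-- `M(B)` as a type; it is a unital complex algebra. -/
abbrev Multiplier (B : Type*) [NonUnitalRing B] [Module ℂ B] [IsScalarTower ℂ B B]
    [SMulCommClass ℂ B B] : Type _ := ↥(multiplierAlgebra B)

variable {B : Type*} [NonUnitalRing B] [Module ℂ B] [IsScalarTower ℂ B B] [SMulCommClass ℂ B B]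
variable {C : Type*} [NonUnitalRing C] [Module ℂ C] [IsScalarTower ℂ C C] [SMulCommClass ℂ C C]

/-- `m.left b` is the product `m b`. -/
def Multiplier.left (m : Multiplier B) : Module.End ℂ B := m.1.1

/-- `m.right b` is the product `b m`. -/
def Multiplier.right (m : Multiplier B) : Module.End ℂ B := m.1.2.unop

/-- The multiplier with given left and right multiplications. -/
def Multiplier.mk (l r : Module.End ℂ B) (hl : ∀ a b, l (a * b) = l a * b)
    (hr : ∀ a b, r (a * b) = a * r b) (h : ∀ a b, r a * b = a * l b) : Multiplier B :=
  ⟨(l, MulOpposite.op r), hl, hr, h⟩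

/-- The canonical map `B → M(B)`. -/
def Multiplier.of (B : Type*) [NonUnitalRing B] [Module ℂ B] [IsScalarTower ℂ B B]
    [SMulCommClass ℂ B B] : B →ₗ[ℂ] Multiplier B where
  toFun b := Multiplier.mk (LinearMap.mulLeft ℂ b) (LinearMap.mulRight ℂ b)
    (fun x y => by simp [mul_assoc]) (fun x y => by simp [mul_assoc])
    (fun x y => by simp [mul_assoc])
  map_add' x y := by
    refine Subtype.ext (Prod.ext ?_ (MulOpposite.unop_injective ?_)) <;>
      · ext z; simp [Multiplier.mk, add_mul, mul_add]
  map_smul' c x := by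
    refine Subtype.ext (Prod.ext ?_ (MulOpposite.unop_injective ?_)) <;>
      · ext z; simp [Multiplier.mk, smul_mul_assoc, mul_smul_comm]

/-- The multiplier `m ⊗ n` of `B ⊗ C`. -/
def Multiplier.tmul (m : Multiplier B) (n : Multiplier C) : Multiplier (B ⊗[ℂ] C) :=
  Multiplier.mk (TensorProduct.map m.left n.left) (TensorProduct.map m.right n.right)
    (by
      intro x y
      induction x using TensorProduct.induction_on with
      | zero => simp
      | add x x' hx hx' => simp only [add_mul, map_add, hx, hx']
      | tmul b c =>
        induction y using TensorProduct.induction_on with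
        | zero => simp
        | add y y' hy hy' => simp only [mul_add, map_add, hy, hy']
        | tmul b' c' =>
          simp [Multiplier.left, Algebra.TensorProduct.tmul_mul_tmul, m.2.1, n.2.1])
    (by
      intro x y
      induction x using TensorProduct.induction_on with
      | zero => simp
      | add x x' hx hx' => simp only [add_mul, map_add, hx, hx']
      | tmul b c =>
        induction y using TensorProduct.induction_on with
        | zero => simp
        | add y y' hy hy' => simp only [mul_add, map_add, hy, hy']
        | tmul b' c' =>
          simp [Multiplier.right, Algebra.TensorProduct.tmul_mul_tmul, m.2.2.1, n.2.2.1])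
    (by
      intro x y
      induction x using TensorProduct.induction_on with
      | zero => simp
      | add x x' hx hx' => simp only [add_mul, map_add, hx, hx']
      | tmul b c =>
        induction y using TensorProduct.induction_on with
        | zero => simp
        | add y y' hy hy' => simp only [mul_add, map_add, hy, hy']
        | tmul b' c' =>
          simp [Multiplier.left, Multiplier.right, Algebra.TensorProduct.tmul_mul_tmul,
            m.2.2.2, n.2.2.2])

/-- The natural map `M(B) ⊗ M(C) → M(B ⊗ C)`, as a bilinear map. -/
def Multiplier.tmulₗ (B C : Type*) [NonUnitalRing B] [Module ℂ B] [IsScalarTower ℂ B B]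
    [SMulCommClass ℂ B B] [NonUnitalRing C] [Module ℂ C] [IsScalarTower ℂ C C]
    [SMulCommClass ℂ C C] :
    Multiplier B →ₗ[ℂ] Multiplier C →ₗ[ℂ] Multiplier (B ⊗[ℂ] C) :=
  LinearMap.mk₂ ℂ Multiplier.tmul
    (fun _ _ _ => Subtype.ext (Prod.ext (TensorProduct.map_add_left _ _ _)
      (MulOpposite.unop_injective (TensorProduct.map_add_left _ _ _))))
    (fun _ _ _ => Subtype.ext (Prod.ext (TensorProduct.map_smul_left _ _ _)
      (MulOpposite.unop_injective (TensorProduct.map_smul_left _ _ _))))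
    (fun _ _ _ => Subtype.ext (Prod.ext (TensorProduct.map_add_right _ _ _)
      (MulOpposite.unop_injective (TensorProduct.map_add_right _ _ _))))
    (fun _ _ _ => Subtype.ext (Prod.ext (TensorProduct.map_smul_right _ _ _)
      (MulOpposite.unop_injective (TensorProduct.map_smul_right _ _ _))))

/-- Transport of multipliers along an isomorphism of algebras. -/
def Multiplier.transport (e : B ≃ₗ[ℂ] C) (he : ∀ x y, e (x * y) = e x * e y)
    (m : Multiplier B) : Multiplier C :=
  have he' : ∀ x y, e.symm (x * y) = e.symm x * e.symm y := fun x y => by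
    apply e.injective; simp [he]
  Multiplier.mk (e.toLinearMap ∘ₗ m.left ∘ₗ e.symm.toLinearMap)
    (e.toLinearMap ∘ₗ m.right ∘ₗ e.symm.toLinearMap)
    (fun x y => by simp [Multiplier.left, he', he, m.2.1])
    (fun x y => by simp [Multiplier.right, he', he, m.2.2.1])
    (fun x y => by
      have h := congrArg e (m.2.2.2 (e.symm x) (e.symm y))
      simpa [he, Multiplier.left, Multiplier.right] using h)

/-- The value at the multiplier `m` of the extension to `M(B)` of a homomorphism `Φ : B → M(C)`
whose extension sends `1` to the idempotent `e`: the multiplier `X = e X = X e` of `C` such that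
`X Φ(b) = Φ(m b)` and `Φ(b) X = Φ(b m)` for all `b`. It is unique when `Φ(B) C = e C`. -/
def IsExtensionAt (Φ : B →ₗ[ℂ] Multiplier C) (e : Multiplier C) (m : Multiplier B)
    (X : Multiplier C) : Prop :=
  e * X = X ∧ X * e = X ∧ (∀ b, X * Φ b = Φ (m.left b)) ∧ ∀ b, Φ b * X = Φ (m.right b)

end Multipliers

theorem assoc_mul (A : Type*) [NonUnitalRing A] [Module ℂ A] [IsScalarTower ℂ A A]
    [SMulCommClass ℂ A A] (x y : (A ⊗[ℂ] A) ⊗[ℂ] A) :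
    TensorProduct.assoc ℂ A A A (x * y) =
      TensorProduct.assoc ℂ A A A x * TensorProduct.assoc ℂ A A A y := by
  induction x using TensorProduct.induction_on with
  | zero => simp
  | add x x' hx hx' => simp only [add_mul, map_add, hx, hx']
  | tmul p c =>
    induction y using TensorProduct.induction_on with
    | zero => simp
    | add y y' hy hy' => simp only [mul_add, map_add, hy, hy']
    | tmul q d =>
      induction p using TensorProduct.induction_on with
      | zero => simp
      | add x x' hx hx' => simp only [TensorProduct.add_tmul, add_mul, map_add, hx, hx']
      | tmul a b =>
        induction q using TensorProduct.induction_on with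
        | zero => simp
        | add x x' hx hx' => simp only [TensorProduct.add_tmul, mul_add, map_add, hx, hx']
        | tmul a' b' => simp [Algebra.TensorProduct.tmul_mul_tmul]

section Legs

variable {A : Type*} [NonUnitalRing A] [Module ℂ A] [IsScalarTower ℂ A A] [SMulCommClass ℂ A A]

/-- `F ⊗ 1` in `M(A ⊗ A ⊗ A)`, for `F` in `M(A ⊗ A)`. -/
def leg12 (F : Multiplier (A ⊗[ℂ] A)) : Multiplier (A ⊗[ℂ] (A ⊗[ℂ] A)) :=
  Multiplier.transport (TensorProduct.assoc ℂ A A A) (assoc_mul A)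
    (Multiplier.tmul F (1 : Multiplier A))

/-- `1 ⊗ F` in `M(A ⊗ A ⊗ A)`, for `F` in `M(A ⊗ A)`. -/
def leg23 (F : Multiplier (A ⊗[ℂ] A)) : Multiplier (A ⊗[ℂ] (A ⊗[ℂ] A)) :=
  Multiplier.tmul (1 : Multiplier A) F

/-- `ι ⊗ Δ : A ⊗ A → M(A ⊗ A ⊗ A)`. -/
def idTensor (Δ : A →ₗ[ℂ] Multiplier (A ⊗[ℂ] A)) :
    A ⊗[ℂ] A →ₗ[ℂ] Multiplier (A ⊗[ℂ] (A ⊗[ℂ] A)) :=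
  TensorProduct.lift ((Multiplier.tmulₗ A (A ⊗[ℂ] A)).compl₁₂ (Multiplier.of A) Δ)

/-- An operator `T` on `A ⊗ A`, acting on the first and third factor of `A ⊗ A ⊗ A`. -/
def leg13 (T : Module.End ℂ (A ⊗[ℂ] A)) : Module.End ℂ (A ⊗[ℂ] (A ⊗[ℂ] A)) :=
  (TensorProduct.leftComm ℂ A A A).toLinearMap ∘ₗ T.lTensor A ∘ₗ
    (TensorProduct.leftComm ℂ A A A).toLinearMap

/-- `φ ⊗ ι : A ⊗ A → A`. -/
def sliceLeft (φ : A →ₗ[ℂ] ℂ) : A ⊗[ℂ] A →ₗ[ℂ] A :=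
  (TensorProduct.lid ℂ A).toLinearMap ∘ₗ φ.rTensor A

/-- `ι ⊗ φ : A ⊗ A → A`. -/
def sliceRight (φ : A →ₗ[ℂ] ℂ) : A ⊗[ℂ] A →ₗ[ℂ] A :=
  (TensorProduct.rid ℂ A).toLinearMap ∘ₗ φ.lTensor A

end Legs

/-- A weak multiplier Hopf algebra (not necessarily regular) with underlying algebra `A`. Besides
the coproduct `Δ`, the structure records the canonical maps `T₁`, `T₂`, the counit `ε`, the
canonical idempotent `E` and the maps `G₁`, `G₂`, all of which are determined by `Δ`. -/
structure WeakMultiplierHopfAlgebra (A : Type*) [NonUnitalRing A] [Module ℂ A]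
    [IsScalarTower ℂ A A] [SMulCommClass ℂ A A] where
  /-- The product is non-degenerate. -/
  left_nondeg : ∀ a : A, (∀ b, a * b = 0) → a = 0
  right_nondeg : ∀ a : A, (∀ b, b * a = 0) → a = 0
  /-- `A² = A`. -/
  idempotent : Submodule.span ℂ {x : A | ∃ a b, x = a * b} = ⊤
  /-- The coproduct, a homomorphism `A → M(A ⊗ A)`. -/
  Δ : A →ₙₐ[ℂ] Multiplier (A ⊗[ℂ] A)
  /-- The canonical map `T₁(a ⊗ b) = Δ(a)(1 ⊗ b)`; in particular this lies in `A ⊗ A`. -/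
  T₁ : Module.End ℂ (A ⊗[ℂ] A)
  T₁_spec : ∀ a b, Multiplier.of (A ⊗[ℂ] A) (T₁ (a ⊗ₜ b)) =
    Δ a * Multiplier.tmul (1 : Multiplier A) (Multiplier.of A b)
  /-- The canonical map `T₂(a ⊗ b) = (a ⊗ 1)Δ(b)`; in particular this lies in `A ⊗ A`. -/
  T₂ : Module.End ℂ (A ⊗[ℂ] A)
  T₂_spec : ∀ a b, Multiplier.of (A ⊗[ℂ] A) (T₂ (a ⊗ₜ b)) =
    Multiplier.tmul (Multiplier.of A a) (1 : Multiplier A) * Δ b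
  /-- Coassociativity:
  `(c ⊗ 1 ⊗ 1)(Δ ⊗ ι)(Δ(a)(1 ⊗ b)) = (ι ⊗ Δ)((c ⊗ 1)Δ(a))(1 ⊗ 1 ⊗ b)`. -/
  coassoc : ∀ a b c : A,
    TensorProduct.assoc ℂ A A A
        (T₂.rTensor A ((TensorProduct.assoc ℂ A A A).symm (c ⊗ₜ T₁ (a ⊗ₜ b)))) =
      T₁.lTensor A (TensorProduct.assoc ℂ A A A (T₂ (c ⊗ₜ a) ⊗ₜ b))
  /-- Fullness: the smallest `V` with `Δ(A)(1 ⊗ A) ⊆ V ⊗ A` is `A`. -/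
  full_left : ∀ V : Submodule ℂ A,
    LinearMap.range T₁ ≤ LinearMap.range (V.subtype.rTensor A) → V = ⊤
  /-- Fullness: the smallest `W` with `(A ⊗ 1)Δ(A) ⊆ A ⊗ W` is `A`. -/
  full_right : ∀ W : Submodule ℂ A,
    LinearMap.range T₂ ≤ LinearMap.range (W.subtype.lTensor A) → W = ⊤
  /-- The counit. -/
  ε : A →ₗ[ℂ] ℂ
  counit_left : ∀ a b, sliceLeft ε (T₁ (a ⊗ₜ b)) = a * b
  counit_right : ∀ a b, sliceRight ε (T₂ (a ⊗ₜ b)) = a * b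
  /-- The canonical idempotent. -/
  E : Multiplier (A ⊗[ℂ] A)
  E_idem : E * E = E
  /-- `E(A ⊗ A) = T₁(A ⊗ A)`. -/
  range_T₁ : LinearMap.range E.left = LinearMap.range T₁
  /-- `(A ⊗ A)E = T₂(A ⊗ A)`. -/
  range_T₂ : LinearMap.range E.right = LinearMap.range T₂
  /-- `(ι ⊗ Δ)E = (E ⊗ 1)(1 ⊗ E)`, for the extension of `ι ⊗ Δ` to `M(A ⊗ A)`. -/
  idTensor_E : IsExtensionAt (idTensor (Δ : A →ₗ[ℂ] Multiplier (A ⊗[ℂ] A))) (leg23 E) E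
    (leg12 E * leg23 E)
  /-- `(E ⊗ 1)(1 ⊗ E) = (1 ⊗ E)(E ⊗ 1)`. -/
  E_comm : leg12 E * leg23 E = leg23 E * leg12 E
  /-- `(G₁ ⊗ ι)(Δ₁₃(a)(1 ⊗ b ⊗ c)) = Δ₁₃(a)(1 ⊗ E)(1 ⊗ b ⊗ c)`; here
  `Δ₁₃(a)(1 ⊗ b ⊗ c)` is `T₁` applied to the outer factors of `a ⊗ b ⊗ c`. -/
  G₁ : Module.End ℂ (A ⊗[ℂ] A)
  G₁_spec : ∀ a b c : A,
    TensorProduct.assoc ℂ A A A (G₁.rTensor A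
        ((TensorProduct.assoc ℂ A A A).symm (leg13 T₁ (a ⊗ₜ (b ⊗ₜ c))))) =
      leg13 T₁ (a ⊗ₜ E.left (b ⊗ₜ c))
  /-- `Ker T₁ = (1 - G₁)(A ⊗ A)`. -/
  ker_T₁ : LinearMap.ker T₁ = LinearMap.range (1 - G₁)
  /-- `(ι ⊗ G₂)((a ⊗ b ⊗ 1)Δ₁₃(c)) = (a ⊗ b ⊗ 1)(E ⊗ 1)Δ₁₃(c)`; here
  `(a ⊗ b ⊗ 1)Δ₁₃(c)` is `T₂` applied to the outer factors of `a ⊗ b ⊗ c`. -/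
  G₂ : Module.End ℂ (A ⊗[ℂ] A)
  G₂_spec : ∀ a b c : A,
    G₂.lTensor A (leg13 T₂ (a ⊗ₜ (b ⊗ₜ c))) =
      leg13 T₂ (TensorProduct.assoc ℂ A A A (E.right (a ⊗ₜ b) ⊗ₜ c))
  /-- `Ker T₂ = (1 - G₂)(A ⊗ A)`. -/
  ker_T₂ : LinearMap.ker T₂ = LinearMap.range (1 - G₂)

/-- `R` is the generalized inverse of `T` with `T R = P` and `R T = G`. It is unique. -/
def IsGeneralizedInverse {V : Type*} [AddCommGroup V] [Module ℂ V] (T P G R : Module.End ℂ V) :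
    Prop :=
  T * R = P ∧ R * T = G ∧ R * T * R = R

namespace WeakMultiplierHopfAlgebra

variable {A : Type*} [NonUnitalRing A] [Module ℂ A] [IsScalarTower ℂ A A] [SMulCommClass ℂ A A]

/-- `S : A → M(A)` is the antipode: with `R₁(a ⊗ b) = ∑ a₍₁₎ ⊗ S(a₍₂₎)b` and
`R₂(a ⊗ b) = ∑ a S(b₍₁₎) ⊗ b₍₂₎` the generalized inverses of `T₁` and `T₂` that belong to
`E`, `G₁` and `E`, `G₂`, it is given by `S(a)b = (ε ⊗ ι)R₁(a ⊗ b)` and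
`b S(a) = (ι ⊗ ε)R₂(b ⊗ a)`. -/
def IsAntipode (H : WeakMultiplierHopfAlgebra A) (S : A →ₗ[ℂ] Multiplier A) : Prop :=
  ∃ R₁ R₂ : Module.End ℂ (A ⊗[ℂ] A),
    IsGeneralizedInverse H.T₁ H.E.left H.G₁ R₁ ∧
    IsGeneralizedInverse H.T₂ H.E.right H.G₂ R₂ ∧
    (∀ a b, (S a).left b = sliceLeft H.ε (R₁ (a ⊗ₜ b))) ∧
    ∀ a b, (S a).right b = sliceRight H.ε (R₂ (b ⊗ₜ a))

/-- The antipode `S : A → M(A)`, the unique map with `IsAntipode`. -/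
def antipode (H : WeakMultiplierHopfAlgebra A) : A →ₗ[ℂ] Multiplier A :=
  Classical.epsilon H.IsAntipode

/-- The antipode on `M(A)`: the unique extension of `S` to an anti-homomorphism, that is, `S(m)`
is the multiplier with `S(m)S(a) = S(am)` and `S(a)S(m) = S(ma)` for all `a` in `A`. -/
def antipodeM (H : WeakMultiplierHopfAlgebra A) (m : Multiplier A) : Multiplier A :=
  Classical.epsilon fun z => ∀ a : A,
    z * H.antipode a = H.antipode (m.right a) ∧ H.antipode a * z = H.antipode (m.left a)

/-- The source map `ε_s(a) = (ι ⊗ ε)((1 ⊗ a)E) = ∑ S(a₍₁₎)a₍₂₎` in `M(A)`, that is,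
`b ε_s(a) = (ι ⊗ ε)((b ⊗ a)E)` for all `b` in `A`; this determines the multiplier. -/
def sourceMap (H : WeakMultiplierHopfAlgebra A) (a : A) : Multiplier A :=
  Classical.epsilon fun y => ∀ b : A, y.right b = sliceRight H.ε (H.E.right (b ⊗ₜ a))

/-- The source algebra `ε_s(A)`. -/
def sourceAlgebra (H : WeakMultiplierHopfAlgebra A) : Set (Multiplier A) :=
  Set.range H.sourceMap

end WeakMultiplierHopfAlgebra

section Modules

/-- The action of `M(B)` on a unital left `B`-module `V`: the multiplier `m` acts by the linear
map with `m (b x) = (m b) x` for all `b` in `B` and `x` in `V`. Such a map is unique because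
`B V = V`, and it exists when the module is non-degenerate. -/
def multiplierAct {B : Type*} [NonUnitalRing B] [Module ℂ B] [IsScalarTower ℂ B B]
    [SMulCommClass ℂ B B] {V : Type*} [AddCommGroup V] [Module ℂ V]
    (act : B →ₗ[ℂ] V →ₗ[ℂ] V) (m : Multiplier B) : V →ₗ[ℂ] V :=
  Classical.epsilon fun f : V →ₗ[ℂ] V => ∀ b x, f (act b x) = act (m.left b) x

/-- The action `(a ⊗ b)(r ⊗ s) = a r ⊗ b s` of `A ⊗ A` on `R ⊗ R`. -/
def tensorAct {A : Type*} [NonUnitalRing A] [Module ℂ A] {R : Type*} [AddCommGroup R]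
    [Module ℂ R] (act : A →ₗ[ℂ] R →ₗ[ℂ] R) :
    A ⊗[ℂ] A →ₗ[ℂ] R ⊗[ℂ] R →ₗ[ℂ] R ⊗[ℂ] R :=
  TensorProduct.homTensorHomMap (RingHom.id ℂ) R R R R ∘ₗ TensorProduct.map act act

variable {A : Type*} [NonUnitalRing A] [Module ℂ A] [IsScalarTower ℂ A A] [SMulCommClass ℂ A A]
variable {R : Type*} [NonUnitalRing R] [Module ℂ R] [IsScalarTower ℂ R R] [SMulCommClass ℂ R R]

/-- The algebra `R` is a left module algebra for the action `a ▷ r = act a r`: a unital left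
`A`-module with `a ▷ m(x ⊗ y) = m(Δ(a) ▷ (x ⊗ y))`, where `m` is the product of `R`. -/
structure IsModuleAlgebra (H : WeakMultiplierHopfAlgebra A) (act : A →ₗ[ℂ] R →ₗ[ℂ] R) :
    Prop where
  mul_act : ∀ a b r, act (a * b) r = act a (act b r)
  unital : Submodule.span ℂ {x : R | ∃ a r, x = act a r} = ⊤
  act_mul : ∀ a x y, act a (x * y) =
    LinearMap.mul' ℂ R (multiplierAct (tensorAct act) (H.Δ a) (x ⊗ₜ y))

end Modules

end WMHA

end

noncomputable section

namespace WMHA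

set_option linter.unusedSectionVars false

/-! ### Slicing tensors over a field. -/

section TensorGeneralities

variable {V W V' W' : Type*} [AddCommGroup V] [Module ℂ V] [AddCommGroup W] [Module ℂ W]
  [AddCommGroup V'] [Module ℂ V'] [AddCommGroup W'] [Module ℂ W']

/-! The module algebra axiom sees `E` through Δ(a)E = Δ(a), which gives a ▷ m(E ▷ (r ⊗ r')) = a ▷
(rr') for every a. If A has left local units, each element of the unital module R is fixed by some
a, and m(E ▷ (r ⊗ r')) = rr' follows. The second identity then follows from the multiplier identity
E(y ⊗ 1) = E(1 ⊗ S(y)) for y in the source algebra. The work is thus inside A: to prove this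
identity, and to construct left local units, which are also what makes multipliers act on R and R ⊗
R.

The axioms give the value of ι ⊗ Δ at E. Coassociativity yields the counterpart for Δ ⊗ ι
(`tensorId_E_left`, `tensorId_E_right`), so E commutes with the canonical maps on overlapping legs.
Fullness determines G₁ and G₂ from their defining equations, so they inherit idempotency and
commutation from E. Hence the generalized inverses R₁, R₂ exist and commute with the opposite
canonical maps, the two halves of the antipode form a multiplier (`antipode_compat`), and S(A)A = A
= AS(A).

For y = ε_s(p), the pentagon equation gives Δ(q)(y ⊗ S(a)) = Δ(q)(1 ⊗ S(ay))
(`rTensor_sourceRight`), hence E(y ⊗ S(a)) = E(1 ⊗ S(ay)). This shows both that S(y) is well defined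
and that E(y ⊗ 1) = E(1 ⊗ S(y)) (`E_left_source_tmul_eq`).

For local units, E(a ⊗ q) lies in A ⊗ ε_t(A)q, where ε_t(A)q is finite-dimensional
(`finiteDimensional_range_targetAt`). A dual basis made of functionals whose slices of E are source
elements y_i gives E(a ⊗ q) = ∑ y_i a ⊗ v_i with v_i in ε_t(A)q. Applying a ⊗ b ↦ S(a)b and
cancelling S(a) yields q = ∑ S(y_i)v_i. Since ε_t(A)q is contained in Aq (`targetAt_mem`), q lies in
Aq. -/

/-- A tensor vanishes if its slices under a jointly injective family of maps on the first leg
vanish. -/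
theorem eq_zero_of_rTensor_eq_zero {ι : Type*} {g : ι → V →ₗ[ℂ] V'}
    (hg : ∀ v, (∀ i, g i v = 0) → v = 0) (Y : V ⊗[ℂ] W)
    (hY : ∀ i, (g i).rTensor W Y = 0) : Y = 0 := by
  classical
  -- A basis of W turns Y into a finitely supported family in V, on which each g i acts
  -- coordinatewise.
  let b := Module.Basis.ofVectorSpace ℂ W
  have key : ∀ (i) (k) (Z : V ⊗[ℂ] W),
      TensorProduct.equivFinsuppOfBasisRight b ((g i).rTensor W Z) k =
        g i (TensorProduct.equivFinsuppOfBasisRight b Z k) := by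
    intro i k Z
    induction Z using TensorProduct.induction_on with
    | zero => simp
    | add x y hx hy => simp only [map_add, Finsupp.add_apply, hx, hy]
    | tmul v w => simp
  apply (TensorProduct.equivFinsuppOfBasisRight b).injective
  rw [map_zero]
  ext k
  refine hg _ fun i => ?_
  rw [← key, hY, map_zero, Finsupp.zero_apply]

theorem eq_zero_of_lTensor_eq_zero {ι : Type*} {g : ι → V →ₗ[ℂ] V'}
    (hg : ∀ v, (∀ i, g i v = 0) → v = 0) (Y : W ⊗[ℂ] V)
    (hY : ∀ i, (g i).lTensor W Y = 0) : Y = 0 := by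
  apply (TensorProduct.comm ℂ W V).injective
  rw [map_zero]
  refine eq_zero_of_rTensor_eq_zero hg _ fun i => ?_
  have : (g i).rTensor W (TensorProduct.comm ℂ W V Y) =
      TensorProduct.comm ℂ W V' ((g i).lTensor W Y) := by
    rw [LinearMap.lTensor, LinearMap.rTensor, TensorProduct.map_comm]
  rw [this, hY, map_zero]

theorem mem_range_subtype_rTensor (U : Submodule ℂ V) (Y : V ⊗[ℂ] W)
    (hY : U.mkQ.rTensor W Y = 0) : Y ∈ LinearMap.range (U.subtype.rTensor W) := by
  have h : Function.Exact U.subtype U.mkQ := LinearMap.exact_subtype_mkQ U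
  exact (rTensor_exact W h U.mkQ_surjective Y).1 hY

theorem mem_range_subtype_lTensor (U : Submodule ℂ V) (Y : W ⊗[ℂ] V)
    (hY : U.mkQ.lTensor W Y = 0) : Y ∈ LinearMap.range (U.subtype.lTensor W) := by
  have h : Function.Exact U.subtype U.mkQ := LinearMap.exact_subtype_mkQ U
  exact (lTensor_exact W h U.mkQ_surjective Y).1 hY

theorem mkQ_lTensor_of_mem {U : Submodule ℂ V} {Y : W ⊗[ℂ] V}
    (hY : Y ∈ LinearMap.range (U.subtype.lTensor W)) : U.mkQ.lTensor W Y = 0 := by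
  have h : Function.Exact U.subtype U.mkQ := LinearMap.exact_subtype_mkQ U
  exact (lTensor_exact W h U.mkQ_surjective Y).2 hY

/-- The kernel of `f ⊗ ι` is the tensor product of the kernel of `f`. -/
theorem mem_range_ker_rTensor (f : V →ₗ[ℂ] V') (Y : V ⊗[ℂ] W) (hY : f.rTensor W Y = 0) :
    Y ∈ LinearMap.range ((LinearMap.ker f).subtype.rTensor W) := by
  exact (Module.Flat.rTensor_exact W (LinearMap.exact_subtype_ker_map f) Y).1 hY

theorem mem_range_ker_lTensor (f : V →ₗ[ℂ] V') (Y : W ⊗[ℂ] V) (hY : f.lTensor W Y = 0) :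
    Y ∈ LinearMap.range ((LinearMap.ker f).subtype.lTensor W) := by
  exact (Module.Flat.lTensor_exact W (LinearMap.exact_subtype_ker_map f) Y).1 hY

/-- A linear map that vanishes on the kernel of a surjection factors through it. -/
theorem exists_factor {α : V →ₗ[ℂ] W} (hα : Function.Surjective α) {β : V →ₗ[ℂ] V'}
    (h : ∀ v, α v = 0 → β v = 0) : ∃ f : W →ₗ[ℂ] V', ∀ v, f (α v) = β v := by
  obtain ⟨s, hs⟩ := α.exists_rightInverse_of_surjective (LinearMap.range_eq_top.2 hα)
  refine ⟨β ∘ₗ s, fun v => ?_⟩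
  have hs' : ∀ w, α (s w) = w := fun w => LinearMap.congr_fun hs w
  have := h (s (α v) - v) (by rw [map_sub, hs', sub_self])
  rwa [map_sub, sub_eq_zero] at this

end TensorGeneralities

/-! ### Multipliers and non-degenerate products. -/

section MultiplierBasics

variable {B : Type*} [NonUnitalRing B] [Module ℂ B] [IsScalarTower ℂ B B] [SMulCommClass ℂ B B]
variable {C : Type*} [NonUnitalRing C] [Module ℂ C] [IsScalarTower ℂ C C] [SMulCommClass ℂ C C]

namespace Multiplier

theorem left_mul (m : Multiplier B) (a b : B) : m.left (a * b) = m.left a * b := m.2.1 a b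

theorem right_mul (m : Multiplier B) (a b : B) : m.right (a * b) = a * m.right b := m.2.2.1 a b

theorem right_mul_eq (m : Multiplier B) (a b : B) : m.right a * b = a * m.left b := m.2.2.2 a b

@[simp] theorem mul_left (m n : Multiplier B) (b : B) : (m * n).left b = m.left (n.left b) := rfl

@[simp] theorem mul_right (m n : Multiplier B) (b : B) :
    (m * n).right b = n.right (m.right b) := rfl

@[simp] theorem one_left (b : B) : (1 : Multiplier B).left b = b := rfl

@[simp] theorem one_right (b : B) : (1 : Multiplier B).right b = b := rfl

@[simp] theorem of_left (x b : B) : (Multiplier.of B x).left b = x * b := rfl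

@[simp] theorem of_right (x b : B) : (Multiplier.of B x).right b = b * x := rfl

@[simp] theorem mk_left (l r : Module.End ℂ B) (h1 h2 h3) :
    (Multiplier.mk l r h1 h2 h3).left = l := rfl

@[simp] theorem mk_right (l r : Module.End ℂ B) (h1 h2 h3) :
    (Multiplier.mk l r h1 h2 h3).right = r := rfl

theorem tmul_left (m : Multiplier B) (n : Multiplier C) :
    (Multiplier.tmul m n).left = TensorProduct.map m.left n.left := rfl

theorem tmul_right (m : Multiplier B) (n : Multiplier C) :
    (Multiplier.tmul m n).right = TensorProduct.map m.right n.right := rfl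

theorem ext {m n : Multiplier B} (hl : ∀ b, m.left b = n.left b)
    (hr : ∀ b, m.right b = n.right b) : m = n :=
  Subtype.ext (Prod.ext (LinearMap.ext hl) (MulOpposite.unop_injective (LinearMap.ext hr)))

theorem one_left_eq : (1 : Multiplier B).left = LinearMap.id := rfl

theorem one_right_eq : (1 : Multiplier B).right = LinearMap.id := rfl

theorem mul_left_eq (m n : Multiplier B) : (m * n).left = m.left ∘ₗ n.left := rfl

theorem mul_right_eq (m n : Multiplier B) : (m * n).right = n.right ∘ₗ m.right := rfl

theorem tmul_mul_tmul (m m' : Multiplier B) (n n' : Multiplier C) :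
    Multiplier.tmul m n * Multiplier.tmul m' n' = Multiplier.tmul (m * m') (n * n') := by
  refine ext (fun b => ?_) (fun b => ?_)
  · rw [mul_left, tmul_left, tmul_left, tmul_left, mul_left_eq, mul_left_eq,
      TensorProduct.map_comp, LinearMap.comp_apply]
  · rw [mul_right, tmul_right, tmul_right, tmul_right, mul_right_eq, mul_right_eq,
      TensorProduct.map_comp, LinearMap.comp_apply]

theorem of_mul (m : Multiplier B) (x : B) :
    Multiplier.of B x * m = Multiplier.of B (m.right x) :=
  ext (fun b => by simp [right_mul_eq]) (fun b => by simp [right_mul])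

theorem mul_of (m : Multiplier B) (x : B) :
    m * Multiplier.of B x = Multiplier.of B (m.left x) :=
  ext (fun b => by simp [left_mul]) (fun b => by simp [right_mul_eq])

theorem of_mul_of (x y : B) :
    Multiplier.of B x * Multiplier.of B y = Multiplier.of B (x * y) := mul_of _ _

theorem tmul_of_of (b : B) (c : C) :
    Multiplier.tmul (Multiplier.of B b) (Multiplier.of C c) = Multiplier.of (B ⊗[ℂ] C) (b ⊗ₜ c) := by
  refine ext (fun t => ?_) (fun t => ?_)
  · rw [tmul_left]
    induction t using TensorProduct.induction_on with
    | zero => simp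
    | add x y hx hy => rw [map_add, map_add, hx, hy]
    | tmul x y => simp
  · rw [tmul_right]
    induction t using TensorProduct.induction_on with
    | zero => simp
    | add x y hx hy => rw [map_add, map_add, hx, hy]
    | tmul x y => simp

@[simp] theorem transport_left (e : B ≃ₗ[ℂ] C) (he) (m : Multiplier B) (c : C) :
    (transport e he m).left c = e (m.left (e.symm c)) := rfl

@[simp] theorem transport_right (e : B ≃ₗ[ℂ] C) (he) (m : Multiplier B) (c : C) :
    (transport e he m).right c = e (m.right (e.symm c)) := rfl

theorem transport_mul (e : B ≃ₗ[ℂ] C) (he) (m n : Multiplier B) :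
    transport e he (m * n) = transport e he m * transport e he n :=
  ext (fun c => by simp) (fun c => by simp)

theorem transport_of (e : B ≃ₗ[ℂ] C) (he : ∀ x y, e (x * y) = e x * e y) (x : B) :
    transport e he (Multiplier.of B x) = Multiplier.of C (e x) :=
  ext (fun c => by simp [he]) (fun c => by simp [he])

end Multiplier

/-- Non-degeneracy of the product. -/
structure NonDegenerate (B : Type*) [NonUnitalRing B] : Prop where
  left : ∀ a : B, (∀ b, a * b = 0) → a = 0
  right : ∀ a : B, (∀ b, b * a = 0) → a = 0

theorem NonDegenerate.eq_of_mul {B : Type*} [NonUnitalRing B] (hB : NonDegenerate B) {a b : B}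
    (h : ∀ c, a * c = b * c) : a = b :=
  sub_eq_zero.1 (hB.left _ fun c => by rw [sub_mul, h, sub_self])

theorem NonDegenerate.eq_of_mul' {B : Type*} [NonUnitalRing B] (hB : NonDegenerate B) {a b : B}
    (h : ∀ c, c * a = c * b) : a = b :=
  sub_eq_zero.1 (hB.right _ fun c => by rw [mul_sub, h, sub_self])

theorem NonDegenerate.of_injective (hB : NonDegenerate B) {x y : B}
    (h : Multiplier.of B x = Multiplier.of B y) : x = y :=
  hB.eq_of_mul fun c => by
    rw [← Multiplier.of_left, h, Multiplier.of_left]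

theorem NonDegenerate.multiplier_ext_left (hB : NonDegenerate B) {m n : Multiplier B}
    (h : ∀ b, m.left b = n.left b) : m = n :=
  Multiplier.ext h fun b => hB.eq_of_mul fun c => by
    rw [Multiplier.right_mul_eq, Multiplier.right_mul_eq, h]

theorem NonDegenerate.multiplier_ext_right (hB : NonDegenerate B) {m n : Multiplier B}
    (h : ∀ b, m.right b = n.right b) : m = n :=
  Multiplier.ext (fun b => hB.eq_of_mul' fun c => by
    rw [← Multiplier.right_mul_eq, ← Multiplier.right_mul_eq, h]) h

theorem NonDegenerate.multiplier_eq_of_of_mul (hB : NonDegenerate B) {m n : Multiplier B}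
    (h : ∀ b, Multiplier.of B b * m = Multiplier.of B b * n) : m = n :=
  hB.multiplier_ext_right fun b => hB.of_injective (by
    rw [← Multiplier.of_mul, ← Multiplier.of_mul, h])

theorem NonDegenerate.multiplier_eq_of_mul_of (hB : NonDegenerate B) {m n : Multiplier B}
    (h : ∀ b, m * Multiplier.of B b = n * Multiplier.of B b) : m = n :=
  hB.multiplier_ext_left fun b => hB.of_injective (by
    rw [← Multiplier.mul_of, ← Multiplier.mul_of, h])

theorem mul_tmul_eq (x : B ⊗[ℂ] C) (b : B) (c : C) :
    x * (b ⊗ₜ c) = (LinearMap.mulRight ℂ b).rTensor C ((LinearMap.mulRight ℂ c).lTensor B x) := by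
  induction x using TensorProduct.induction_on with
  | zero => simp
  | add x y hx hy => rw [add_mul, hx, hy, map_add, map_add]
  | tmul x y => simp

theorem tmul_mul_eq (x : B ⊗[ℂ] C) (b : B) (c : C) :
    (b ⊗ₜ c) * x = (LinearMap.mulLeft ℂ b).rTensor C ((LinearMap.mulLeft ℂ c).lTensor B x) := by
  induction x using TensorProduct.induction_on with
  | zero => simp
  | add x y hx hy => rw [mul_add, hx, hy, map_add, map_add]
  | tmul x y => simp

theorem NonDegenerate.tensor (hB : NonDegenerate B) (hC : NonDegenerate C) :
    NonDegenerate (B ⊗[ℂ] C) where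
  left x hx := by
    refine eq_zero_of_lTensor_eq_zero (g := fun c : C => LinearMap.mulRight ℂ c)
      (fun v hv => hC.left v hv) x fun c => ?_
    refine eq_zero_of_rTensor_eq_zero (g := fun b : B => LinearMap.mulRight ℂ b)
      (fun v hv => hB.left v hv) _ fun b => ?_
    rw [← mul_tmul_eq, hx]
  right x hx := by
    refine eq_zero_of_lTensor_eq_zero (g := fun c : C => LinearMap.mulLeft ℂ c)
      (fun v hv => hC.right v hv) x fun c => ?_
    refine eq_zero_of_rTensor_eq_zero (g := fun b : B => LinearMap.mulLeft ℂ b)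
      (fun v hv => hB.right v hv) _ fun b => ?_
    rw [← tmul_mul_eq, hx]

end MultiplierBasics

/-! ### Leg notation on A ⊗ A ⊗ A. -/

section Legs

variable {A : Type*} [NonUnitalRing A] [Module ℂ A] [IsScalarTower ℂ A A] [SMulCommClass ℂ A A]

/-- An operator on `A ⊗ A`, acting on the first two factors of `A ⊗ A ⊗ A`. -/
def op12 (T : Module.End ℂ (A ⊗[ℂ] A)) : Module.End ℂ (A ⊗[ℂ] (A ⊗[ℂ] A)) :=
  (TensorProduct.assoc ℂ A A A).toLinearMap ∘ₗ T.rTensor A ∘ₗ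
    (TensorProduct.assoc ℂ A A A).symm.toLinearMap

/-- An operator on `A ⊗ A`, acting on the last two factors of `A ⊗ A ⊗ A`. -/
def op23 (T : Module.End ℂ (A ⊗[ℂ] A)) : Module.End ℂ (A ⊗[ℂ] (A ⊗[ℂ] A)) :=
  T.lTensor A

@[simp] theorem op12_tmul (T : Module.End ℂ (A ⊗[ℂ] A)) (a b c : A) :
    op12 T (a ⊗ₜ (b ⊗ₜ c)) = TensorProduct.assoc ℂ A A A (T (a ⊗ₜ b) ⊗ₜ c) := by
  simp [op12]

theorem op12_assoc (T : Module.End ℂ (A ⊗[ℂ] A)) (t : (A ⊗[ℂ] A) ⊗[ℂ] A) :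
    op12 T (TensorProduct.assoc ℂ A A A t) = TensorProduct.assoc ℂ A A A (T.rTensor A t) := by
  simp [op12]

@[simp] theorem op23_tmul (T : Module.End ℂ (A ⊗[ℂ] A)) (a : A) (t : A ⊗[ℂ] A) :
    op23 T (a ⊗ₜ t) = a ⊗ₜ T t := by
  simp [op23]

theorem op12_mul (S T : Module.End ℂ (A ⊗[ℂ] A)) : op12 (S * T) = op12 S * op12 T := by
  ext a b c
  simp [op12, Module.End.mul_eq_comp]

theorem op23_mul (S T : Module.End ℂ (A ⊗[ℂ] A)) : op23 (S * T) = op23 S * op23 T := by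
  simp [op23, LinearMap.lTensor_mul]

theorem leg12_left (F : Multiplier (A ⊗[ℂ] A)) : (leg12 F).left = op12 F.left := rfl

theorem leg12_right (F : Multiplier (A ⊗[ℂ] A)) : (leg12 F).right = op12 F.right := rfl

theorem leg23_left (F : Multiplier (A ⊗[ℂ] A)) : (leg23 F).left = op23 F.left := rfl

theorem leg23_right (F : Multiplier (A ⊗[ℂ] A)) : (leg23 F).right = op23 F.right := rfl

theorem leg12_mul (F G : Multiplier (A ⊗[ℂ] A)) : leg12 (F * G) = leg12 F * leg12 G := by
  rw [leg12, leg12, leg12, ← Multiplier.transport_mul, Multiplier.tmul_mul_tmul, mul_one]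

theorem leg23_mul (F G : Multiplier (A ⊗[ℂ] A)) : leg23 (F * G) = leg23 F * leg23 G := by
  rw [leg23, leg23, leg23, Multiplier.tmul_mul_tmul, mul_one]

theorem tmul_one_one : Multiplier.tmul (1 : Multiplier A) (1 : Multiplier A) = 1 :=
  Multiplier.ext (fun b => by
      rw [Multiplier.tmul_left, Multiplier.one_left_eq, TensorProduct.map_id]; rfl)
    (fun b => by rw [Multiplier.tmul_right, Multiplier.one_right_eq, TensorProduct.map_id]; rfl)

theorem transport_assoc_tmul (k m n : Multiplier A) :
    Multiplier.transport (TensorProduct.assoc ℂ A A A) (assoc_mul A)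
      (Multiplier.tmul (Multiplier.tmul k m) n) = Multiplier.tmul k (Multiplier.tmul m n) := by
  refine Multiplier.ext (fun b => ?_) (fun b => ?_)
  · rw [Multiplier.transport_left]
    simp only [Multiplier.tmul_left]
    have h : (TensorProduct.assoc ℂ A A A).toLinearMap ∘ₗ
        TensorProduct.map (TensorProduct.map k.left m.left) n.left ∘ₗ
        (TensorProduct.assoc ℂ A A A).symm.toLinearMap =
        TensorProduct.map k.left (TensorProduct.map m.left n.left) := by
      ext a b c
      simp
    exact LinearMap.congr_fun h b
  · rw [Multiplier.transport_right]
    simp only [Multiplier.tmul_right]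
    have h : (TensorProduct.assoc ℂ A A A).toLinearMap ∘ₗ
        TensorProduct.map (TensorProduct.map k.right m.right) n.right ∘ₗ
        (TensorProduct.assoc ℂ A A A).symm.toLinearMap =
        TensorProduct.map k.right (TensorProduct.map m.right n.right) := by
      ext a b c
      simp
    exact LinearMap.congr_fun h b

/-- `c ⊗ 1 ⊗ 1`. -/
def inFirst (c : A) : Multiplier (A ⊗[ℂ] (A ⊗[ℂ] A)) :=
  Multiplier.tmul (Multiplier.of A c) 1

/-- `1 ⊗ 1 ⊗ b`. -/
def inThird (b : A) : Multiplier (A ⊗[ℂ] (A ⊗[ℂ] A)) :=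
  Multiplier.tmul 1 (Multiplier.tmul 1 (Multiplier.of A b))

theorem leg12_mul_inThird (F : Multiplier (A ⊗[ℂ] A)) (b : A) :
    leg12 F * inThird b = Multiplier.transport (TensorProduct.assoc ℂ A A A) (assoc_mul A)
      (Multiplier.tmul F (Multiplier.of A b)) := by
  rw [leg12, inThird, ← transport_assoc_tmul, ← Multiplier.transport_mul, tmul_one_one,
    Multiplier.tmul_mul_tmul, mul_one, one_mul]

theorem inThird_mul_leg12 (F : Multiplier (A ⊗[ℂ] A)) (b : A) :
    inThird b * leg12 F = leg12 F * inThird b := by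
  rw [leg12_mul_inThird, leg12, inThird, ← transport_assoc_tmul, ← Multiplier.transport_mul,
    tmul_one_one, Multiplier.tmul_mul_tmul, mul_one, one_mul]

theorem inFirst_mul_leg23 (F : Multiplier (A ⊗[ℂ] A)) (b : A) :
    inFirst b * leg23 F = leg23 F * inFirst b := by
  rw [inFirst, leg23, Multiplier.tmul_mul_tmul, Multiplier.tmul_mul_tmul, mul_one, one_mul,
    mul_one, one_mul]

theorem inFirst_eq_leg12 (c : A) :
    inFirst c = leg12 (Multiplier.tmul (Multiplier.of A c) 1) := by
  rw [leg12, transport_assoc_tmul, tmul_one_one, inFirst]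

theorem of_assoc_tmul (t : A ⊗[ℂ] A) (c : A) :
    Multiplier.of _ (TensorProduct.assoc ℂ A A A (t ⊗ₜ c)) =
      leg12 (Multiplier.of (A ⊗[ℂ] A) t) * inThird c := by
  rw [leg12_mul_inThird, Multiplier.tmul_of_of, Multiplier.transport_of]

/-- Transport of multipliers as a linear map. -/
def transportₗ {B C : Type*} [NonUnitalRing B] [Module ℂ B] [IsScalarTower ℂ B B]
    [SMulCommClass ℂ B B] [NonUnitalRing C] [Module ℂ C] [IsScalarTower ℂ C C]
    [SMulCommClass ℂ C C] (e : B ≃ₗ[ℂ] C) (he : ∀ x y, e (x * y) = e x * e y) :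
    Multiplier B →ₗ[ℂ] Multiplier C where
  toFun := Multiplier.transport e he
  map_add' _ _ := Multiplier.ext (fun _ => map_add e _ _) (fun _ => map_add e _ _)
  map_smul' _ _ := Multiplier.ext (fun _ => map_smul e _ _) (fun _ => map_smul e _ _)

/-- `Δ ⊗ ι : A ⊗ A → M(A ⊗ A ⊗ A)`. -/
def tensorId (Δ : A →ₗ[ℂ] Multiplier (A ⊗[ℂ] A)) :
    A ⊗[ℂ] A →ₗ[ℂ] Multiplier (A ⊗[ℂ] (A ⊗[ℂ] A)) :=
  transportₗ (TensorProduct.assoc ℂ A A A) (assoc_mul A) ∘ₗ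
    TensorProduct.lift ((Multiplier.tmulₗ (A ⊗[ℂ] A) A).compl₁₂ Δ (Multiplier.of A))

end Legs

/-! ### Coassociativity in multiplier form, and commutation of E with the canonical maps. -/

namespace WeakMultiplierHopfAlgebra

variable {A : Type*} [NonUnitalRing A] [Module ℂ A] [IsScalarTower ℂ A A] [SMulCommClass ℂ A A]
  (H : WeakMultiplierHopfAlgebra A)

theorem nondeg (H : WeakMultiplierHopfAlgebra A) : NonDegenerate A := ⟨H.left_nondeg, H.right_nondeg⟩

theorem nondeg₂ (H : WeakMultiplierHopfAlgebra A) : NonDegenerate (A ⊗[ℂ] A) := H.nondeg.tensor H.nondeg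

theorem nondeg₃ (H : WeakMultiplierHopfAlgebra A) : NonDegenerate (A ⊗[ℂ] (A ⊗[ℂ] A)) := H.nondeg.tensor H.nondeg₂

/-- The coproduct as a linear map. -/
abbrev Δₗ : A →ₗ[ℂ] Multiplier (A ⊗[ℂ] A) := (H.Δ : A →ₗ[ℂ] Multiplier (A ⊗[ℂ] A))

theorem tensorId_tmul (a b : A) :
    tensorId H.Δₗ (a ⊗ₜ b) = leg12 (H.Δ a) * inThird b := by
  rw [leg12_mul_inThird]
  rfl

theorem idTensor_tmul (a b : A) :
    idTensor H.Δₗ (a ⊗ₜ b) = inFirst a * leg23 (H.Δ b) := by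
  rw [inFirst, leg23, Multiplier.tmul_mul_tmul, mul_one, one_mul]
  rfl

theorem E_left_E_left (t : A ⊗[ℂ] A) : H.E.left (H.E.left t) = H.E.left t := by
  rw [← Multiplier.mul_left, H.E_idem]

theorem E_right_E_right (t : A ⊗[ℂ] A) : H.E.right (H.E.right t) = H.E.right t := by
  rw [← Multiplier.mul_right, H.E_idem]

theorem E_left_T₁ (t : A ⊗[ℂ] A) : H.E.left (H.T₁ t) = H.T₁ t := by
  have : H.T₁ t ∈ LinearMap.range H.E.left := H.range_T₁ ▸ LinearMap.mem_range_self _ t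
  obtain ⟨s, hs⟩ := this
  rw [← hs, E_left_E_left]

theorem E_right_T₂ (t : A ⊗[ℂ] A) : H.E.right (H.T₂ t) = H.T₂ t := by
  have : H.T₂ t ∈ LinearMap.range H.E.right := H.range_T₂ ▸ LinearMap.mem_range_self _ t
  obtain ⟨s, hs⟩ := this
  rw [← hs, E_right_E_right]

theorem exists_T₁ (t : A ⊗[ℂ] A) : ∃ s, H.T₁ s = H.E.left t := by
  have : H.E.left t ∈ LinearMap.range H.T₁ := H.range_T₁ ▸ LinearMap.mem_range_self _ t
  exact this

theorem exists_T₂ (t : A ⊗[ℂ] A) : ∃ s, H.T₂ s = H.E.right t := by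
  have : H.E.right t ∈ LinearMap.range H.T₂ := H.range_T₂ ▸ LinearMap.mem_range_self _ t
  exact this

/-- `Δ(a)(p ⊗ b) = T₁(a ⊗ b)(p ⊗ 1)`. -/
theorem Δ_left_tmul (a p b : A) :
    (H.Δ a).left (p ⊗ₜ b) = (LinearMap.mulRight ℂ p).rTensor A (H.T₁ (a ⊗ₜ b)) := by
  apply H.nondeg₂.of_injective
  rw [← Multiplier.mul_of, ← Multiplier.tmul_of_of]
  have h1 : Multiplier.tmul (Multiplier.of A p) (Multiplier.of A b) =
      Multiplier.tmul 1 (Multiplier.of A b) * Multiplier.tmul (Multiplier.of A p) 1 := by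
    rw [Multiplier.tmul_mul_tmul, mul_one, one_mul]
  rw [h1, ← mul_assoc, ← H.T₁_spec, Multiplier.of_mul]
  rfl

/-- `(c ⊗ d)Δ(a) = (1 ⊗ d)T₂(c ⊗ a)`. -/
theorem Δ_right_tmul (a c d : A) :
    (H.Δ a).right (c ⊗ₜ d) = (LinearMap.mulLeft ℂ d).lTensor A (H.T₂ (c ⊗ₜ a)) := by
  apply H.nondeg₂.of_injective
  rw [← Multiplier.of_mul, ← Multiplier.tmul_of_of]
  have h1 : Multiplier.tmul (Multiplier.of A c) (Multiplier.of A d) =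
      Multiplier.tmul 1 (Multiplier.of A d) * Multiplier.tmul (Multiplier.of A c) 1 := by
    rw [Multiplier.tmul_mul_tmul, mul_one, one_mul]
  rw [h1, mul_assoc, ← H.T₂_spec, Multiplier.mul_of]
  rfl

/-- E fixes the range of `T₁`, and Δ(a)(p ⊗ b) arises from T₁(a ⊗ b) by a right multiplication, with
which E commutes. -/
theorem E_mul_Δ (a : A) : H.E * H.Δ a = H.Δ a := by
  refine H.nondeg₂.multiplier_ext_left fun t => ?_
  refine LinearMap.congr_fun (f := (H.E * H.Δ a).left) (g := (H.Δ a).left) ?_ t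
  refine TensorProduct.ext' fun p b => ?_
  have h : ∀ t : A ⊗[ℂ] A, H.E.left ((LinearMap.mulRight ℂ p).rTensor A t) =
      (LinearMap.mulRight ℂ p).rTensor A (H.E.left t) := by
    intro t
    refine H.nondeg₂.eq_of_mul' fun w => ?_
    have h2 : ∀ x y : A ⊗[ℂ] A, x * (LinearMap.mulRight ℂ p).rTensor A y =
        (LinearMap.mulRight ℂ p).rTensor A (x * y) := fun x y =>
      ((Multiplier.tmul (Multiplier.of A p) 1).right_mul x y).symm
    rw [← Multiplier.right_mul_eq, h2, h2, Multiplier.right_mul_eq]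
  rw [Multiplier.mul_left, H.Δ_left_tmul, h, H.E_left_T₁]

theorem Δ_mul_E (a : A) : H.Δ a * H.E = H.Δ a := by
  refine H.nondeg₂.multiplier_ext_right fun t => ?_
  refine LinearMap.congr_fun (f := (H.Δ a * H.E).right) (g := (H.Δ a).right) ?_ t
  refine TensorProduct.ext' fun c d => ?_
  have h : ∀ t : A ⊗[ℂ] A, H.E.right ((LinearMap.mulLeft ℂ d).lTensor A t) =
      (LinearMap.mulLeft ℂ d).lTensor A (H.E.right t) := by
    intro t
    refine H.nondeg₂.eq_of_mul fun w => ?_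
    have h2 : ∀ x y : A ⊗[ℂ] A, (LinearMap.mulLeft ℂ d).lTensor A x * y =
        (LinearMap.mulLeft ℂ d).lTensor A (x * y) := fun x y =>
      ((Multiplier.tmul 1 (Multiplier.of A d)).left_mul x y).symm
    rw [Multiplier.right_mul_eq, h2, h2, Multiplier.right_mul_eq]
  rw [Multiplier.mul_right, H.Δ_right_tmul, h, H.E_right_T₂]

theorem idTensor_mul_inThird (t : A ⊗[ℂ] A) (d : A) :
    idTensor H.Δₗ t * inThird d = Multiplier.of _ (op23 H.T₁ (TensorProduct.assoc ℂ A A A (t ⊗ₜ d))) := by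
  induction t using TensorProduct.induction_on with
  | zero => simp
  | add x y hx hy => simp only [map_add, add_mul, TensorProduct.add_tmul, hx, hy]
  | tmul a b =>
    rw [TensorProduct.assoc_tmul, op23_tmul, ← Multiplier.tmul_of_of, H.T₁_spec, idTensor_tmul,
      inFirst, leg23, inThird, Multiplier.tmul_mul_tmul, Multiplier.tmul_mul_tmul, mul_one, mul_one,
      one_mul]

theorem inFirst_mul_tensorId (c : A) (t : A ⊗[ℂ] A) :
    inFirst c * tensorId H.Δₗ t = Multiplier.of _ (op12 H.T₂ (c ⊗ₜ t)) := by
  induction t using TensorProduct.induction_on with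
  | zero => simp
  | add x y hx hy => simp only [map_add, mul_add, TensorProduct.tmul_add, hx, hy]
  | tmul a b =>
    rw [op12_tmul, of_assoc_tmul, H.T₂_spec, tensorId_tmul, ← mul_assoc, inFirst_eq_leg12,
      ← leg12_mul]

/-- This is the axiom `coassoc` read in M(A ⊗ A ⊗ A), where it can be multiplied by other
multipliers. -/
theorem idTensor_T₂ (a b c : A) :
    idTensor H.Δₗ (H.T₂ (c ⊗ₜ a)) * inThird b = inFirst c * tensorId H.Δₗ (H.T₁ (a ⊗ₜ b)) := by
  rw [idTensor_mul_inThird, inFirst_mul_tensorId]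
  congr 1
  exact (H.coassoc a b c).symm

theorem tensorId_mul_leg12 (s : A ⊗[ℂ] A) (p : A) :
    tensorId H.Δₗ s * leg12 (H.Δ p) = tensorId H.Δₗ ((LinearMap.mulRight ℂ p).rTensor A s) := by
  induction s using TensorProduct.induction_on with
  | zero => simp
  | add x y hx hy => simp only [map_add, add_mul, hx, hy]
  | tmul a b =>
    rw [LinearMap.rTensor_tmul, tensorId_tmul, tensorId_tmul, mul_assoc, inThird_mul_leg12,
      ← mul_assoc, ← leg12_mul]
    congr 2
    exact (map_mul H.Δ a p).symm

theorem inThird_mul (a b : A) : inThird a * inThird b = inThird (a * b) := by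
  simp only [inThird, Multiplier.tmul_mul_tmul, mul_one, Multiplier.of_mul_of]

theorem tensorId_mul (s t : A ⊗[ℂ] A) :
    tensorId H.Δₗ (s * t) = tensorId H.Δₗ s * tensorId H.Δₗ t := by
  induction t using TensorProduct.induction_on with
  | zero => simp
  | add x y hx hy => simp only [map_add, mul_add, hx, hy]
  | tmul p b =>
    rw [tensorId_tmul, ← mul_assoc]
    rw [tensorId_mul_leg12]
    induction s using TensorProduct.induction_on with
    | zero => simp
    | add x y hx hy => simp only [map_add, add_mul, hx, hy]
    | tmul q c =>
      rw [LinearMap.rTensor_tmul, tensorId_tmul, mul_assoc, inThird_mul,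
        Algebra.TensorProduct.tmul_mul_tmul, tensorId_tmul]
      rfl

theorem idTensor_T₂_mul_tensorId (a c : A) (t : A ⊗[ℂ] A) :
    idTensor H.Δₗ (H.T₂ (c ⊗ₜ a)) * tensorId H.Δₗ t =
      inFirst c * tensorId H.Δₗ ((H.Δ a).left t) := by
  induction t using TensorProduct.induction_on with
  | zero => simp
  | add x y hx hy => simp only [map_add, mul_add, hx, hy]
  | tmul p b =>
    rw [tensorId_tmul, ← inThird_mul_leg12, ← mul_assoc, idTensor_T₂, mul_assoc, H.Δ_left_tmul]
    rw [tensorId_mul_leg12]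

theorem leg12_E_mul_tensorId (t : A ⊗[ℂ] A) :
    leg12 H.E * tensorId H.Δₗ t = tensorId H.Δₗ t := by
  induction t using TensorProduct.induction_on with
  | zero => simp
  | add x y hx hy => simp only [map_add, mul_add, hx, hy]
  | tmul p b =>
    rw [tensorId_tmul, ← mul_assoc, ← leg12_mul]
    rw [H.E_mul_Δ]

theorem tensorId_mul_leg12_E (t : A ⊗[ℂ] A) :
    tensorId H.Δₗ t * leg12 H.E = tensorId H.Δₗ t := by
  induction t using TensorProduct.induction_on with
  | zero => simp
  | add x y hx hy => simp only [map_add, add_mul, hx, hy]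
  | tmul p b =>
    rw [tensorId_tmul, mul_assoc, inThird_mul_leg12, ← mul_assoc, ← leg12_mul]
    rw [H.Δ_mul_E]

theorem leg23_E_mul_idTensor (t : A ⊗[ℂ] A) :
    leg23 H.E * idTensor H.Δₗ t = idTensor H.Δₗ t := by
  induction t using TensorProduct.induction_on with
  | zero => simp
  | add x y hx hy => simp only [map_add, mul_add, hx, hy]
  | tmul p b =>
    rw [idTensor_tmul, ← mul_assoc, ← inFirst_mul_leg23, mul_assoc, ← leg23_mul]
    rw [H.E_mul_Δ]

theorem idTensor_mul_leg23_E (t : A ⊗[ℂ] A) :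
    idTensor H.Δₗ t * leg23 H.E = idTensor H.Δₗ t := by
  induction t using TensorProduct.induction_on with
  | zero => simp
  | add x y hx hy => simp only [map_add, add_mul, hx, hy]
  | tmul p b =>
    rw [idTensor_tmul, mul_assoc, ← leg23_mul]
    rw [H.Δ_mul_E]

theorem eq_of_inFirst_mul (H : WeakMultiplierHopfAlgebra A) {m n : Multiplier (A ⊗[ℂ] (A ⊗[ℂ] A))}
    (h : ∀ c, inFirst c * m = inFirst c * n) : m = n := by
  refine H.nondeg₃.multiplier_eq_of_of_mul fun w => ?_
  induction w using TensorProduct.induction_on with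
  | zero => simp
  | add x y hx hy => simp only [map_add, add_mul, hx, hy]
  | tmul c t =>
    have : Multiplier.of _ (c ⊗ₜ t) = Multiplier.tmul 1 (Multiplier.of (A ⊗[ℂ] A) t) * inFirst c := by
      rw [inFirst, Multiplier.tmul_mul_tmul, mul_one, one_mul, Multiplier.tmul_of_of]
    rw [this, mul_assoc, h, mul_assoc]

theorem eq_of_mul_inThird (H : WeakMultiplierHopfAlgebra A) {m n : Multiplier (A ⊗[ℂ] (A ⊗[ℂ] A))}
    (h : ∀ c, m * inThird c = n * inThird c) : m = n := by
  refine H.nondeg₃.multiplier_eq_of_mul_of fun w => ?_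
  obtain ⟨w, rfl⟩ := (TensorProduct.assoc ℂ A A A).surjective w
  induction w using TensorProduct.induction_on with
  | zero => simp
  | add x y hx hy => simp only [map_add, mul_add, hx, hy]
  | tmul t c =>
    rw [of_assoc_tmul, ← inThird_mul_leg12, ← mul_assoc, h, mul_assoc]

/-- `(Δ ⊗ ι)(E t) = (1 ⊗ E)(Δ ⊗ ι)(t)`. -/
theorem tensorId_E_left (t : A ⊗[ℂ] A) :
    tensorId H.Δₗ (H.E.left t) = leg23 H.E * tensorId H.Δₗ t := by
  -- Since Et is in the range of `T₁`, coassociativity rewrites (Δ ⊗ ι)(Et) through ι ⊗ Δ, whose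
  -- values are fixed by 1 ⊗ E.
  have h1 : leg23 H.E * tensorId H.Δₗ (H.E.left t) = tensorId H.Δₗ (H.E.left t) := by
    obtain ⟨s, hs⟩ := H.exists_T₁ t
    rw [← hs]
    refine H.eq_of_inFirst_mul fun c => ?_
    rw [← mul_assoc, inFirst_mul_leg23, mul_assoc]
    clear hs
    induction s using TensorProduct.induction_on with
    | zero => simp
    | add x y hx hy => simp only [map_add, mul_add, hx, hy]
    | tmul a b => rw [← idTensor_T₂, ← mul_assoc, leg23_E_mul_idTensor]
  -- The factor E ⊗ 1 can be inserted in front of (Δ ⊗ ι)(x), and the given value of ι ⊗ Δ at E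
  -- absorbs it into u. As uE is in the range of `T₂`, coassociativity leaves only (Δ ⊗ ι)(Δ(a)x),
  -- which does not change when x is replaced by Ex.
  have h2 : ∀ u : A ⊗[ℂ] A,
      idTensor H.Δₗ u * (leg23 H.E * tensorId H.Δₗ (H.E.left t)) =
        idTensor H.Δₗ u * (leg23 H.E * tensorId H.Δₗ t) := by
    intro u
    have h3 : ∀ x : A ⊗[ℂ] A, idTensor H.Δₗ u * (leg23 H.E * tensorId H.Δₗ x) =
        idTensor H.Δₗ (H.E.right u) * tensorId H.Δₗ x := by
      intro x
      rw [← H.idTensor_E.2.2.2, H.E_comm]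
      simp only [mul_assoc, leg12_E_mul_tensorId]
    rw [h3, h3]
    obtain ⟨s, hs⟩ := H.exists_T₂ u
    rw [← hs]
    clear hs
    induction s using TensorProduct.induction_on with
    | zero => simp
    | add x y hx hy => simp only [map_add, add_mul, hx, hy]
    | tmul c a =>
      rw [idTensor_T₂_mul_tensorId, idTensor_T₂_mul_tensorId, ← Multiplier.mul_left, H.Δ_mul_E]
  rw [← h1]
  -- Both sides now start with 1 ⊗ E. Elements w(1 ⊗ E) are combinations of terms ending in (ι ⊗
  -- Δ)(u)(1 ⊗ E), so `h2` suffices.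
  refine H.nondeg₃.multiplier_eq_of_of_mul fun w => ?_
  rw [← mul_assoc, ← mul_assoc, Multiplier.of_mul]
  induction w using TensorProduct.induction_on with
  | zero => simp
  | add x y hx hy => simp only [map_add, add_mul, hx, hy]
  | tmul c w =>
    rw [leg23_right, op23_tmul]
    obtain ⟨s, hs⟩ := H.exists_T₂ w
    rw [← hs]
    clear hs
    induction s using TensorProduct.induction_on with
    | zero => simp
    | add x y hx hy => simp only [map_add, TensorProduct.tmul_add, add_mul, hx, hy]
    | tmul d q =>
      have h4 : Multiplier.of _ (c ⊗ₜ H.T₂ (d ⊗ₜ q)) =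
          leg23 (Multiplier.tmul (Multiplier.of A d) 1) * idTensor H.Δₗ (c ⊗ₜ q) * leg23 H.E := by
        rw [mul_assoc, idTensor_mul_leg23_E, ← Multiplier.tmul_of_of, H.T₂_spec, idTensor_tmul,
          ← mul_assoc, ← inFirst_mul_leg23, mul_assoc, ← leg23_mul, inFirst, leg23,
          Multiplier.tmul_mul_tmul, mul_one, one_mul]
      rw [h4]
      simp only [mul_assoc]
      rw [h2]

/-- `(Δ ⊗ ι)(t E) = (Δ ⊗ ι)(t)(1 ⊗ E)`. -/
theorem tensorId_E_right (t : A ⊗[ℂ] A) :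
    tensorId H.Δₗ (H.E.right t) = tensorId H.Δₗ t * leg23 H.E := by
  -- This is the left-handed version multiplied from the left by (Δ ⊗ ι)(t). To cancel (Δ ⊗ ι)(t'),
  -- a factor E ⊗ 1 is appended on the right; E(A ⊗ A) is the range of `T₁`, so it is spanned by the
  -- elements Δ(p)(1 ⊗ q).
  have h1 : ∀ t', tensorId H.Δₗ (H.E.right t) * tensorId H.Δₗ t' =
      tensorId H.Δₗ t * leg23 H.E * tensorId H.Δₗ t' := by
    intro t'
    rw [← tensorId_mul, Multiplier.right_mul_eq, tensorId_mul, tensorId_E_left, mul_assoc]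
  have h2 : tensorId H.Δₗ t * leg23 H.E * leg12 H.E = tensorId H.Δₗ t * leg23 H.E := by
    rw [mul_assoc, ← H.E_comm, ← mul_assoc, tensorId_mul_leg12_E]
  rw [← h2, ← H.tensorId_mul_leg12_E]
  refine H.eq_of_mul_inThird fun b => ?_
  rw [mul_assoc, mul_assoc _ (leg12 H.E)]
  refine H.nondeg₃.multiplier_eq_of_mul_of fun w => ?_
  have h5 : ∀ m : Multiplier (A ⊗[ℂ] (A ⊗[ℂ] A)), m * (leg12 H.E * inThird b) * Multiplier.of _ w =
      m * (inThird b * Multiplier.of _ ((leg12 H.E).left w)) := fun m => by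
    rw [← inThird_mul_leg12, ← Multiplier.mul_of, mul_assoc, mul_assoc]
  rw [h5, h5]
  clear h5
  obtain ⟨w, rfl⟩ := (TensorProduct.assoc ℂ A A A).surjective w
  rw [leg12_left, op12_assoc]
  induction w using TensorProduct.induction_on with
  | zero => simp
  | add x y hx hy => simp only [map_add, mul_add, hx, hy]
  | tmul w d =>
    rw [LinearMap.rTensor_tmul]
    obtain ⟨s, hs⟩ := H.exists_T₁ w
    rw [← hs]
    clear hs
    induction s using TensorProduct.induction_on with
    | zero => simp
    | add x y hx hy => simp only [map_add, TensorProduct.add_tmul, mul_add, hx, hy]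
    | tmul p q =>
      have h4 : inThird b * Multiplier.of _ (TensorProduct.assoc ℂ A A A (H.T₁ (p ⊗ₜ q) ⊗ₜ d)) =
          tensorId H.Δₗ (p ⊗ₜ (b * d)) * leg12 (Multiplier.tmul 1 (Multiplier.of A q)) := by
        rw [of_assoc_tmul, H.T₁_spec, ← inThird_mul_leg12, ← mul_assoc, inThird_mul, leg12_mul,
          ← mul_assoc, inThird_mul_leg12, tensorId_tmul]
      rw [h4, ← mul_assoc, h1, mul_assoc]

/-- `E₂₃` commutes with `T₂` on the first two factors. -/
theorem op23_E_left_op12_T₂ (t : A ⊗[ℂ] (A ⊗[ℂ] A)) :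
    op23 H.E.left (op12 H.T₂ t) = op12 H.T₂ (op23 H.E.left t) := by
  induction t using TensorProduct.induction_on with
  | zero => simp
  | add x y hx hy => simp only [map_add, hx, hy]
  | tmul c t =>
    apply H.nondeg₃.of_injective
    rw [op23_tmul, ← inFirst_mul_tensorId, tensorId_E_left, ← mul_assoc, inFirst_mul_leg23,
      mul_assoc, inFirst_mul_tensorId, Multiplier.mul_of, leg23_left]

theorem op23_E_right_op12_T₂ (t : A ⊗[ℂ] (A ⊗[ℂ] A)) :
    op23 H.E.right (op12 H.T₂ t) = op12 H.T₂ (op23 H.E.right t) := by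
  induction t using TensorProduct.induction_on with
  | zero => simp
  | add x y hx hy => simp only [map_add, hx, hy]
  | tmul c t =>
    apply H.nondeg₃.of_injective
    rw [op23_tmul, ← inFirst_mul_tensorId, tensorId_E_right, ← mul_assoc,
      inFirst_mul_tensorId, Multiplier.of_mul, leg23_right]

theorem op12_E_left_op23_T₁ (t : A ⊗[ℂ] (A ⊗[ℂ] A)) :
    op12 H.E.left (op23 H.T₁ t) = op23 H.T₁ (op12 H.E.left t) := by
  obtain ⟨t, rfl⟩ := (TensorProduct.assoc ℂ A A A).surjective t
  induction t using TensorProduct.induction_on with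
  | zero => simp
  | add x y hx hy => simp only [map_add, hx, hy]
  | tmul t d =>
    apply H.nondeg₃.of_injective
    rw [op12_assoc, LinearMap.rTensor_tmul, ← idTensor_mul_inThird, ← H.idTensor_E.2.2.1,
      ← leg12_left, ← Multiplier.mul_of, ← idTensor_mul_inThird, mul_assoc (leg12 H.E),
      leg23_E_mul_idTensor, mul_assoc]

theorem op12_E_right_op23_T₁ (t : A ⊗[ℂ] (A ⊗[ℂ] A)) :
    op12 H.E.right (op23 H.T₁ t) = op23 H.T₁ (op12 H.E.right t) := by
  obtain ⟨t, rfl⟩ := (TensorProduct.assoc ℂ A A A).surjective t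
  induction t using TensorProduct.induction_on with
  | zero => simp
  | add x y hx hy => simp only [map_add, hx, hy]
  | tmul t d =>
    apply H.nondeg₃.of_injective
    rw [op12_assoc, LinearMap.rTensor_tmul, ← idTensor_mul_inThird, ← H.idTensor_E.2.2.2,
      H.E_comm, ← leg12_right, ← Multiplier.of_mul, ← idTensor_mul_inThird, ← mul_assoc,
      idTensor_mul_leg23_E, mul_assoc, mul_assoc, inThird_mul_leg12]

theorem op12_E_left_op23_E_left (t : A ⊗[ℂ] (A ⊗[ℂ] A)) :
    op12 H.E.left (op23 H.E.left t) = op23 H.E.left (op12 H.E.left t) := by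
  have := congrArg (fun m => m.left t) H.E_comm
  simpa [leg12_left, leg23_left] using this

theorem op12_E_right_op23_E_right (t : A ⊗[ℂ] (A ⊗[ℂ] A)) :
    op12 H.E.right (op23 H.E.right t) = op23 H.E.right (op12 H.E.right t) := by
  have := congrArg (fun m => m.right t) H.E_comm
  simpa [leg12_right, leg23_right] using this.symm

end WeakMultiplierHopfAlgebra

/-! ### Slice maps by functionals. -/

section Slices

variable {A : Type*} [NonUnitalRing A] [Module ℂ A] [IsScalarTower ℂ A A] [SMulCommClass ℂ A A]

@[simp] theorem sliceLeft_tmul (φ : A →ₗ[ℂ] ℂ) (a b : A) : sliceLeft φ (a ⊗ₜ b) = φ a • b := by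
  simp [sliceLeft]

@[simp] theorem sliceRight_tmul (φ : A →ₗ[ℂ] ℂ) (a b : A) : sliceRight φ (a ⊗ₜ b) = φ b • a := by
  simp [sliceRight]

theorem sliceLeft_mul_right (φ : A →ₗ[ℂ] ℂ) (f : A →ₗ[ℂ] A) (t : A ⊗[ℂ] A) :
    sliceLeft φ (f.lTensor A t) = f (sliceLeft φ t) := by
  induction t using TensorProduct.induction_on with
  | zero => simp
  | add x y hx hy => simp only [map_add, hx, hy]
  | tmul a b => simp

theorem sliceRight_mul_left (φ : A →ₗ[ℂ] ℂ) (f : A →ₗ[ℂ] A) (t : A ⊗[ℂ] A) :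
    sliceRight φ (f.rTensor A t) = f (sliceRight φ t) := by
  induction t using TensorProduct.induction_on with
  | zero => simp
  | add x y hx hy => simp only [map_add, hx, hy]
  | tmul a b => simp

@[simp] theorem leg13_tmul (T : Module.End ℂ (A ⊗[ℂ] A)) (a b c : A) :
    leg13 T (a ⊗ₜ (b ⊗ₜ c)) = TensorProduct.leftComm ℂ A A A (b ⊗ₜ T (a ⊗ₜ c)) := by
  simp [leg13]

theorem leg12_zero : leg12 (0 : Multiplier (A ⊗[ℂ] A)) = 0 :=
  Multiplier.ext (fun b => by change op12 0 b = 0; simp [op12])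
    (fun b => by change op12 0 b = 0; simp [op12])

theorem leg12_add (F G : Multiplier (A ⊗[ℂ] A)) : leg12 (F + G) = leg12 F + leg12 G :=
  Multiplier.ext
    (fun b => by
      change op12 (F.left + G.left) b = op12 F.left b + op12 G.left b
      simp [op12, LinearMap.rTensor_add])
    (fun b => by
      change op12 (F.right + G.right) b = op12 F.right b + op12 G.right b
      simp [op12, LinearMap.rTensor_add])

theorem leg23_zero : leg23 (0 : Multiplier (A ⊗[ℂ] A)) = 0 :=
  (Multiplier.tmulₗ A (A ⊗[ℂ] A) 1).map_zero

theorem leg23_add (F G : Multiplier (A ⊗[ℂ] A)) : leg23 (F + G) = leg23 F + leg23 G :=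
  (Multiplier.tmulₗ A (A ⊗[ℂ] A) 1).map_add F G

/-- `φ ⊗ ι ⊗ ι` on `A ⊗ A ⊗ A`. -/
def sliceFirst (φ : A →ₗ[ℂ] ℂ) : A ⊗[ℂ] (A ⊗[ℂ] A) →ₗ[ℂ] A ⊗[ℂ] A :=
  (TensorProduct.lid ℂ (A ⊗[ℂ] A)).toLinearMap ∘ₗ φ.rTensor (A ⊗[ℂ] A)

/-- `ι ⊗ ι ⊗ φ` on `A ⊗ A ⊗ A`. -/
def sliceThird (φ : A →ₗ[ℂ] ℂ) : A ⊗[ℂ] (A ⊗[ℂ] A) →ₗ[ℂ] A ⊗[ℂ] A :=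
  (sliceRight φ).lTensor A

@[simp] theorem sliceFirst_tmul (φ : A →ₗ[ℂ] ℂ) (a : A) (t : A ⊗[ℂ] A) :
    sliceFirst φ (a ⊗ₜ t) = φ a • t := by
  simp [sliceFirst]

@[simp] theorem sliceThird_tmul (φ : A →ₗ[ℂ] ℂ) (a : A) (t : A ⊗[ℂ] A) :
    sliceThird φ (a ⊗ₜ t) = a ⊗ₜ sliceRight φ t := by
  simp [sliceThird]

@[simp] theorem sliceThird_assoc (φ : A →ₗ[ℂ] ℂ) (a : A) (t : A ⊗[ℂ] A) :
    sliceThird φ (TensorProduct.assoc ℂ A A A (t ⊗ₜ a)) = φ a • t := by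
  induction t using TensorProduct.induction_on with
  | zero => simp
  | add x y hx hy => simp only [map_add, TensorProduct.add_tmul, smul_add, hx, hy]
  | tmul x y => simp

theorem sliceThird_op12 (φ : A →ₗ[ℂ] ℂ) (T : Module.End ℂ (A ⊗[ℂ] A))
    (s : A ⊗[ℂ] (A ⊗[ℂ] A)) : sliceThird φ (op12 T s) = T (sliceThird φ s) := by
  obtain ⟨s, rfl⟩ := (TensorProduct.assoc ℂ A A A).surjective s
  induction s using TensorProduct.induction_on with
  | zero => simp
  | add x y hx hy => simp only [map_add, hx, hy]
  | tmul t a => rw [op12_assoc, LinearMap.rTensor_tmul, sliceThird_assoc, sliceThird_assoc, map_smul]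

theorem sliceFirst_op23 (φ : A →ₗ[ℂ] ℂ) (T : Module.End ℂ (A ⊗[ℂ] A))
    (s : A ⊗[ℂ] (A ⊗[ℂ] A)) : sliceFirst φ (op23 T s) = T (sliceFirst φ s) := by
  induction s using TensorProduct.induction_on with
  | zero => simp
  | add x y hx hy => simp only [map_add, hx, hy]
  | tmul a t => simp

theorem sliceThird_leftComm (φ : A →ₗ[ℂ] ℂ) (b : A) (t : A ⊗[ℂ] A) :
    sliceThird φ (TensorProduct.leftComm ℂ A A A (b ⊗ₜ t)) = sliceRight φ t ⊗ₜ b := by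
  induction t using TensorProduct.induction_on with
  | zero => simp
  | add x y hx hy => simp only [map_add, TensorProduct.tmul_add, TensorProduct.add_tmul, hx, hy]
  | tmul x y => simp [TensorProduct.smul_tmul]

theorem sliceFirst_leftComm (φ : A →ₗ[ℂ] ℂ) (b : A) (t : A ⊗[ℂ] A) :
    sliceFirst φ (TensorProduct.leftComm ℂ A A A (b ⊗ₜ t)) = b ⊗ₜ sliceLeft φ t := by
  induction t using TensorProduct.induction_on with
  | zero => simp
  | add x y hx hy => simp only [map_add, TensorProduct.tmul_add, hx, hy]
  | tmul x y => simp

theorem lTensor_assoc_tmul {V : Type*} [AddCommGroup V] [Module ℂ V] (F : A ⊗[ℂ] A →ₗ[ℂ] V)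
    (t : A ⊗[ℂ] A) (b : A) :
    F.lTensor A (TensorProduct.assoc ℂ A A A (t ⊗ₜ b)) =
      (F ∘ₗ (TensorProduct.mk ℂ A A).flip b).lTensor A t := by
  induction t using TensorProduct.induction_on with
  | zero => simp
  | add x y hx hy => simp only [map_add, TensorProduct.add_tmul, hx, hy]
  | tmul x y => simp

theorem lTensor_leftComm_tmul {V : Type*} [AddCommGroup V] [Module ℂ V] (F : A ⊗[ℂ] A →ₗ[ℂ] V)
    (t : A ⊗[ℂ] A) (b : A) :
    F.lTensor A (TensorProduct.leftComm ℂ A A A (b ⊗ₜ t)) =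
      (F ∘ₗ TensorProduct.mk ℂ A A b).lTensor A t := by
  induction t using TensorProduct.induction_on with
  | zero => simp
  | add x y hx hy => simp only [map_add, TensorProduct.tmul_add, hx, hy]
  | tmul x y => simp

theorem rTensor_assoc_symm_tmul {V : Type*} [AddCommGroup V] [Module ℂ V] (F : A ⊗[ℂ] A →ₗ[ℂ] V)
    (t : A ⊗[ℂ] A) (b : A) :
    F.rTensor A ((TensorProduct.assoc ℂ A A A).symm (b ⊗ₜ t)) =
      (F ∘ₗ TensorProduct.mk ℂ A A b).rTensor A t := by
  induction t using TensorProduct.induction_on with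
  | zero => simp
  | add x y hx hy => simp only [map_add, TensorProduct.tmul_add, hx, hy]
  | tmul x y => simp

theorem rTensor_leftComm_tmul {V : Type*} [AddCommGroup V] [Module ℂ V] (F : A ⊗[ℂ] A →ₗ[ℂ] V)
    (t : A ⊗[ℂ] A) (b : A) :
    F.rTensor A ((TensorProduct.assoc ℂ A A A).symm (TensorProduct.leftComm ℂ A A A (b ⊗ₜ t))) =
      (F ∘ₗ (TensorProduct.mk ℂ A A).flip b).rTensor A t := by
  induction t using TensorProduct.induction_on with
  | zero => simp
  | add x y hx hy => simp only [map_add, TensorProduct.tmul_add, hx, hy]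
  | tmul x y => simp

end Slices

/-! ### Pentagon equations, consequences of fullness, and existence of generalized inverses. -/

namespace WeakMultiplierHopfAlgebra

variable {A : Type*} [NonUnitalRing A] [Module ℂ A] [IsScalarTower ℂ A A] [SMulCommClass ℂ A A]
  (H : WeakMultiplierHopfAlgebra A)

/-- `(c ⊗ 1)(Δ(a)(1 ⊗ b)) = ((c ⊗ 1)Δ(a))(1 ⊗ b)`. -/
theorem mulLeft_T₁ (a b c : A) :
    (LinearMap.mulLeft ℂ c).rTensor A (H.T₁ (a ⊗ₜ b)) =
      (LinearMap.mulRight ℂ b).lTensor A (H.T₂ (c ⊗ₜ a)) := by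
  apply H.nondeg₂.of_injective
  have h1 : Multiplier.of _ ((LinearMap.mulLeft ℂ c).rTensor A (H.T₁ (a ⊗ₜ b))) =
      Multiplier.tmul (Multiplier.of A c) 1 * Multiplier.of _ (H.T₁ (a ⊗ₜ b)) := by
    rw [Multiplier.mul_of]; rfl
  have h2 : Multiplier.of _ ((LinearMap.mulRight ℂ b).lTensor A (H.T₂ (c ⊗ₜ a))) =
      Multiplier.of _ (H.T₂ (c ⊗ₜ a)) * Multiplier.tmul 1 (Multiplier.of A b) := by
    rw [Multiplier.of_mul]; rfl
  rw [h1, h2, H.T₁_spec, H.T₂_spec, mul_assoc]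

theorem T₁_tmul_mul (a b c : A) :
    H.T₁ (a ⊗ₜ (b * c)) = (LinearMap.mulRight ℂ c).lTensor A (H.T₁ (a ⊗ₜ b)) := by
  apply H.nondeg₂.of_injective
  have h2 : Multiplier.of _ ((LinearMap.mulRight ℂ c).lTensor A (H.T₁ (a ⊗ₜ b))) =
      Multiplier.of _ (H.T₁ (a ⊗ₜ b)) * Multiplier.tmul 1 (Multiplier.of A c) := by
    rw [Multiplier.of_mul]; rfl
  rw [h2, H.T₁_spec, H.T₁_spec, mul_assoc, Multiplier.tmul_mul_tmul, mul_one,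
    Multiplier.of_mul_of]

theorem T₂_mul_tmul (a b c : A) :
    H.T₂ ((c * a) ⊗ₜ b) = (LinearMap.mulLeft ℂ c).rTensor A (H.T₂ (a ⊗ₜ b)) := by
  apply H.nondeg₂.of_injective
  have h1 : Multiplier.of _ ((LinearMap.mulLeft ℂ c).rTensor A (H.T₂ (a ⊗ₜ b))) =
      Multiplier.tmul (Multiplier.of A c) 1 * Multiplier.of _ (H.T₂ (a ⊗ₜ b)) := by
    rw [Multiplier.mul_of]; rfl
  rw [h1, H.T₂_spec, H.T₂_spec, ← mul_assoc, Multiplier.tmul_mul_tmul, mul_one,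
    Multiplier.of_mul_of]

theorem T₁_lTensor_mulRight (c : A) (t : A ⊗[ℂ] A) :
    H.T₁ ((LinearMap.mulRight ℂ c).lTensor A t) = (LinearMap.mulRight ℂ c).lTensor A (H.T₁ t) := by
  induction t using TensorProduct.induction_on with
  | zero => simp
  | add x y hx hy => simp only [map_add, hx, hy]
  | tmul x y => rw [← T₁_tmul_mul]; simp

theorem T₂_rTensor_mulLeft (c : A) (t : A ⊗[ℂ] A) :
    H.T₂ ((LinearMap.mulLeft ℂ c).rTensor A t) = (LinearMap.mulLeft ℂ c).rTensor A (H.T₂ t) := by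
  induction t using TensorProduct.induction_on with
  | zero => simp
  | add x y hx hy => simp only [map_add, hx, hy]
  | tmul x y => rw [← T₂_mul_tmul]; simp

theorem op12_T₂_op23_T₁ (s : A ⊗[ℂ] (A ⊗[ℂ] A)) :
    op12 H.T₂ (op23 H.T₁ s) = op23 H.T₁ (op12 H.T₂ s) := by
  have : op12 H.T₂ ∘ₗ op23 H.T₁ = op23 H.T₁ ∘ₗ op12 H.T₂ := by
    refine TensorProduct.ext_threefold' fun c a b => ?_
    simpa [op12, op23] using H.coassoc a b c
  exact LinearMap.congr_fun this s

theorem of_op23_T₂_leg13 (c p a : A) :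
    Multiplier.of _ (op23 H.T₂ (leg13 H.T₂ (c ⊗ₜ (p ⊗ₜ a)))) =
      leg23 (Multiplier.tmul (Multiplier.of A p) 1) * idTensor H.Δₗ (H.T₂ (c ⊗ₜ a)) := by
  rw [leg13_tmul]
  induction H.T₂ (c ⊗ₜ a) using TensorProduct.induction_on with
  | zero => simp
  | add x y hx hy => simp only [map_add, TensorProduct.tmul_add, mul_add, hx, hy]
  | tmul x v =>
    rw [TensorProduct.leftComm_tmul, op23_tmul, idTensor_tmul, ← mul_assoc, ← inFirst_mul_leg23,
      mul_assoc, ← leg23_mul, ← H.T₂_spec, ← Multiplier.tmul_of_of, inFirst, leg23,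
      Multiplier.tmul_mul_tmul, mul_one, one_mul]

theorem of_op12_T₁_leg13 (a b d : A) :
    Multiplier.of _ (op12 H.T₁ (leg13 H.T₁ (a ⊗ₜ (b ⊗ₜ d)))) =
      tensorId H.Δₗ (H.T₁ (a ⊗ₜ d)) * leg12 (Multiplier.tmul 1 (Multiplier.of A b)) := by
  rw [leg13_tmul]
  induction H.T₁ (a ⊗ₜ d) using TensorProduct.induction_on with
  | zero => simp
  | add x y hx hy => simp only [map_add, TensorProduct.tmul_add, add_mul, hx, hy]
  | tmul x v =>
    rw [TensorProduct.leftComm_tmul, op12_tmul, tensorId_tmul, of_assoc_tmul, H.T₁_spec, mul_assoc,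
      inThird_mul_leg12, ← mul_assoc, ← leg12_mul]

/-- The pentagon equation for `T₂`. -/
theorem pentagon_T₂ (s : A ⊗[ℂ] (A ⊗[ℂ] A)) :
    op12 H.T₂ (op23 H.T₂ s) = op23 H.T₂ (leg13 H.T₂ (op12 H.T₂ s)) := by
  have : op12 H.T₂ ∘ₗ op23 H.T₂ = op23 H.T₂ ∘ₗ leg13 H.T₂ ∘ₗ op12 H.T₂ := by
    refine TensorProduct.ext_threefold' fun c p a => ?_
    simp only [LinearMap.comp_apply]
    apply H.nondeg₃.of_injective
    refine H.eq_of_mul_inThird fun d => ?_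
    rw [op23_tmul, ← inFirst_mul_tensorId, op12_tmul]
    -- After multiplication by 1 ⊗ 1 ⊗ d the left side is (T₂(c ⊗ p) ⊗ 1)(Δ ⊗ ι)(T₁(a ⊗ d)), and
    -- coassociativity applies to each elementary tensor c' ⊗ p' of T₂(c ⊗ p).
    have h1 : inFirst c * tensorId H.Δₗ (H.T₂ (p ⊗ₜ a)) * inThird d =
        leg12 (Multiplier.of _ (H.T₂ (c ⊗ₜ p))) * tensorId H.Δₗ (H.T₁ (a ⊗ₜ d)) := by
      have h2 : ∀ t, tensorId H.Δₗ t * inThird d =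
          tensorId H.Δₗ ((LinearMap.mulRight ℂ d).lTensor A t) := by
        intro t
        induction t using TensorProduct.induction_on with
        | zero => simp
        | add x y hx hy => simp only [map_add, add_mul, hx, hy]
        | tmul x y =>
          rw [tensorId_tmul, mul_assoc, inThird_mul, LinearMap.lTensor_tmul, tensorId_tmul]
          rfl
      have h3 : ∀ t, leg12 (H.Δ p) * tensorId H.Δₗ t =
          tensorId H.Δₗ ((LinearMap.mulLeft ℂ p).rTensor A t) := by
        intro t
        induction t using TensorProduct.induction_on with
        | zero => simp
        | add x y hx hy => simp only [map_add, mul_add, hx, hy]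
        | tmul x y =>
          rw [tensorId_tmul, ← mul_assoc, ← leg12_mul, LinearMap.rTensor_tmul, tensorId_tmul,
            LinearMap.mulLeft_apply, map_mul]
      rw [mul_assoc, h2, ← mulLeft_T₁, ← h3, ← mul_assoc, H.T₂_spec, leg12_mul, inFirst_eq_leg12]
    rw [h1]
    induction H.T₂ (c ⊗ₜ p) using TensorProduct.induction_on with
    | zero => rw [map_zero, leg12_zero]; simp
    | add x y hx hy =>
      rw [map_add, leg12_add]
      simp only [map_add, TensorProduct.add_tmul, add_mul, hx, hy]
    | tmul c' p' =>
      have h6 : leg12 (Multiplier.of (A ⊗[ℂ] A) (c' ⊗ₜ p')) =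
          leg23 (Multiplier.tmul (Multiplier.of A p') 1) * inFirst c' := by
        rw [← Multiplier.tmul_of_of, leg12, transport_assoc_tmul, leg23, inFirst,
          Multiplier.tmul_mul_tmul, mul_one, one_mul]
      rw [TensorProduct.assoc_tmul, of_op23_T₂_leg13, h6, mul_assoc, ← idTensor_T₂, mul_assoc]
  exact LinearMap.congr_fun this s

/-- The pentagon equation for `T₁`. -/
theorem pentagon_T₁ (s : A ⊗[ℂ] (A ⊗[ℂ] A)) :
    op23 H.T₁ (op12 H.T₁ s) = op12 H.T₁ (leg13 H.T₁ (op23 H.T₁ s)) := by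
  have : op23 H.T₁ ∘ₗ op12 H.T₁ = op12 H.T₁ ∘ₗ leg13 H.T₁ ∘ₗ op23 H.T₁ := by
    refine TensorProduct.ext_threefold' fun a b d => ?_
    simp only [LinearMap.comp_apply]
    apply H.nondeg₃.of_injective
    refine H.eq_of_inFirst_mul fun c => ?_
    rw [op12_tmul, ← idTensor_mul_inThird, op23_tmul]
    have h1 : inFirst c * (idTensor H.Δₗ (H.T₁ (a ⊗ₜ b)) * inThird d) =
        idTensor H.Δₗ (H.T₂ (c ⊗ₜ a)) * leg23 (Multiplier.of _ (H.T₁ (b ⊗ₜ d))) := by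
      have h2 : ∀ t, inFirst c * idTensor H.Δₗ t =
          idTensor H.Δₗ ((LinearMap.mulLeft ℂ c).rTensor A t) := by
        intro t
        induction t using TensorProduct.induction_on with
        | zero => simp
        | add x y hx hy => simp only [map_add, mul_add, hx, hy]
        | tmul x y =>
          rw [idTensor_tmul, ← mul_assoc, LinearMap.rTensor_tmul, idTensor_tmul]
          congr 1
          simp only [inFirst, Multiplier.tmul_mul_tmul, mul_one, Multiplier.of_mul_of]
          rfl
      have h3 : ∀ t, idTensor H.Δₗ t * leg23 (H.Δ b) =
          idTensor H.Δₗ ((LinearMap.mulRight ℂ b).lTensor A t) := by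
        intro t
        induction t using TensorProduct.induction_on with
        | zero => simp
        | add x y hx hy => simp only [map_add, add_mul, hx, hy]
        | tmul x y =>
          rw [idTensor_tmul, mul_assoc, ← leg23_mul, LinearMap.lTensor_tmul, idTensor_tmul,
            LinearMap.mulRight_apply, map_mul]
      rw [← mul_assoc, h2, mulLeft_T₁, ← h3, mul_assoc, H.T₁_spec, leg23_mul]
      rfl
    rw [h1]
    induction H.T₁ (b ⊗ₜ d) using TensorProduct.induction_on with
    | zero => rw [map_zero, leg23_zero]; simp
    | add x y hx hy =>
      rw [map_add, leg23_add]
      simp only [map_add, TensorProduct.tmul_add, mul_add, hx, hy]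
    | tmul b' d' =>
      have h6 : leg23 (Multiplier.of (A ⊗[ℂ] A) (b' ⊗ₜ d')) =
          inThird d' * leg12 (Multiplier.tmul 1 (Multiplier.of A b')) := by
        rw [← Multiplier.tmul_of_of, leg12, transport_assoc_tmul, leg23, inThird,
          Multiplier.tmul_mul_tmul, Multiplier.tmul_mul_tmul, mul_one, one_mul, mul_one]
      rw [of_op12_T₁_leg13, h6, ← mul_assoc, idTensor_T₂, mul_assoc]
  exact LinearMap.congr_fun this s

/-- Fullness in usable form: the kernel of f - g contains every left leg of Δ(A)(1 ⊗ A), so it is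
all of A. -/
theorem eq_of_forall_T₁ {V : Type*} [AddCommGroup V] [Module ℂ V] {f g : A →ₗ[ℂ] V}
    (h : ∀ a b, f.rTensor A (H.T₁ (a ⊗ₜ b)) = g.rTensor A (H.T₁ (a ⊗ₜ b))) : f = g := by
  have h1 : LinearMap.ker (f - g) = ⊤ := by
    refine H.full_left _ ?_
    rintro _ ⟨t, rfl⟩
    refine mem_range_ker_rTensor _ _ ?_
    rw [LinearMap.rTensor_sub, LinearMap.sub_apply]
    induction t using TensorProduct.induction_on with
    | zero => simp
    | add x y hx hy => simp only [map_add, add_sub_add_comm, hx, hy, add_zero]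
    | tmul x y => rw [h, sub_self]
  exact sub_eq_zero.1 (LinearMap.ker_eq_top.1 h1)

theorem eq_of_forall_T₂ {V : Type*} [AddCommGroup V] [Module ℂ V] {f g : A →ₗ[ℂ] V}
    (h : ∀ a b, f.lTensor A (H.T₂ (a ⊗ₜ b)) = g.lTensor A (H.T₂ (a ⊗ₜ b))) : f = g := by
  have h1 : LinearMap.ker (f - g) = ⊤ := by
    refine H.full_right _ ?_
    rintro _ ⟨t, rfl⟩
    refine mem_range_ker_lTensor _ _ ?_
    rw [LinearMap.lTensor_sub, LinearMap.sub_apply]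
    induction t using TensorProduct.induction_on with
    | zero => simp
    | add x y hx hy => simp only [map_add, add_sub_add_comm, hx, hy, add_zero]
    | tmul x y => rw [h, sub_self]
  exact sub_eq_zero.1 (LinearMap.ker_eq_top.1 h1)

/-- Maps on `A ⊗ A` are determined by their values on the slices of `Δ₁₃(a)(1 ⊗ b ⊗ c)`. -/
theorem eq_of_forall_sliceThird {V : Type*} [AddCommGroup V] [Module ℂ V]
    {F G : A ⊗[ℂ] A →ₗ[ℂ] V}
    (h : ∀ (ω : A →ₗ[ℂ] ℂ) s, F (sliceThird ω (leg13 H.T₁ s)) = G (sliceThird ω (leg13 H.T₁ s))) :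
    F = G := by
  refine TensorProduct.ext (LinearMap.ext₂ fun a b => ?_)
  have : F ∘ₗ (TensorProduct.mk ℂ A A).flip b = G ∘ₗ (TensorProduct.mk ℂ A A).flip b := by
    refine H.eq_of_forall_T₁ fun a d => ?_
    rw [← sub_eq_zero, ← LinearMap.sub_apply, ← LinearMap.rTensor_sub]
    refine eq_zero_of_lTensor_eq_zero (g := fun ω : A →ₗ[ℂ] ℂ => ω)
      (fun v hv => (Module.forall_dual_apply_eq_zero_iff ℂ v).1 hv) _ fun ω => ?_
    apply (TensorProduct.rid ℂ V).injective
    have h1 : ∀ (f : A →ₗ[ℂ] V) (t : A ⊗[ℂ] A),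
        TensorProduct.rid ℂ V (ω.lTensor V (f.rTensor A t)) = f (sliceRight ω t) := by
      intro f t
      induction t using TensorProduct.induction_on with
      | zero => simp
      | add x y hx hy => simp only [map_add, hx, hy]
      | tmul x y => simp
    have h2 := h ω (a ⊗ₜ (b ⊗ₜ d))
    rw [leg13_tmul, sliceThird_leftComm] at h2
    rw [h1, map_zero, LinearMap.sub_apply, sub_eq_zero]
    exact h2
  exact LinearMap.congr_fun this a

/-- Maps on `A ⊗ A` are determined by their values on the slices of `(a ⊗ b ⊗ 1)Δ₁₃(c)`. -/
theorem eq_of_forall_sliceFirst {V : Type*} [AddCommGroup V] [Module ℂ V]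
    {F G : A ⊗[ℂ] A →ₗ[ℂ] V}
    (h : ∀ (ω : A →ₗ[ℂ] ℂ) s, F (sliceFirst ω (leg13 H.T₂ s)) = G (sliceFirst ω (leg13 H.T₂ s))) :
    F = G := by
  refine TensorProduct.ext (LinearMap.ext₂ fun b a => ?_)
  have : F ∘ₗ TensorProduct.mk ℂ A A b = G ∘ₗ TensorProduct.mk ℂ A A b := by
    refine H.eq_of_forall_T₂ fun d a => ?_
    rw [← sub_eq_zero, ← LinearMap.sub_apply, ← LinearMap.lTensor_sub]
    refine eq_zero_of_rTensor_eq_zero (g := fun ω : A →ₗ[ℂ] ℂ => ω)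
      (fun v hv => (Module.forall_dual_apply_eq_zero_iff ℂ v).1 hv) _ fun ω => ?_
    apply (TensorProduct.lid ℂ V).injective
    have h1 : ∀ (f : A →ₗ[ℂ] V) (t : A ⊗[ℂ] A),
        TensorProduct.lid ℂ V (ω.rTensor V (f.lTensor A t)) = f (sliceLeft ω t) := by
      intro f t
      induction t using TensorProduct.induction_on with
      | zero => simp
      | add x y hx hy => simp only [map_add, hx, hy]
      | tmul x y => simp
    have h2 := h ω (d ⊗ₜ (b ⊗ₜ a))
    rw [leg13_tmul, sliceFirst_leftComm] at h2
    rw [h1, map_zero, LinearMap.sub_apply, sub_eq_zero]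
    exact h2
  exact LinearMap.congr_fun this a

theorem op12_G₁ (s : A ⊗[ℂ] (A ⊗[ℂ] A)) :
    op12 H.G₁ (leg13 H.T₁ s) = leg13 H.T₁ (op23 H.E.left s) := by
  have : op12 H.G₁ ∘ₗ leg13 H.T₁ = leg13 H.T₁ ∘ₗ op23 H.E.left := by
    refine TensorProduct.ext_threefold' fun a b c => ?_
    simpa [op12] using H.G₁_spec a b c
  exact LinearMap.congr_fun this s

theorem op23_G₂ (s : A ⊗[ℂ] (A ⊗[ℂ] A)) :
    op23 H.G₂ (leg13 H.T₂ s) = leg13 H.T₂ (op12 H.E.right s) := by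
  have : op23 H.G₂ ∘ₗ leg13 H.T₂ = leg13 H.T₂ ∘ₗ op12 H.E.right := by
    refine TensorProduct.ext_threefold' fun a b c => ?_
    simpa [op23] using H.G₂_spec a b c
  exact LinearMap.congr_fun this s

theorem G₁_sliceThird (ω : A →ₗ[ℂ] ℂ) (s : A ⊗[ℂ] (A ⊗[ℂ] A)) :
    H.G₁ (sliceThird ω (leg13 H.T₁ s)) = sliceThird ω (leg13 H.T₁ (op23 H.E.left s)) := by
  rw [← sliceThird_op12, op12_G₁]

theorem G₂_sliceFirst (ω : A →ₗ[ℂ] ℂ) (s : A ⊗[ℂ] (A ⊗[ℂ] A)) :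
    H.G₂ (sliceFirst ω (leg13 H.T₂ s)) = sliceFirst ω (leg13 H.T₂ (op12 H.E.right s)) := by
  rw [← sliceFirst_op23, op23_G₂]

theorem E_left_mul_self : H.E.left * H.E.left = H.E.left := LinearMap.ext H.E_left_E_left

theorem E_right_mul_self : H.E.right * H.E.right = H.E.right := LinearMap.ext H.E_right_E_right

/-- On the slices of Δ₁₃(a)(1 ⊗ b ⊗ c), which determine a map by fullness, `G₁` acts as E on b ⊗ c.
Identities for E therefore transfer to `G₁`. -/
theorem G₁_idem : H.G₁ * H.G₁ = H.G₁ := by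
  refine H.eq_of_forall_sliceThird fun ω s => ?_
  rw [Module.End.mul_apply, G₁_sliceThird, G₁_sliceThird, ← Module.End.mul_apply (op23 _),
    ← op23_mul, E_left_mul_self]

theorem G₂_idem : H.G₂ * H.G₂ = H.G₂ := by
  refine H.eq_of_forall_sliceFirst fun ω s => ?_
  rw [Module.End.mul_apply, G₂_sliceFirst, G₂_sliceFirst, ← Module.End.mul_apply (op12 _),
    ← op12_mul, E_right_mul_self]

end WeakMultiplierHopfAlgebra

/-- Existence of the generalized inverse with given projections. -/
theorem exists_isGeneralizedInverse {V : Type*} [AddCommGroup V] [Module ℂ V]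
    {T P G : Module.End ℂ V} (hP : P * P = P) (hPT : LinearMap.range P = LinearMap.range T)
    (hG : G * G = G) (hGT : LinearMap.ker T = LinearMap.range (1 - G)) :
    ∃ R, IsGeneralizedInverse T P G R := by
  have hTG : ∀ v, T (G v) = T v := fun v => by
    have : (1 - G) v ∈ LinearMap.ker T := hGT ▸ LinearMap.mem_range_self _ v
    rw [LinearMap.mem_ker, LinearMap.sub_apply, map_sub, sub_eq_zero] at this
    exact this.symm
  have hPT' : ∀ v, P (T v) = T v := fun v => by
    obtain ⟨w, hw⟩ : T v ∈ LinearMap.range P := hPT ▸ LinearMap.mem_range_self _ v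
    rw [← hw, ← Module.End.mul_apply, hP]
  -- The map Tv ↦ Gv is well defined on the range of T because G vanishes on (1 - G)V, the kernel of
  -- T. The inverse is this map composed with P.
  obtain ⟨f, hf⟩ := exists_factor (α := T.rangeRestrict) T.surjective_rangeRestrict (β := G)
    (fun v hv => by
      have hv' : v ∈ LinearMap.ker T := by
        rw [LinearMap.mem_ker]
        exact congrArg Subtype.val hv
      rw [hGT] at hv'
      obtain ⟨w, rfl⟩ := hv'
      rw [← Module.End.mul_apply, mul_sub, mul_one, hG, sub_self, LinearMap.zero_apply])
  let R : Module.End ℂ V := f ∘ₗ P.codRestrict (LinearMap.range T)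
    (fun v => hPT ▸ LinearMap.mem_range_self P v)
  have hRT : R * T = G := by
    ext v
    rw [← hf v]
    change f _ = f _
    congr 1
    exact Subtype.ext (hPT' v)
  have hTR : T * R = P := by
    ext v
    obtain ⟨w, hw⟩ : P v ∈ LinearMap.range T := hPT ▸ LinearMap.mem_range_self P v
    have : R v = G w := by
      rw [← hf w]
      change f _ = f _
      congr 1
      exact Subtype.ext hw.symm
    rw [Module.End.mul_apply, this, hTG, hw]
  refine ⟨R, hTR, hRT, ?_⟩
  have hRP : R * P = R := by
    ext v
    change f _ = f _
    congr 1
    exact Subtype.ext (LinearMap.congr_fun hP v)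
  rw [mul_assoc, hTR, hRP]

namespace WeakMultiplierHopfAlgebra

variable {A : Type*} [NonUnitalRing A] [Module ℂ A] [IsScalarTower ℂ A A] [SMulCommClass ℂ A A]
  (H : WeakMultiplierHopfAlgebra A)

theorem exists_R₁ : ∃ R₁, IsGeneralizedInverse H.T₁ H.E.left H.G₁ R₁ :=
  exists_isGeneralizedInverse H.E_left_mul_self H.range_T₁ H.G₁_idem H.ker_T₁

theorem exists_R₂ : ∃ R₂, IsGeneralizedInverse H.T₂ H.E.right H.G₂ R₂ :=
  exists_isGeneralizedInverse H.E_right_mul_self H.range_T₂ H.G₂_idem H.ker_T₂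

end WeakMultiplierHopfAlgebra

theorem NonDegenerate.left_right_comm {B : Type*} [NonUnitalRing B] [Module ℂ B]
    [IsScalarTower ℂ B B] [SMulCommClass ℂ B B] (hB : NonDegenerate B) (m n : Multiplier B)
    (b : B) : m.left (n.right b) = n.right (m.left b) :=
  hB.eq_of_mul' fun c => by
    rw [← Multiplier.right_mul_eq, ← Multiplier.right_mul, ← Multiplier.right_mul,
      Multiplier.right_mul_eq]

section Slices

variable {A : Type*} [NonUnitalRing A] [Module ℂ A] [IsScalarTower ℂ A A] [SMulCommClass ℂ A A]

theorem op23_op23 (S T : Module.End ℂ (A ⊗[ℂ] A)) (s : A ⊗[ℂ] (A ⊗[ℂ] A)) :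
    op23 S (op23 T s) = op23 (S * T) s := by
  rw [op23_mul, Module.End.mul_apply]

theorem op12_op12 (S T : Module.End ℂ (A ⊗[ℂ] A)) (s : A ⊗[ℂ] (A ⊗[ℂ] A)) :
    op12 S (op12 T s) = op12 (S * T) s := by
  rw [op12_mul, Module.End.mul_apply]

theorem lTensor_op23 {V : Type*} [AddCommGroup V] [Module ℂ V] (F : A ⊗[ℂ] A →ₗ[ℂ] V)
    (T : Module.End ℂ (A ⊗[ℂ] A)) (s : A ⊗[ℂ] (A ⊗[ℂ] A)) :
    F.lTensor A (op23 T s) = (F ∘ₗ T).lTensor A s :=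
  (LinearMap.lTensor_comp_apply A F T s).symm

theorem rTensor_op12 {V : Type*} [AddCommGroup V] [Module ℂ V] (F : A ⊗[ℂ] A →ₗ[ℂ] V)
    (T : Module.End ℂ (A ⊗[ℂ] A)) (s : A ⊗[ℂ] (A ⊗[ℂ] A)) :
    F.rTensor A ((TensorProduct.assoc ℂ A A A).symm (op12 T s)) =
      (F ∘ₗ T).rTensor A ((TensorProduct.assoc ℂ A A A).symm s) := by
  rw [LinearMap.rTensor_comp_apply]
  simp [op12]

theorem assoc_tmul_eq_lTensor (t : A ⊗[ℂ] A) (b : A) :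
    TensorProduct.assoc ℂ A A A (t ⊗ₜ b) = ((TensorProduct.mk ℂ A A).flip b).lTensor A t := by
  simpa using lTensor_assoc_tmul (LinearMap.id) t b

theorem tmul_eq_assoc_rTensor (t : A ⊗[ℂ] A) (b : A) :
    b ⊗ₜ t = TensorProduct.assoc ℂ A A A ((TensorProduct.mk ℂ A A b).rTensor A t) := by
  have := rTensor_assoc_symm_tmul (LinearMap.id) t b
  rw [LinearMap.rTensor_id, LinearMap.id_apply, LinearMap.id_comp] at this
  rw [← this, LinearEquiv.apply_symm_apply]

theorem sliceFirst_assoc_tmul (φ : A →ₗ[ℂ] ℂ) (t : A ⊗[ℂ] A) (c : A) :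
    sliceFirst φ (TensorProduct.assoc ℂ A A A (t ⊗ₜ c)) = sliceLeft φ t ⊗ₜ c := by
  induction t using TensorProduct.induction_on with
  | zero => simp
  | add x y hx hy => simp only [map_add, TensorProduct.add_tmul, hx, hy]
  | tmul x y => simp [TensorProduct.smul_tmul']

theorem sliceFirst_op12_tmul (φ : A →ₗ[ℂ] ℂ) (T : Module.End ℂ (A ⊗[ℂ] A)) (d : A)
    (w : A ⊗[ℂ] A) : sliceFirst φ (op12 T (d ⊗ₜ w)) =
      (sliceLeft φ ∘ₗ T ∘ₗ TensorProduct.mk ℂ A A d).rTensor A w := by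
  induction w using TensorProduct.induction_on with
  | zero => simp
  | add x y hx hy => simp only [map_add, TensorProduct.tmul_add, hx, hy]
  | tmul x y => rw [op12_tmul, sliceFirst_assoc_tmul]; simp

theorem sliceThird_op23_assoc (φ : A →ₗ[ℂ] ℂ) (T : Module.End ℂ (A ⊗[ℂ] A)) (d : A)
    (w : A ⊗[ℂ] A) : sliceThird φ (op23 T (TensorProduct.assoc ℂ A A A (w ⊗ₜ d))) =
      (sliceRight φ ∘ₗ T ∘ₗ (TensorProduct.mk ℂ A A).flip d).lTensor A w := by
  rw [sliceThird, lTensor_op23, lTensor_assoc_tmul]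
  rfl

theorem mul'_rTensor_mulLeft (c : A) (t : A ⊗[ℂ] A) :
    LinearMap.mul' ℂ A ((LinearMap.mulLeft ℂ c).rTensor A t) = c * LinearMap.mul' ℂ A t := by
  induction t using TensorProduct.induction_on with
  | zero => simp
  | add x y hx hy => simp only [map_add, mul_add, hx, hy]
  | tmul x y => simp [mul_assoc]

theorem mul'_lTensor_mulRight (c : A) (t : A ⊗[ℂ] A) :
    LinearMap.mul' ℂ A ((LinearMap.mulRight ℂ c).lTensor A t) = LinearMap.mul' ℂ A t * c := by
  induction t using TensorProduct.induction_on with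
  | zero => simp
  | add x y hx hy => simp only [map_add, add_mul, hx, hy]
  | tmul x y => simp [mul_assoc]

theorem rTensor_sliceRight_assoc_symm (φ : A →ₗ[ℂ] ℂ) (s : A ⊗[ℂ] (A ⊗[ℂ] A)) :
    (sliceRight φ).rTensor A ((TensorProduct.assoc ℂ A A A).symm s) =
      (sliceLeft φ).lTensor A s := by
  have : (sliceRight φ).rTensor A ∘ₗ (TensorProduct.assoc ℂ A A A).symm.toLinearMap =
      (sliceLeft φ).lTensor A := by
    refine TensorProduct.ext_threefold' fun a b c => ?_
    simp [TensorProduct.smul_tmul]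
  exact LinearMap.congr_fun this s

end Slices

/-! ### Commutation rules for G₁ and G₂, and the source and target formulas. -/

namespace WeakMultiplierHopfAlgebra

variable {A : Type*} [NonUnitalRing A] [Module ℂ A] [IsScalarTower ℂ A A] [SMulCommClass ℂ A A]
  (H : WeakMultiplierHopfAlgebra A)

theorem E_left_lTensor_mulRight (c : A) (t : A ⊗[ℂ] A) :
    H.E.left ((LinearMap.mulRight ℂ c).lTensor A t) =
      (LinearMap.mulRight ℂ c).lTensor A (H.E.left t) :=
  H.nondeg₂.left_right_comm H.E (Multiplier.tmul 1 (Multiplier.of A c)) t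

theorem E_left_rTensor_mulRight (c : A) (t : A ⊗[ℂ] A) :
    H.E.left ((LinearMap.mulRight ℂ c).rTensor A t) =
      (LinearMap.mulRight ℂ c).rTensor A (H.E.left t) :=
  H.nondeg₂.left_right_comm H.E (Multiplier.tmul (Multiplier.of A c) 1) t

theorem E_right_rTensor_mulLeft (c : A) (t : A ⊗[ℂ] A) :
    H.E.right ((LinearMap.mulLeft ℂ c).rTensor A t) =
      (LinearMap.mulLeft ℂ c).rTensor A (H.E.right t) :=
  (H.nondeg₂.left_right_comm (Multiplier.tmul (Multiplier.of A c) 1) H.E t).symm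

theorem E_right_lTensor_mulLeft (c : A) (t : A ⊗[ℂ] A) :
    H.E.right ((LinearMap.mulLeft ℂ c).lTensor A t) =
      (LinearMap.mulLeft ℂ c).lTensor A (H.E.right t) :=
  (H.nondeg₂.left_right_comm (Multiplier.tmul 1 (Multiplier.of A c)) H.E t).symm

/-- On slices, right multiplication of the second leg by c comes from the middle factor b of a ⊗ b ⊗
d, where it commutes with left multiplication by E on b ⊗ d. -/
theorem G₁_lTensor_mulRight (c : A) (t : A ⊗[ℂ] A) :
    H.G₁ ((LinearMap.mulRight ℂ c).lTensor A t) = (LinearMap.mulRight ℂ c).lTensor A (H.G₁ t) := by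
  have h1 : ∀ ω s, (LinearMap.mulRight ℂ c).lTensor A (sliceThird ω (leg13 H.T₁ s)) =
      sliceThird ω (leg13 H.T₁ (op23 ((LinearMap.mulRight ℂ c).rTensor A) s)) := by
    intro ω s
    refine LinearMap.congr_fun (f := (LinearMap.mulRight ℂ c).lTensor A ∘ₗ sliceThird ω ∘ₗ
      leg13 H.T₁) (g := sliceThird ω ∘ₗ leg13 H.T₁ ∘ₗ
        op23 ((LinearMap.mulRight ℂ c).rTensor A)) ?_ s
    refine TensorProduct.ext_threefold' fun a b d => ?_
    simp [sliceThird_leftComm]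
  refine LinearMap.congr_fun (f := H.G₁ ∘ₗ (LinearMap.mulRight ℂ c).lTensor A)
    (g := (LinearMap.mulRight ℂ c).lTensor A ∘ₗ H.G₁) (H.eq_of_forall_sliceThird fun ω s => ?_) t
  simp only [LinearMap.comp_apply]
  rw [h1, G₁_sliceThird, G₁_sliceThird, h1, op23_op23, op23_op23]
  congr 4
  exact LinearMap.ext fun t => H.E_left_rTensor_mulRight c t

theorem G₂_rTensor_mulLeft (c : A) (t : A ⊗[ℂ] A) :
    H.G₂ ((LinearMap.mulLeft ℂ c).rTensor A t) = (LinearMap.mulLeft ℂ c).rTensor A (H.G₂ t) := by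
  have h1 : ∀ ω s, (LinearMap.mulLeft ℂ c).rTensor A (sliceFirst ω (leg13 H.T₂ s)) =
      sliceFirst ω (leg13 H.T₂ (op12 ((LinearMap.mulLeft ℂ c).lTensor A) s)) := by
    intro ω s
    refine LinearMap.congr_fun (f := (LinearMap.mulLeft ℂ c).rTensor A ∘ₗ sliceFirst ω ∘ₗ
      leg13 H.T₂) (g := sliceFirst ω ∘ₗ leg13 H.T₂ ∘ₗ
        op12 ((LinearMap.mulLeft ℂ c).lTensor A)) ?_ s
    refine TensorProduct.ext_threefold' fun a b d => ?_
    simp [sliceFirst_leftComm]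
  refine LinearMap.congr_fun (f := H.G₂ ∘ₗ (LinearMap.mulLeft ℂ c).rTensor A)
    (g := (LinearMap.mulLeft ℂ c).rTensor A ∘ₗ H.G₂) (H.eq_of_forall_sliceFirst fun ω s => ?_) t
  simp only [LinearMap.comp_apply]
  rw [h1, G₂_sliceFirst, G₂_sliceFirst, h1, op12_op12, op12_op12]
  congr 4
  exact LinearMap.ext fun t => H.E_right_lTensor_mulLeft c t

/-- By coassociativity `T₂` passes inside the slices on which `G₁` is known: it then meets only c ⊗
a and leaves t alone. -/
theorem op12_T₂_sliceThird (ω : A →ₗ[ℂ] ℂ) (c a : A) (t : A ⊗[ℂ] A) :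
    op12 H.T₂ (c ⊗ₜ sliceThird ω (leg13 H.T₁ (a ⊗ₜ t))) =
      (sliceThird ω ∘ₗ leg13 H.T₁ ∘ₗ
        (TensorProduct.mk ℂ A (A ⊗[ℂ] A)).flip t).lTensor A (H.T₂ (c ⊗ₜ a)) := by
  induction t using TensorProduct.induction_on with
  | zero => simp
  | add x y hx hy =>
    simp only [map_add, TensorProduct.tmul_add, hx, hy, LinearMap.comp_add, LinearMap.lTensor_add,
      LinearMap.add_apply]
  | tmul b d =>
    have h1 : H.T₂ (c ⊗ₜ sliceRight ω (H.T₁ (a ⊗ₜ d))) =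
        (sliceRight ω ∘ₗ H.T₁ ∘ₗ (TensorProduct.mk ℂ A A).flip d).lTensor A (H.T₂ (c ⊗ₜ a)) := by
      rw [← sliceThird_tmul, ← sliceThird_op12, ← op23_tmul, op12_T₂_op23_T₁, op12_tmul,
        sliceThird_op23_assoc]
    rw [leg13_tmul, sliceThird_leftComm, op12_tmul, h1, assoc_tmul_eq_lTensor,
      ← LinearMap.lTensor_comp_apply]
    congr 2
    ext v
    simp [sliceThird_leftComm]

theorem op23_T₁_sliceFirst (ω : A →ₗ[ℂ] ℂ) (c a : A) (t : A ⊗[ℂ] A) :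
    op23 H.T₁ (TensorProduct.assoc ℂ A A A
        (sliceFirst ω (leg13 H.T₂ (TensorProduct.assoc ℂ A A A (t ⊗ₜ a))) ⊗ₜ c)) =
      TensorProduct.assoc ℂ A A A ((sliceFirst ω ∘ₗ leg13 H.T₂ ∘ₗ
        (TensorProduct.assoc ℂ A A A).toLinearMap ∘ₗ
        TensorProduct.mk ℂ (A ⊗[ℂ] A) A t).rTensor A (H.T₁ (a ⊗ₜ c))) := by
  induction t using TensorProduct.induction_on with
  | zero => simp
  | add x y hx hy =>
    simp only [map_add, TensorProduct.add_tmul, hx, hy, LinearMap.comp_add, LinearMap.rTensor_add,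
      LinearMap.add_apply]
  | tmul d b =>
    have h1 : H.T₁ (sliceLeft ω (H.T₂ (d ⊗ₜ a)) ⊗ₜ c) =
        (sliceLeft ω ∘ₗ H.T₂ ∘ₗ TensorProduct.mk ℂ A A d).rTensor A (H.T₁ (a ⊗ₜ c)) := by
      rw [← sliceFirst_assoc_tmul, ← sliceFirst_op23, ← op12_tmul, ← op12_T₂_op23_T₁, op23_tmul,
        sliceFirst_op12_tmul]
    rw [TensorProduct.assoc_tmul, leg13_tmul, sliceFirst_leftComm, TensorProduct.assoc_tmul,
      op23_tmul, h1, tmul_eq_assoc_rTensor, ← LinearMap.rTensor_comp_apply]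
    congr 3
    ext v
    simp [sliceFirst_leftComm]

/-- On slices `G₁` is the action of E on t, whereas `T₂` acts on c ⊗ a, so the two do not interfere.
-/
theorem op23_G₁_op12_T₂ (s : A ⊗[ℂ] (A ⊗[ℂ] A)) :
    op23 H.G₁ (op12 H.T₂ s) = op12 H.T₂ (op23 H.G₁ s) := by
  induction s using TensorProduct.induction_on with
  | zero => simp
  | add x y hx hy => simp only [map_add, hx, hy]
  | tmul c v =>
    refine LinearMap.congr_fun (f := op23 H.G₁ ∘ₗ op12 H.T₂ ∘ₗ TensorProduct.mk ℂ A _ c)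
      (g := op12 H.T₂ ∘ₗ op23 H.G₁ ∘ₗ TensorProduct.mk ℂ A _ c)
      (H.eq_of_forall_sliceThird fun ω s => ?_) v
    induction s using TensorProduct.induction_on with
    | zero => simp
    | add x y hx hy => simp only [map_add, hx, hy]
    | tmul a t =>
      simp only [LinearMap.comp_apply, TensorProduct.mk_apply]
      rw [op23_tmul, G₁_sliceThird, op23_tmul, op12_T₂_sliceThird, op12_T₂_sliceThird, op23,
        ← LinearMap.lTensor_comp_apply]
      congr 2
      ext1 v
      simp [G₁_sliceThird]

theorem op12_G₂_op23_T₁ (s : A ⊗[ℂ] (A ⊗[ℂ] A)) :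
    op12 H.G₂ (op23 H.T₁ s) = op23 H.T₁ (op12 H.G₂ s) := by
  obtain ⟨s, rfl⟩ := (TensorProduct.assoc ℂ A A A).surjective s
  induction s using TensorProduct.induction_on with
  | zero => simp
  | add x y hx hy => simp only [map_add, hx, hy]
  | tmul v c =>
    refine LinearMap.congr_fun (f := op12 H.G₂ ∘ₗ op23 H.T₁ ∘ₗ
        (TensorProduct.assoc ℂ A A A).toLinearMap ∘ₗ (TensorProduct.mk ℂ _ A).flip c)
      (g := op23 H.T₁ ∘ₗ op12 H.G₂ ∘ₗ
        (TensorProduct.assoc ℂ A A A).toLinearMap ∘ₗ (TensorProduct.mk ℂ _ A).flip c)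
      (H.eq_of_forall_sliceFirst fun ω s => ?_) v
    obtain ⟨s, rfl⟩ := (TensorProduct.assoc ℂ A A A).surjective s
    induction s using TensorProduct.induction_on with
    | zero => simp
    | add x y hx hy => simp only [map_add, hx, hy]
    | tmul t a =>
      simp only [LinearMap.comp_apply, LinearMap.flip_apply, TensorProduct.mk_apply,
        LinearEquiv.coe_coe]
      rw [op12_assoc, LinearMap.rTensor_tmul, G₂_sliceFirst, op12_assoc, LinearMap.rTensor_tmul,
        op23_T₁_sliceFirst, op23_T₁_sliceFirst, op12_assoc, ← LinearMap.rTensor_comp_apply]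
      congr 3
      ext1 v
      simp [G₂_sliceFirst, op12_assoc]

/-- `(r ⊗ q)E(a ⊗ 1) = ∑ r a₍₁₎ ⊗ q ε_t(a₍₂₎)`. -/
theorem lTensor_sliceRight_G₂ (t : A ⊗[ℂ] A) (a : A) :
    (sliceRight H.ε ∘ₗ H.G₂).lTensor A (leg13 H.T₂ (TensorProduct.assoc ℂ A A A (t ⊗ₜ a))) =
      (LinearMap.mulRight ℂ a).rTensor A (H.E.right t) := by
  have h1 : ∀ t : A ⊗[ℂ] A, sliceThird H.ε (leg13 H.T₂ (TensorProduct.assoc ℂ A A A (t ⊗ₜ a))) =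
      (LinearMap.mulRight ℂ a).rTensor A t := by
    intro t
    induction t using TensorProduct.induction_on with
    | zero => simp
    | add x y hx hy => simp only [map_add, TensorProduct.add_tmul, hx, hy]
    | tmul b c =>
      rw [TensorProduct.assoc_tmul, leg13_tmul, sliceThird_leftComm, H.counit_right]
      simp
  rw [← lTensor_op23, op23_G₂, op12_assoc, LinearMap.rTensor_tmul]
  exact h1 _

/-- `(1 ⊗ a)E(b ⊗ c) = ∑ ε_s(a₍₁₎)b ⊗ a₍₂₎c`. -/
theorem rTensor_sliceLeft_G₁ (t : A ⊗[ℂ] A) (a : A) :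
    (sliceLeft H.ε ∘ₗ H.G₁).rTensor A
        ((TensorProduct.assoc ℂ A A A).symm (leg13 H.T₁ (a ⊗ₜ t))) =
      (LinearMap.mulLeft ℂ a).lTensor A (H.E.left t) := by
  have h1 : ∀ t : A ⊗[ℂ] A, (sliceLeft H.ε).rTensor A
      ((TensorProduct.assoc ℂ A A A).symm (leg13 H.T₁ (a ⊗ₜ t))) =
      (LinearMap.mulLeft ℂ a).lTensor A t := by
    intro t
    induction t using TensorProduct.induction_on with
    | zero => simp
    | add x y hx hy => simp only [map_add, TensorProduct.tmul_add, hx, hy]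
    | tmul b c =>
      rw [leg13_tmul, rTensor_leftComm_tmul, LinearMap.lTensor_tmul, LinearMap.mulLeft_apply,
        ← H.counit_left]
      induction H.T₁ (a ⊗ₜ c) using TensorProduct.induction_on with
      | zero => simp
      | add x y hx hy => simp only [map_add, TensorProduct.tmul_add, hx, hy]
      | tmul x y => simp [TensorProduct.smul_tmul]
  rw [← rTensor_op12, op12_G₁, op23_tmul]
  exact h1 _

/-- `(ι ⊗ ε ⊗ ι)` of `T₂(c ⊗ a) ⊗ b`. -/
theorem lTensor_sliceLeft_op12_T₂ (c : A) (t : A ⊗[ℂ] A) :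
    (sliceLeft H.ε).lTensor A (op12 H.T₂ (c ⊗ₜ t)) = (LinearMap.mulLeft ℂ c).rTensor A t := by
  induction t using TensorProduct.induction_on with
  | zero => simp
  | add x y hx hy => simp only [map_add, TensorProduct.tmul_add, hx, hy]
  | tmul a b =>
    rw [← rTensor_sliceRight_assoc_symm, op12_tmul, LinearEquiv.symm_apply_apply,
      LinearMap.rTensor_tmul, H.counit_right]
    simp

theorem lTensor_sliceLeft_op23_T₁ (b : A) (t : A ⊗[ℂ] A) :
    (sliceLeft H.ε).lTensor A (op23 H.T₁ (TensorProduct.assoc ℂ A A A (t ⊗ₜ b))) =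
      (LinearMap.mulRight ℂ b).lTensor A t := by
  induction t using TensorProduct.induction_on with
  | zero => simp
  | add x y hx hy => simp only [map_add, TensorProduct.add_tmul, hx, hy]
  | tmul c a =>
    rw [TensorProduct.assoc_tmul, op23_tmul, LinearMap.lTensor_tmul, H.counit_left]
    simp

theorem lTensor_rTensor_mulRight (a b : A) (t : A ⊗[ℂ] A) :
    (LinearMap.mulRight ℂ b).lTensor A ((LinearMap.mulRight ℂ a).rTensor A t) = t * (a ⊗ₜ b) := by
  rw [mul_tmul_eq, ← LinearMap.comp_apply, ← LinearMap.comp_apply, LinearMap.lTensor_comp_rTensor,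
    LinearMap.rTensor_comp_lTensor]

theorem lTensor_rTensor_mulLeft (a b : A) (t : A ⊗[ℂ] A) :
    (LinearMap.mulLeft ℂ b).lTensor A ((LinearMap.mulLeft ℂ a).rTensor A t) = (a ⊗ₜ b) * t := by
  rw [tmul_mul_eq, ← LinearMap.comp_apply, ← LinearMap.comp_apply, LinearMap.lTensor_comp_rTensor,
    LinearMap.rTensor_comp_lTensor]

/-- The left and right multiplications by `ε_t(a)` are compatible. -/
theorem target_compat (a b c : A) :
    c * sliceLeft H.ε (H.E.left (a ⊗ₜ b)) = sliceRight H.ε (H.G₂ (c ⊗ₜ a)) * b := by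
  -- By fullness a may be taken as the second leg of T₂(r ⊗ a). The claim then becomes (r ⊗ c)(E(a ⊗
  -- b)) = ((r ⊗ c)E)(a ⊗ b), which holds for any multiplier.
  refine LinearMap.congr_fun
    (f := LinearMap.mulLeft ℂ c ∘ₗ (sliceLeft H.ε ∘ₗ H.E.left) ∘ₗ (TensorProduct.mk ℂ A A).flip b)
    (g := LinearMap.mulRight ℂ b ∘ₗ (sliceRight H.ε ∘ₗ H.G₂) ∘ₗ TensorProduct.mk ℂ A A c)
    (H.eq_of_forall_T₂ fun r a => ?_) a
  rw [LinearMap.lTensor_comp_apply A (LinearMap.mulLeft ℂ c),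
    LinearMap.lTensor_comp_apply A (LinearMap.mulRight ℂ b), ← lTensor_assoc_tmul,
    ← lTensor_leftComm_tmul, ← leg13_tmul, ← op12_tmul, ← lTensor_op23, op23_E_left_op12_T₂,
    op23_tmul, lTensor_sliceLeft_op12_T₂, ← TensorProduct.assoc_tmul, lTensor_sliceRight_G₂,
    lTensor_rTensor_mulRight, lTensor_rTensor_mulLeft, Multiplier.right_mul_eq]

/-- The left and right multiplications by `ε_s(a)` are compatible. -/
theorem source_compat (a b c : A) :
    sliceRight H.ε (H.E.right (c ⊗ₜ a)) * b = c * sliceLeft H.ε (H.G₁ (a ⊗ₜ b)) := by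
  refine LinearMap.congr_fun
    (f := LinearMap.mulRight ℂ b ∘ₗ (sliceRight H.ε ∘ₗ H.E.right) ∘ₗ TensorProduct.mk ℂ A A c)
    (g := LinearMap.mulLeft ℂ c ∘ₗ (sliceLeft H.ε ∘ₗ H.G₁) ∘ₗ (TensorProduct.mk ℂ A A).flip b)
    (H.eq_of_forall_T₁ fun a d => ?_) a
  rw [LinearMap.rTensor_comp_apply A (LinearMap.mulRight ℂ b),
    LinearMap.rTensor_comp_apply A (LinearMap.mulLeft ℂ c), ← rTensor_assoc_symm_tmul,
    ← rTensor_leftComm_tmul, ← leg13_tmul, ← op23_tmul, ← rTensor_op12, op12_E_right_op23_T₁,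
    rTensor_sliceRight_assoc_symm, op12_tmul, lTensor_sliceLeft_op23_T₁, rTensor_sliceLeft_G₁,
    ← mul_tmul_eq, ← tmul_mul_eq, Multiplier.right_mul_eq]

theorem sliceLeft_T₁ (t : A ⊗[ℂ] A) : sliceLeft H.ε (H.T₁ t) = LinearMap.mul' ℂ A t := by
  induction t using TensorProduct.induction_on with
  | zero => simp
  | add x y hx hy => simp only [map_add, hx, hy]
  | tmul a b => rw [H.counit_left, LinearMap.mul'_apply]

theorem sliceRight_T₂ (t : A ⊗[ℂ] A) : sliceRight H.ε (H.T₂ t) = LinearMap.mul' ℂ A t := by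
  induction t using TensorProduct.induction_on with
  | zero => simp
  | add x y hx hy => simp only [map_add, hx, hy]
  | tmul a b => rw [H.counit_right, LinearMap.mul'_apply]

end WeakMultiplierHopfAlgebra

/-! ### Construction of the antipode as a map into M(A). -/

namespace WeakMultiplierHopfAlgebra

variable {A : Type*} [NonUnitalRing A] [Module ℂ A] [IsScalarTower ℂ A A] [SMulCommClass ℂ A A]
  {H : WeakMultiplierHopfAlgebra A} {R₁ R₂ : Module.End ℂ (A ⊗[ℂ] A)}

section GeneralizedInverses

theorem R₁_E_left (hR₁ : IsGeneralizedInverse H.T₁ H.E.left H.G₁ R₁) : R₁ * H.E.left = R₁ := by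
  rw [← hR₁.1, ← mul_assoc, hR₁.2.2]

theorem R₂_E_right (hR₂ : IsGeneralizedInverse H.T₂ H.E.right H.G₂ R₂) : R₂ * H.E.right = R₂ := by
  rw [← hR₂.1, ← mul_assoc, hR₂.2.2]

theorem G₁_R₁ (hR₁ : IsGeneralizedInverse H.T₁ H.E.left H.G₁ R₁) : H.G₁ * R₁ = R₁ := by
  rw [← hR₁.2.1, hR₁.2.2]

theorem G₂_R₂ (hR₂ : IsGeneralizedInverse H.T₂ H.E.right H.G₂ R₂) : H.G₂ * R₂ = R₂ := by
  rw [← hR₂.2.1, hR₂.2.2]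

theorem R₁_lTensor_mulRight (hR₁ : IsGeneralizedInverse H.T₁ H.E.left H.G₁ R₁) (c : A)
    (t : A ⊗[ℂ] A) :
    R₁ ((LinearMap.mulRight ℂ c).lTensor A t) = (LinearMap.mulRight ℂ c).lTensor A (R₁ t) := by
  calc R₁ ((LinearMap.mulRight ℂ c).lTensor A t)
      = R₁ (H.E.left ((LinearMap.mulRight ℂ c).lTensor A t)) :=
        (LinearMap.congr_fun (R₁_E_left hR₁) _).symm
    _ = R₁ (H.T₁ ((LinearMap.mulRight ℂ c).lTensor A (R₁ t))) := by
        rw [E_left_lTensor_mulRight, T₁_lTensor_mulRight, ← hR₁.1, Module.End.mul_apply]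
    _ = (LinearMap.mulRight ℂ c).lTensor A ((H.G₁ * R₁) t) := by
        rw [← Module.End.mul_apply R₁, hR₁.2.1, G₁_lTensor_mulRight, Module.End.mul_apply]
    _ = (LinearMap.mulRight ℂ c).lTensor A (R₁ t) := by rw [G₁_R₁ hR₁]

theorem R₂_rTensor_mulLeft (hR₂ : IsGeneralizedInverse H.T₂ H.E.right H.G₂ R₂) (c : A)
    (t : A ⊗[ℂ] A) :
    R₂ ((LinearMap.mulLeft ℂ c).rTensor A t) = (LinearMap.mulLeft ℂ c).rTensor A (R₂ t) := by
  calc R₂ ((LinearMap.mulLeft ℂ c).rTensor A t)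
      = R₂ (H.E.right ((LinearMap.mulLeft ℂ c).rTensor A t)) :=
        (LinearMap.congr_fun (R₂_E_right hR₂) _).symm
    _ = R₂ (H.T₂ ((LinearMap.mulLeft ℂ c).rTensor A (R₂ t))) := by
        rw [E_right_rTensor_mulLeft, T₂_rTensor_mulLeft, ← hR₂.1, Module.End.mul_apply]
    _ = (LinearMap.mulLeft ℂ c).rTensor A ((H.G₂ * R₂) t) := by
        rw [← Module.End.mul_apply R₂, hR₂.2.1, G₂_rTensor_mulLeft, Module.End.mul_apply]
    _ = (LinearMap.mulLeft ℂ c).rTensor A (R₂ t) := by rw [G₂_R₂ hR₂]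

/-- Commutation passes from `T₁`, `E` and `G₁` to the generalized inverse: R₁ = R₁E = R₁T₁R₁, the
inner `T₁` moves past `T₂` by coassociativity, and R₁T₁ = G₁ is absorbed by `R₁`. -/
theorem op23_R₁_op12_T₂ (hR₁ : IsGeneralizedInverse H.T₁ H.E.left H.G₁ R₁)
    (s : A ⊗[ℂ] (A ⊗[ℂ] A)) : op23 R₁ (op12 H.T₂ s) = op12 H.T₂ (op23 R₁ s) := by
  calc op23 R₁ (op12 H.T₂ s) = op23 R₁ (op23 H.E.left (op12 H.T₂ s)) := by
        rw [op23_op23, R₁_E_left hR₁]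
    _ = op23 R₁ (op12 H.T₂ (op23 H.T₁ (op23 R₁ s))) := by
        rw [op23_E_left_op12_T₂, op23_op23 H.T₁, hR₁.1]
    _ = op12 H.T₂ (op23 R₁ s) := by
        rw [op12_T₂_op23_T₁, op23_op23, hR₁.2.1, op23_G₁_op12_T₂, op23_op23, G₁_R₁ hR₁]

theorem op12_R₂_op23_T₁ (hR₂ : IsGeneralizedInverse H.T₂ H.E.right H.G₂ R₂)
    (s : A ⊗[ℂ] (A ⊗[ℂ] A)) : op12 R₂ (op23 H.T₁ s) = op23 H.T₁ (op12 R₂ s) := by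
  calc op12 R₂ (op23 H.T₁ s) = op12 R₂ (op12 H.E.right (op23 H.T₁ s)) := by
        rw [op12_op12, R₂_E_right hR₂]
    _ = op12 R₂ (op23 H.T₁ (op12 H.T₂ (op12 R₂ s))) := by
        rw [op12_E_right_op23_T₁, op12_op12 H.T₂, hR₂.1]
    _ = op23 H.T₁ (op12 R₂ s) := by
        rw [← op12_T₂_op23_T₁, op12_op12, hR₂.2.1, op12_G₂_op23_T₁, op12_op12, G₂_R₂ hR₂]

/-- The map `a ⊗ b ↦ S(a)b`. -/
def antipodeLeft (H : WeakMultiplierHopfAlgebra A) (R₁ : Module.End ℂ (A ⊗[ℂ] A)) :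
    A ⊗[ℂ] A →ₗ[ℂ] A := sliceLeft H.ε ∘ₗ R₁

/-- The map `b ⊗ a ↦ bS(a)`. -/
def antipodeRight (H : WeakMultiplierHopfAlgebra A) (R₂ : Module.End ℂ (A ⊗[ℂ] A)) :
    A ⊗[ℂ] A →ₗ[ℂ] A := sliceRight H.ε ∘ₗ R₂

theorem antipodeLeft_comp_E (hR₁ : IsGeneralizedInverse H.T₁ H.E.left H.G₁ R₁) :
    H.antipodeLeft R₁ ∘ₗ H.E.left = H.antipodeLeft R₁ := by
  rw [antipodeLeft, LinearMap.comp_assoc, ← Module.End.mul_eq_comp, R₁_E_left hR₁]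

theorem antipodeRight_comp_E (hR₂ : IsGeneralizedInverse H.T₂ H.E.right H.G₂ R₂) :
    H.antipodeRight R₂ ∘ₗ H.E.right = H.antipodeRight R₂ := by
  rw [antipodeRight, LinearMap.comp_assoc, ← Module.End.mul_eq_comp, R₂_E_right hR₂]

theorem antipodeLeft_comp_T₁ (hR₁ : IsGeneralizedInverse H.T₁ H.E.left H.G₁ R₁) :
    H.antipodeLeft R₁ ∘ₗ H.T₁ = sliceLeft H.ε ∘ₗ H.G₁ := by
  rw [antipodeLeft, LinearMap.comp_assoc, ← Module.End.mul_eq_comp, hR₁.2.1]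

theorem antipodeRight_comp_T₂ (hR₂ : IsGeneralizedInverse H.T₂ H.E.right H.G₂ R₂) :
    H.antipodeRight R₂ ∘ₗ H.T₂ = sliceRight H.ε ∘ₗ H.G₂ := by
  rw [antipodeRight, LinearMap.comp_assoc, ← Module.End.mul_eq_comp, hR₂.2.1]

theorem mul'_R₁ (hR₁ : IsGeneralizedInverse H.T₁ H.E.left H.G₁ R₁) (t : A ⊗[ℂ] A) :
    LinearMap.mul' ℂ A (R₁ t) = sliceLeft H.ε (H.E.left t) := by
  rw [← sliceLeft_T₁, ← Module.End.mul_apply, hR₁.1]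

theorem mul'_R₂ (hR₂ : IsGeneralizedInverse H.T₂ H.E.right H.G₂ R₂) (t : A ⊗[ℂ] A) :
    LinearMap.mul' ℂ A (R₂ t) = sliceRight H.ε (H.E.right t) := by
  rw [← sliceRight_T₂, ← Module.End.mul_apply, hR₂.1]

/-- The left and right multiplications by `S(a)` are compatible: `c(S(a)b) = (cS(a))b`. -/
theorem antipode_compat (hR₁ : IsGeneralizedInverse H.T₁ H.E.left H.G₁ R₁)
    (hR₂ : IsGeneralizedInverse H.T₂ H.E.right H.G₂ R₂) (a b c : A) :
    c * H.antipodeLeft R₁ (a ⊗ₜ b) = H.antipodeRight R₂ (c ⊗ₜ a) * b := by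
  let F : A ⊗[ℂ] (A ⊗[ℂ] A) →ₗ[ℂ] A := LinearMap.mul' ℂ A ∘ₗ (H.antipodeLeft R₁).lTensor A
  let K : A ⊗[ℂ] (A ⊗[ℂ] A) →ₗ[ℂ] A := LinearMap.mul' ℂ A ∘ₗ (H.antipodeRight R₂).rTensor A ∘ₗ
    (TensorProduct.assoc ℂ A A A).symm.toLinearMap
  have hFE : ∀ s, F (op23 H.E.left s) = F s := fun s => by
    simp only [F, LinearMap.comp_apply]
    rw [lTensor_op23, antipodeLeft_comp_E hR₁]
  have hKE : ∀ s, K (op12 H.E.right s) = K s := fun s => by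
    simp only [K, LinearMap.comp_apply, LinearEquiv.coe_coe]
    rw [rTensor_op12, antipodeRight_comp_E hR₂]
  -- Here F(c ⊗ a ⊗ b) = c(S(a)b) and K(c ⊗ a ⊗ b) = (cS(a))b. With c ⊗ a replaced by T₂(c ⊗ a),
  -- both products contract to c ε_t(a) b.
  have hT₂ : F ∘ₗ op12 H.T₂ = K ∘ₗ op12 H.T₂ := by
    refine TensorProduct.ext_threefold' fun c a b => ?_
    have h1 : F (op12 H.T₂ (c ⊗ₜ (a ⊗ₜ b))) = c * sliceLeft H.ε (H.E.left (a ⊗ₜ b)) := by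
      simp only [F, LinearMap.comp_apply]
      rw [antipodeLeft, ← lTensor_op23, op23_R₁_op12_T₂ hR₁, op23_tmul, lTensor_sliceLeft_op12_T₂,
        mul'_rTensor_mulLeft, mul'_R₁ hR₁]
    have h2 : K (op12 H.T₂ (c ⊗ₜ (a ⊗ₜ b))) = sliceRight H.ε (H.G₂ (c ⊗ₜ a)) * b := by
      simp only [K, LinearMap.comp_apply, LinearEquiv.coe_coe]
      rw [rTensor_op12, antipodeRight_comp_T₂ hR₂]
      simp
    exact h1.trans ((H.target_compat a b c).trans h2.symm)
  -- With a ⊗ b replaced by T₁(a ⊗ b), both products contract to c ε_s(a) b.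
  have hT₁ : F ∘ₗ op23 H.T₁ = K ∘ₗ op23 H.T₁ := by
    refine TensorProduct.ext_threefold' fun c a b => ?_
    have h1 : F (op23 H.T₁ (c ⊗ₜ (a ⊗ₜ b))) = c * sliceLeft H.ε (H.G₁ (a ⊗ₜ b)) := by
      simp only [F, LinearMap.comp_apply]
      rw [lTensor_op23, antipodeLeft_comp_T₁ hR₁]
      simp
    have h2 : K (op23 H.T₁ (c ⊗ₜ (a ⊗ₜ b))) = sliceRight H.ε (H.E.right (c ⊗ₜ a)) * b := by
      simp only [K, LinearMap.comp_apply, LinearEquiv.coe_coe]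
      rw [antipodeRight, ← rTensor_op12, op12_R₂_op23_T₁ hR₂, rTensor_sliceRight_assoc_symm,
        op12_tmul, lTensor_sliceLeft_op23_T₁, mul'_lTensor_mulRight, mul'_R₂ hR₂]
    exact h1.trans ((H.source_compat a b c).symm.trans h2.symm)
  have hFK : ∀ s, F (op12 H.E.right s) = K s := fun s => by
    rw [← hKE, ← hR₂.1, ← op12_op12]
    exact LinearMap.congr_fun hT₂ _
  have hKF : ∀ s, K (op23 H.E.left s) = F s := fun s => by
    rw [← hFE, ← hR₁.1, ← op23_op23]
    exact (LinearMap.congr_fun hT₁ _).symm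
  have hcomm : ∀ s, op12 H.E.right (op23 H.E.left s) = op23 H.E.left (op12 H.E.right s) := fun s =>
    (H.nondeg₃.left_right_comm (leg23 H.E) (leg12 H.E) s).symm
  -- F absorbs E₂₃ and K absorbs E₁₂. Writing both as operators, F = K E₂₃ = F E₁₂ E₂₃ = F E₂₃ E₁₂ =
  -- F E₁₂ = K.
  have key : ∀ s, F s = K s := fun s => by
    rw [← hKF, ← hFK, hcomm, hFE, hFK]
  simpa [F, K] using key (c ⊗ₜ (a ⊗ₜ b))

theorem antipodeLeft_tmul_mul (hR₁ : IsGeneralizedInverse H.T₁ H.E.left H.G₁ R₁) (a b c : A) :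
    H.antipodeLeft R₁ (a ⊗ₜ (b * c)) = H.antipodeLeft R₁ (a ⊗ₜ b) * c := by
  have := R₁_lTensor_mulRight hR₁ c (a ⊗ₜ b)
  rw [LinearMap.lTensor_tmul, LinearMap.mulRight_apply] at this
  rw [antipodeLeft, LinearMap.comp_apply, this, sliceLeft_mul_right]
  rfl

theorem antipodeRight_mul_tmul (hR₂ : IsGeneralizedInverse H.T₂ H.E.right H.G₂ R₂) (a b c : A) :
    H.antipodeRight R₂ ((c * b) ⊗ₜ a) = c * H.antipodeRight R₂ (b ⊗ₜ a) := by
  have := R₂_rTensor_mulLeft hR₂ c (b ⊗ₜ a)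
  rw [LinearMap.rTensor_tmul, LinearMap.mulLeft_apply] at this
  rw [antipodeRight, LinearMap.comp_apply, this, sliceRight_mul_left]
  rfl

theorem exists_isAntipode (H : WeakMultiplierHopfAlgebra A) : ∃ S, H.IsAntipode S := by
  obtain ⟨R₁, hR₁⟩ := H.exists_R₁
  obtain ⟨R₂, hR₂⟩ := H.exists_R₂
  let S : A →ₗ[ℂ] Multiplier A :=
    { toFun := fun a => Multiplier.mk (H.antipodeLeft R₁ ∘ₗ TensorProduct.mk ℂ A A a)
        (H.antipodeRight R₂ ∘ₗ (TensorProduct.mk ℂ A A).flip a)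
        (fun b c => antipodeLeft_tmul_mul hR₁ a b c)
        (fun c b => antipodeRight_mul_tmul hR₂ a b c)
        (fun c b => (antipode_compat hR₁ hR₂ a b c).symm)
      map_add' := fun a a' => Multiplier.ext
        (fun b => by
          change H.antipodeLeft R₁ ((a + a') ⊗ₜ b) =
            H.antipodeLeft R₁ (a ⊗ₜ b) + H.antipodeLeft R₁ (a' ⊗ₜ b)
          rw [TensorProduct.add_tmul, map_add])
        (fun b => by
          change H.antipodeRight R₂ (b ⊗ₜ (a + a')) =
            H.antipodeRight R₂ (b ⊗ₜ a) + H.antipodeRight R₂ (b ⊗ₜ a')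
          rw [TensorProduct.tmul_add, map_add])
      map_smul' := fun z a => Multiplier.ext
        (fun b => by
          change H.antipodeLeft R₁ ((z • a) ⊗ₜ b) = z • H.antipodeLeft R₁ (a ⊗ₜ b)
          rw [← TensorProduct.smul_tmul', map_smul])
        (fun b => by
          change H.antipodeRight R₂ (b ⊗ₜ (z • a)) = z • H.antipodeRight R₂ (b ⊗ₜ a)
          rw [TensorProduct.tmul_smul, map_smul]) }
  exact ⟨S, R₁, R₂, hR₁, hR₂, fun _ _ => rfl, fun _ _ => rfl⟩

/-- `S(A)A = A`. -/
theorem antipodeLeft_surjective (hR₁ : IsGeneralizedInverse H.T₁ H.E.left H.G₁ R₁) :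
    Function.Surjective (H.antipodeLeft R₁) := by
  rw [← LinearMap.range_eq_top]
  refine H.full_left _ ?_
  rintro _ ⟨t, rfl⟩
  refine mem_range_subtype_rTensor _ _ ?_
  -- By fullness it is enough that the first legs of E(A ⊗ A) lie in S(A)A. Multiplying by 1 ⊗ a
  -- turns them into ε_s(a₍₁₎)b, and ε_s(a)b = ∑ S(a₍₁₎)a₍₂₎b.
  rw [← E_left_T₁]
  refine eq_zero_of_lTensor_eq_zero (g := fun a : A => LinearMap.mulLeft ℂ a)
    (fun v hv => H.right_nondeg v hv) _ fun a => ?_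
  rw [← LinearMap.comp_apply, LinearMap.lTensor_comp_rTensor, ← LinearMap.rTensor_comp_lTensor,
    LinearMap.comp_apply, ← rTensor_sliceLeft_G₁, ← LinearMap.rTensor_comp_apply]
  have : (LinearMap.range (H.antipodeLeft R₁)).mkQ ∘ₗ sliceLeft H.ε ∘ₗ H.G₁ = 0 := by
    rw [← antipodeLeft_comp_T₁ hR₁]
    refine LinearMap.ext fun x => ?_
    simp
  rw [this]
  simp

/-- `AS(A) = A`. -/
theorem antipodeRight_surjective (hR₂ : IsGeneralizedInverse H.T₂ H.E.right H.G₂ R₂) :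
    Function.Surjective (H.antipodeRight R₂) := by
  rw [← LinearMap.range_eq_top]
  refine H.full_right _ ?_
  rintro _ ⟨t, rfl⟩
  refine mem_range_subtype_lTensor _ _ ?_
  rw [← E_right_T₂]
  refine eq_zero_of_rTensor_eq_zero (g := fun a : A => LinearMap.mulRight ℂ a)
    (fun v hv => H.left_nondeg v hv) _ fun a => ?_
  rw [← LinearMap.comp_apply, LinearMap.rTensor_comp_lTensor, ← LinearMap.lTensor_comp_rTensor,
    LinearMap.comp_apply, ← lTensor_sliceRight_G₂, ← LinearMap.lTensor_comp_apply]
  have : (LinearMap.range (H.antipodeRight R₂)).mkQ ∘ₗ sliceRight H.ε ∘ₗ H.G₂ = 0 := by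
    rw [← antipodeRight_comp_T₂ hR₂]
    refine LinearMap.ext fun x => ?_
    simp
  rw [this]
  simp

end GeneralizedInverses

/-! ### Multiplication by source and target elements. -/

section SourceTarget

/-- Right multiplication by `ε_s(p)`. -/
def sourceRight (H : WeakMultiplierHopfAlgebra A) (p : A) : Module.End ℂ A :=
  sliceRight H.ε ∘ₗ H.E.right ∘ₗ (TensorProduct.mk ℂ A A).flip p

/-- Left multiplication by `ε_t(p)`. -/
def targetLeft (H : WeakMultiplierHopfAlgebra A) (p : A) : Module.End ℂ A :=
  sliceLeft H.ε ∘ₗ H.E.left ∘ₗ TensorProduct.mk ℂ A A p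

theorem sourceRight_mul (p a b : A) : H.sourceRight p (a * b) = a * H.sourceRight p b := by
  have := H.E_right_rTensor_mulLeft a (b ⊗ₜ p)
  rw [LinearMap.rTensor_tmul, LinearMap.mulLeft_apply] at this
  simp only [sourceRight, LinearMap.comp_apply, LinearMap.flip_apply, TensorProduct.mk_apply]
  rw [this, sliceRight_mul_left]
  rfl

theorem targetLeft_mul (p a b : A) : H.targetLeft p (a * b) = H.targetLeft p a * b := by
  have := H.E_left_lTensor_mulRight b (p ⊗ₜ a)
  rw [LinearMap.lTensor_tmul, LinearMap.mulRight_apply] at this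
  simp only [targetLeft, LinearMap.comp_apply, TensorProduct.mk_apply]
  rw [this, sliceLeft_mul_right]
  rfl

/-- Right multiplication by ε_s(p) is a slice of right multiplication by E. For T = `T₂` the outcome
is Δ(ay) = Δ(a)(1 ⊗ y) with y = ε_s(p). -/
theorem comp_lTensor_sourceRight {T : Module.End ℂ (A ⊗[ℂ] A)}
    (hT : ∀ s, op23 H.E.right (op12 T s) = op12 T (op23 H.E.right s)) (p : A) (t : A ⊗[ℂ] A) :
    T ((H.sourceRight p).lTensor A t) = (H.sourceRight p).lTensor A (T t) := by
  induction t using TensorProduct.induction_on with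
  | zero => simp
  | add x y hx hy => simp only [map_add, hx, hy]
  | tmul c a =>
    have h1 : c ⊗ₜ H.sourceRight p a = sliceThird H.ε (op23 H.E.right (c ⊗ₜ (a ⊗ₜ p))) := by
      simp [sourceRight]
    rw [LinearMap.lTensor_tmul, h1, ← sliceThird_op12, ← hT, op12_tmul, sliceThird_op23_assoc]
    rfl

theorem comp_rTensor_targetLeft {T : Module.End ℂ (A ⊗[ℂ] A)}
    (hT : ∀ s, op12 H.E.left (op23 T s) = op23 T (op12 H.E.left s)) (p : A) (t : A ⊗[ℂ] A) :
    T ((H.targetLeft p).rTensor A t) = (H.targetLeft p).rTensor A (T t) := by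
  induction t using TensorProduct.induction_on with
  | zero => simp
  | add x y hx hy => simp only [map_add, hx, hy]
  | tmul a c =>
    have h1 : H.targetLeft p a ⊗ₜ c = sliceFirst H.ε (op12 H.E.left (p ⊗ₜ (a ⊗ₜ c))) := by
      rw [op12_tmul, sliceFirst_assoc_tmul]
      rfl
    rw [LinearMap.rTensor_tmul, h1, ← sliceFirst_op23, ← hT, op23_tmul, sliceFirst_op12_tmul]
    rfl

theorem op23_lTensor_assoc (f : Module.End ℂ A) (t : A ⊗[ℂ] A) (c : A) :
    op23 (f.lTensor A) (TensorProduct.assoc ℂ A A A (t ⊗ₜ c)) =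
      TensorProduct.assoc ℂ A A A (t ⊗ₜ f c) := by
  induction t using TensorProduct.induction_on with
  | zero => simp
  | add x y hx hy => simp only [map_add, TensorProduct.add_tmul, hx, hy]
  | tmul x y => simp

theorem op12_rTensor_tmul (f : Module.End ℂ A) (t : A ⊗[ℂ] A) (c : A) :
    op12 (f.rTensor A) (c ⊗ₜ t) = f c ⊗ₜ t := by
  induction t using TensorProduct.induction_on with
  | zero => simp
  | add x y hx hy => simp only [map_add, TensorProduct.tmul_add, hx, hy]
  | tmul x y => simp

theorem op12_op23_lTensor (T : Module.End ℂ (A ⊗[ℂ] A)) (f : Module.End ℂ A)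
    (s : A ⊗[ℂ] (A ⊗[ℂ] A)) :
    op12 T (op23 (f.lTensor A) s) = op23 (f.lTensor A) (op12 T s) := by
  refine LinearMap.congr_fun (f := op12 T ∘ₗ op23 (f.lTensor A))
    (g := op23 (f.lTensor A) ∘ₗ op12 T) (TensorProduct.ext_threefold' fun a b c => ?_) s
  simp [op23_lTensor_assoc]

theorem op23_op12_rTensor (T : Module.End ℂ (A ⊗[ℂ] A)) (f : Module.End ℂ A)
    (s : A ⊗[ℂ] (A ⊗[ℂ] A)) :
    op23 T (op12 (f.rTensor A) s) = op12 (f.rTensor A) (op23 T s) := by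
  refine LinearMap.congr_fun (f := op23 T ∘ₗ op12 (f.rTensor A))
    (g := op12 (f.rTensor A) ∘ₗ op23 T) (TensorProduct.ext_threefold' fun a b c => ?_) s
  simp [op12_rTensor_tmul]

/-- `((r ⊗ 1)Δ(q))(y ⊗ S(a)) = ((r ⊗ 1)Δ(q))(1 ⊗ S(ay))` for `y = ε_s(p)`. -/
theorem rTensor_sourceRight (hR₂ : IsGeneralizedInverse H.T₂ H.E.right H.G₂ R₂) (p : A)
    (s : A ⊗[ℂ] (A ⊗[ℂ] A)) :
    (H.sourceRight p).rTensor A ((H.antipodeRight R₂).lTensor A (op12 H.T₂ s)) =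
      (H.antipodeRight R₂).lTensor A (op12 H.T₂ (op23 ((H.sourceRight p).lTensor A) s)) := by
  -- As `R₂` absorbs E, the last two factors of s may be replaced by an element of the range of
  -- `T₂`.
  have h1 : ∀ s, (H.antipodeRight R₂).lTensor A (op12 H.T₂ (op23 H.E.right s)) =
      (H.antipodeRight R₂).lTensor A (op12 H.T₂ s) := fun s => by
    rw [← op23_E_right_op12_T₂, lTensor_op23, antipodeRight_comp_E hR₂]
  -- On such elements the pentagon equation produces a₍₂₎S(a₍₃₎) = ε_t(a₍₂₎).
  have h2 : ∀ s, (H.antipodeRight R₂).lTensor A (op12 H.T₂ (op23 H.T₂ s)) =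
      (sliceRight H.ε ∘ₗ H.G₂).lTensor A (leg13 H.T₂ (op12 H.T₂ s)) := fun s => by
    rw [pentagon_T₂, lTensor_op23, antipodeRight_comp_T₂ hR₂]
  -- In the form (tE)(a ⊗ 1), replacing a by ay is visibly right multiplication of the first leg by
  -- y.
  have h3 : ∀ x, (sliceRight H.ε ∘ₗ H.G₂).lTensor A
      (leg13 H.T₂ (op23 ((H.sourceRight p).lTensor A) x)) =
      (H.sourceRight p).rTensor A ((sliceRight H.ε ∘ₗ H.G₂).lTensor A (leg13 H.T₂ x)) := fun x => by
    obtain ⟨x, rfl⟩ := (TensorProduct.assoc ℂ A A A).surjective x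
    induction x using TensorProduct.induction_on with
    | zero => simp
    | add x y hx hy => simp only [map_add, hx, hy]
    | tmul t a =>
      rw [op23_lTensor_assoc, lTensor_sliceRight_G₂, lTensor_sliceRight_G₂,
        ← LinearMap.rTensor_comp_apply]
      congr 2
      refine LinearMap.ext fun v => ?_
      simp [sourceRight_mul]
  have hE : H.E.right * (H.sourceRight p).lTensor A = (H.sourceRight p).lTensor A * H.E.right :=
    LinearMap.ext fun t =>
      comp_lTensor_sourceRight (fun s => (H.op12_E_right_op23_E_right s).symm) p t
  have hT : H.T₂ * (H.sourceRight p).lTensor A = (H.sourceRight p).lTensor A * H.T₂ :=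
    LinearMap.ext fun t => comp_lTensor_sourceRight H.op23_E_right_op12_T₂ p t
  have h4 : op23 H.E.right (op23 ((H.sourceRight p).lTensor A) s) =
      op23 H.T₂ (op23 ((H.sourceRight p).lTensor A) (op23 R₂ s)) := by
    simp only [op23_op23]
    rw [hE, ← hR₂.1, ← mul_assoc, ← mul_assoc, hT]
  have h5 : op23 H.E.right s = op23 H.T₂ (op23 R₂ s) := by rw [op23_op23, hR₂.1]
  rw [← h1 (op23 ((H.sourceRight p).lTensor A) s), h4, h2, op12_op23_lTensor, h3, ← h2, ← h5, h1]

/-- `(S(a) ⊗ x)(Δ(q)(1 ⊗ r)) = (S(xa) ⊗ 1)(Δ(q)(1 ⊗ r))` for `x = ε_t(p)`. -/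
theorem lTensor_targetLeft (hR₁ : IsGeneralizedInverse H.T₁ H.E.left H.G₁ R₁) (p : A)
    (s : A ⊗[ℂ] (A ⊗[ℂ] A)) :
    (H.targetLeft p).lTensor A ((H.antipodeLeft R₁).rTensor A
        ((TensorProduct.assoc ℂ A A A).symm (op23 H.T₁ s))) =
      (H.antipodeLeft R₁).rTensor A ((TensorProduct.assoc ℂ A A A).symm
        (op23 H.T₁ (op12 ((H.targetLeft p).rTensor A) s))) := by
  have h1 : ∀ s, (H.antipodeLeft R₁).rTensor A ((TensorProduct.assoc ℂ A A A).symm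
      (op23 H.T₁ (op12 H.E.left s))) =
      (H.antipodeLeft R₁).rTensor A ((TensorProduct.assoc ℂ A A A).symm (op23 H.T₁ s)) := fun s => by
    rw [← op12_E_left_op23_T₁, rTensor_op12, antipodeLeft_comp_E hR₁]
  have h2 : ∀ s, (H.antipodeLeft R₁).rTensor A ((TensorProduct.assoc ℂ A A A).symm
      (op23 H.T₁ (op12 H.T₁ s))) =
      (sliceLeft H.ε ∘ₗ H.G₁).rTensor A ((TensorProduct.assoc ℂ A A A).symm
        (leg13 H.T₁ (op23 H.T₁ s))) := fun s => by
    rw [pentagon_T₁, rTensor_op12, antipodeLeft_comp_T₁ hR₁]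
  have h3 : ∀ x, (sliceLeft H.ε ∘ₗ H.G₁).rTensor A ((TensorProduct.assoc ℂ A A A).symm
      (leg13 H.T₁ (op12 ((H.targetLeft p).rTensor A) x))) =
      (H.targetLeft p).lTensor A ((sliceLeft H.ε ∘ₗ H.G₁).rTensor A
        ((TensorProduct.assoc ℂ A A A).symm (leg13 H.T₁ x))) := fun x => by
    induction x using TensorProduct.induction_on with
    | zero => simp
    | add x y hx hy => simp only [map_add, hx, hy]
    | tmul a t =>
      rw [op12_rTensor_tmul, rTensor_sliceLeft_G₁, rTensor_sliceLeft_G₁,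
        ← LinearMap.lTensor_comp_apply]
      congr 2
      refine LinearMap.ext fun v => ?_
      simp [targetLeft_mul]
  have hE : H.E.left * (H.targetLeft p).rTensor A = (H.targetLeft p).rTensor A * H.E.left :=
    LinearMap.ext fun t =>
      comp_rTensor_targetLeft (fun s => H.op12_E_left_op23_E_left s) p t
  have hT : H.T₁ * (H.targetLeft p).rTensor A = (H.targetLeft p).rTensor A * H.T₁ :=
    LinearMap.ext fun t => comp_rTensor_targetLeft H.op12_E_left_op23_T₁ p t
  have h4 : op12 H.E.left (op12 ((H.targetLeft p).rTensor A) s) =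
      op12 H.T₁ (op12 ((H.targetLeft p).rTensor A) (op12 R₁ s)) := by
    simp only [op12_op12]
    rw [hE, ← hR₁.1, ← mul_assoc, ← mul_assoc, hT]
  have h5 : op12 H.E.left s = op12 H.T₁ (op12 R₁ s) := by rw [op12_op12, hR₁.1]
  rw [← h1 (op12 ((H.targetLeft p).rTensor A) s), h4, h2, op23_op12_rTensor, h3, ← h2, ← h5, h1]

/-- The multiplier `ε_s(p)`. -/
def source (H : WeakMultiplierHopfAlgebra A) (p : A) : Multiplier A :=
  Multiplier.mk (sliceLeft H.ε ∘ₗ H.G₁ ∘ₗ TensorProduct.mk ℂ A A p) (H.sourceRight p)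
    (fun a b => by
      have := H.G₁_lTensor_mulRight b (p ⊗ₜ a)
      rw [LinearMap.lTensor_tmul, LinearMap.mulRight_apply] at this
      simp only [LinearMap.comp_apply, TensorProduct.mk_apply]
      rw [this, sliceLeft_mul_right]
      rfl)
    (fun a b => sourceRight_mul p a b)
    (fun a b => H.source_compat p b a)

/-- `source` witnesses existence for the choice in `sourceMap`; non-degeneracy makes a multiplier
unique once its right action is prescribed. -/
theorem sourceMap_eq (p : A) : H.sourceMap p = H.source p := by
  have h : ∀ b : A, (H.sourceMap p).right b = sliceRight H.ε (H.E.right (b ⊗ₜ p)) :=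
    Classical.epsilon_spec (p := fun y : Multiplier A =>
      ∀ b : A, y.right b = sliceRight H.ε (H.E.right (b ⊗ₜ p))) ⟨H.source p, fun _ => rfl⟩
  exact H.nondeg.multiplier_ext_right h

end SourceTarget

end WeakMultiplierHopfAlgebra

/-- A pair of linear maps `f`, `g` with `g(a)b = af(b)` is a multiplier. -/
theorem NonDegenerate.exists_multiplier {B : Type*} [NonUnitalRing B] [Module ℂ B]
    [IsScalarTower ℂ B B] [SMulCommClass ℂ B B] (hB : NonDegenerate B) {f g : Module.End ℂ B}
    (h : ∀ a b, g a * b = a * f b) : ∃ z : Multiplier B, z.left = f ∧ z.right = g :=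
  ⟨Multiplier.mk f g
    (fun a b => hB.eq_of_mul' fun c => by rw [← h, ← mul_assoc, ← mul_assoc, h])
    (fun a b => hB.eq_of_mul fun c => by rw [h, mul_assoc, mul_assoc, h]) h, rfl, rfl⟩

namespace WeakMultiplierHopfAlgebra

variable {A : Type*} [NonUnitalRing A] [Module ℂ A] [IsScalarTower ℂ A A] [SMulCommClass ℂ A A]
  {H : WeakMultiplierHopfAlgebra A} {R₁ R₂ : Module.End ℂ (A ⊗[ℂ] A)}

/-! ### The antipode on the source algebra and E(y ⊗ 1) = E(1 ⊗ S(y)). -/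

section AntipodeOfSource

/-- `E(yb ⊗ S(a)c) = E(b ⊗ S(ay)c)` for `y = ε_s(p)`. -/
theorem E_left_source_tmul (hR₁ : IsGeneralizedInverse H.T₁ H.E.left H.G₁ R₁)
    (hR₂ : IsGeneralizedInverse H.T₂ H.E.right H.G₂ R₂) (p a b c : A) :
    H.E.left ((H.source p).left b ⊗ₜ H.antipodeLeft R₁ (a ⊗ₜ c)) =
      H.E.left (b ⊗ₜ H.antipodeLeft R₁ (H.sourceRight p a ⊗ₜ c)) := by
  have h1 : ∀ (a : A) (t : A ⊗[ℂ] A), t * (b ⊗ₜ H.antipodeLeft R₁ (a ⊗ₜ c)) =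
      (H.antipodeRight R₂ ∘ₗ (TensorProduct.mk ℂ A A).flip a).lTensor A t * (b ⊗ₜ c) := by
    intro a t
    induction t using TensorProduct.induction_on with
    | zero => simp
    | add x y hx hy => simp only [map_add, add_mul, hx, hy]
    | tmul u v => simp [antipode_compat hR₁ hR₂]
  have h2 : ∀ (d : A) (t : A ⊗[ℂ] A), t * ((H.source p).left b ⊗ₜ d) =
      (H.sourceRight p).rTensor A t * (b ⊗ₜ d) := by
    intro d t
    induction t using TensorProduct.induction_on with
    | zero => simp
    | add x y hx hy => simp only [map_add, add_mul, hx, hy]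
    | tmul u v =>
      rw [LinearMap.rTensor_tmul, Algebra.TensorProduct.tmul_mul_tmul,
        Algebra.TensorProduct.tmul_mul_tmul, ← Multiplier.right_mul_eq]
      rfl
  refine H.nondeg₂.eq_of_mul' fun w => ?_
  rw [← Multiplier.right_mul_eq, ← Multiplier.right_mul_eq]
  -- After pairing with w, only wE matters, and it is in the range of `T₂`, where
  -- `rTensor_sourceRight` applies.
  obtain ⟨s, hs⟩ := H.exists_T₂ w
  rw [← hs]
  clear hs
  induction s using TensorProduct.induction_on with
  | zero => simp
  | add x y hx hy => simp only [map_add, add_mul, hx, hy]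
  | tmul r q =>
    have key := rTensor_sourceRight hR₂ p (r ⊗ₜ (q ⊗ₜ a))
    rw [op23_tmul, LinearMap.lTensor_tmul, op12_tmul, op12_tmul, lTensor_assoc_tmul,
      lTensor_assoc_tmul] at key
    have hcomm : ∀ f g : Module.End ℂ A, f.lTensor A ∘ₗ g.rTensor A =
        g.rTensor A ∘ₗ f.lTensor A := fun f g => by
      rw [LinearMap.lTensor_comp_rTensor, LinearMap.rTensor_comp_lTensor]
    rw [h2, h1, h1, ← key]
    exact congrArg (· * (b ⊗ₜ c)) (LinearMap.congr_fun (hcomm _ _) _)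

/-- Since T₂(r ⊗ q)(b ⊗ x) = T₂(r ⊗ q)E(b ⊗ x) = 0, right multiplication by x kills every second leg
of (A ⊗ 1)Δ(A), which by fullness means Ax = 0. -/
theorem eq_zero_of_E_left_tmul (x : A) (h : ∀ b : A, H.E.left (b ⊗ₜ x) = 0) : x = 0 := by
  have : LinearMap.mulRight ℂ x = 0 := by
    refine H.eq_of_forall_T₂ fun r q => ?_
    rw [LinearMap.lTensor_zero, LinearMap.zero_apply]
    refine eq_zero_of_rTensor_eq_zero (g := fun b : A => LinearMap.mulRight ℂ b)
      (fun v hv => H.left_nondeg v hv) _ fun b => ?_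
    rw [← mul_tmul_eq, ← E_right_T₂, Multiplier.right_mul_eq, h, mul_zero]
  exact H.right_nondeg x fun b => LinearMap.congr_fun this b

theorem E_left_source_tmul' (hR₁ : IsGeneralizedInverse H.T₁ H.E.left H.G₁ R₁)
    (hR₂ : IsGeneralizedInverse H.T₂ H.E.right H.G₂ R₂) (p b : A) (v : A ⊗[ℂ] A) :
    H.E.left ((H.source p).left b ⊗ₜ H.antipodeLeft R₁ v) =
      H.E.left (b ⊗ₜ H.antipodeLeft R₁ ((H.sourceRight p).rTensor A v)) := by
  induction v using TensorProduct.induction_on with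
  | zero => simp
  | add x y hx hy => simp only [map_add, TensorProduct.tmul_add, hx, hy]
  | tmul a c => rw [E_left_source_tmul hR₁ hR₂, LinearMap.rTensor_tmul]

/-- `(uS(yv))(S(a)c) = (uS(v))(S(ay)c)` for `y = ε_s(p)`. -/
theorem antipodeRight_lTensor_source_mul (hR₁ : IsGeneralizedInverse H.T₁ H.E.left H.G₁ R₁)
    (hR₂ : IsGeneralizedInverse H.T₂ H.E.right H.G₂ R₂) (p : A) (t v : A ⊗[ℂ] A) :
    H.antipodeRight R₂ ((H.source p).left.lTensor A t) * H.antipodeLeft R₁ v =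
      H.antipodeRight R₂ t * H.antipodeLeft R₁ ((H.sourceRight p).rTensor A v) := by
  have hE : ∀ t, H.antipodeLeft R₁ (H.E.left t) = H.antipodeLeft R₁ t :=
    LinearMap.congr_fun (antipodeLeft_comp_E hR₁)
  induction t using TensorProduct.induction_on with
  | zero => simp
  | add x y hx hy => simp only [map_add, add_mul, hx, hy]
  | tmul u b =>
    rw [LinearMap.lTensor_tmul, ← antipode_compat hR₁ hR₂, ← antipode_compat hR₁ hR₂, ← hE,
      E_left_source_tmul' hR₁ hR₂, hE]

/-- The multiplier S(y), y = ε_s(p), is forced to act by S(a)c ↦ S(ay)c and uS(b) ↦ uS(yb). As S(A)A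
= A = AS(A), only well-definedness and compatibility of the two actions are at issue. -/
theorem exists_antipodeM_source (hR₁ : IsGeneralizedInverse H.T₁ H.E.left H.G₁ R₁)
    (hR₂ : IsGeneralizedInverse H.T₂ H.E.right H.G₂ R₂) (p : A) :
    ∃ z : Multiplier A,
      (∀ v, z.left (H.antipodeLeft R₁ v) = H.antipodeLeft R₁ ((H.sourceRight p).rTensor A v)) ∧
      ∀ t, z.right (H.antipodeRight R₂ t) =
        H.antipodeRight R₂ ((H.source p).left.lTensor A t) := by
  -- If ∑ S(a_i)c_i = 0, then E(b ⊗ ∑ S(a_i y)c_i) = E(yb ⊗ 0) = 0 for all b, so the image vanishes.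
  obtain ⟨f, hf⟩ := exists_factor (antipodeLeft_surjective hR₁)
    (β := H.antipodeLeft R₁ ∘ₗ (H.sourceRight p).rTensor A) fun v hv => by
      refine eq_zero_of_E_left_tmul (H := H) _ fun b => ?_
      rw [LinearMap.comp_apply, ← E_left_source_tmul' hR₁ hR₂, hv, TensorProduct.tmul_zero, map_zero]
  have key : ∀ t x, H.antipodeRight R₂ ((H.source p).left.lTensor A t) * x =
      H.antipodeRight R₂ t * f x := fun t x => by
    obtain ⟨v, rfl⟩ := antipodeLeft_surjective hR₁ x
    rw [hf, antipodeRight_lTensor_source_mul hR₁ hR₂]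
    rfl
  obtain ⟨g, hg⟩ := exists_factor (antipodeRight_surjective hR₂)
    (β := H.antipodeRight R₂ ∘ₗ (H.source p).left.lTensor A) fun t ht =>
      H.left_nondeg _ fun x => by rw [LinearMap.comp_apply, key, ht, zero_mul]
  obtain ⟨z, rfl, rfl⟩ := H.nondeg.exists_multiplier (f := f) (g := g) fun a b => by
    obtain ⟨t, rfl⟩ := antipodeRight_surjective hR₂ a
    rw [hg, LinearMap.comp_apply, key]
  exact ⟨z, hf, hg⟩

theorem antipode_spec (H : WeakMultiplierHopfAlgebra A) : H.IsAntipode H.antipode :=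
  Classical.epsilon_spec H.exists_isAntipode

/-- `antipodeM` is a choice, so exhibiting one multiplier with the defining property proves that the
chosen one has it. -/
theorem antipodeM_source_spec (p a : A) :
    H.antipodeM (H.source p) * H.antipode a = H.antipode ((H.source p).right a) ∧
      H.antipode a * H.antipodeM (H.source p) = H.antipode ((H.source p).left a) := by
  obtain ⟨R₁, R₂, hR₁, hR₂, hl, hr⟩ := H.antipode_spec
  obtain ⟨z, hz₁, hz₂⟩ := exists_antipodeM_source hR₁ hR₂ p
  refine Classical.epsilon_spec (p := fun z : Multiplier A => ∀ a : A,
    z * H.antipode a = H.antipode ((H.source p).right a) ∧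
      H.antipode a * z = H.antipode ((H.source p).left a)) ⟨z, fun a => ⟨?_, ?_⟩⟩ a
  · refine H.nondeg.multiplier_ext_left fun b => ?_
    rw [Multiplier.mul_left, hl, hl]
    exact hz₁ (a ⊗ₜ b)
  · refine H.nondeg.multiplier_ext_right fun b => ?_
    rw [Multiplier.mul_right, hr, hr]
    exact hz₂ (b ⊗ₜ a)

/-- `E(y ⊗ 1) = E(1 ⊗ S(y))` for `y = ε_s(p)`. -/
theorem E_left_source_tmul_eq (p b x : A) :
    H.E.left ((H.source p).left b ⊗ₜ x) =
      H.E.left (b ⊗ₜ (H.antipodeM (H.source p)).left x) := by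
  obtain ⟨R₁, R₂, hR₁, hR₂, hl, hr⟩ := H.antipode_spec
  obtain ⟨v, rfl⟩ := antipodeLeft_surjective hR₁ x
  rw [E_left_source_tmul' hR₁ hR₂]
  congr 2
  induction v using TensorProduct.induction_on with
  | zero => simp
  | add x y hx hy => simp only [map_add, hx, hy]
  | tmul a c =>
    have h := congrArg (fun m : Multiplier A => m.left c) (antipodeM_source_spec (H := H) p a).1
    simp only [Multiplier.mul_left] at h
    rw [hl, hl] at h
    exact h.symm

/-- From AS(A) = A and (uS(a))v = u(S(a)v) = 0 it follows that Av = 0. -/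
theorem eq_zero_of_antipode_left (v : A) (h : ∀ a, (H.antipode a).left v = 0) : v = 0 := by
  obtain ⟨R₁, R₂, hR₁, hR₂, hl, hr⟩ := H.antipode_spec
  refine H.right_nondeg v fun b => ?_
  obtain ⟨t, rfl⟩ := antipodeRight_surjective hR₂ b
  induction t using TensorProduct.induction_on with
  | zero => simp
  | add x y hx hy => simp only [map_add, add_mul, hx, hy, add_zero]
  | tmul u a =>
    rw [← antipode_compat hR₁ hR₂]
    have := h a
    rw [hl] at this
    exact (congrArg (u * ·) this).trans (mul_zero u)

end AntipodeOfSource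

/-! ### Left local units. -/

section LocalUnits

/-- The map `p ↦ ε_t(p)q`. -/
def targetAt (H : WeakMultiplierHopfAlgebra A) (q : A) : Module.End ℂ A :=
  sliceLeft H.ε ∘ₗ H.E.left ∘ₗ (TensorProduct.mk ℂ A A).flip q

theorem exists_finiteDimensional_lTensor {V W : Type*} [AddCommGroup V] [Module ℂ V]
    [AddCommGroup W] [Module ℂ W] (t : V ⊗[ℂ] W) :
    ∃ Q : Submodule ℂ W, FiniteDimensional ℂ Q ∧ t ∈ LinearMap.range (Q.subtype.lTensor V) := by
  induction t using TensorProduct.induction_on with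
  | zero => exact ⟨⊥, inferInstance, zero_mem _⟩
  | tmul v w =>
    exact ⟨ℂ ∙ w, inferInstance, v ⊗ₜ ⟨w, Submodule.mem_span_singleton_self w⟩, rfl⟩
  | add x y hx hy =>
    obtain ⟨Q, hQ, x, rfl⟩ := hx
    obtain ⟨Q', hQ', y, rfl⟩ := hy
    refine ⟨Q ⊔ Q', inferInstance, add_mem ?_ ?_⟩
    · refine ⟨(Submodule.inclusion le_sup_left).lTensor V x, ?_⟩
      rw [← LinearMap.lTensor_comp_apply, Submodule.subtype_comp_inclusion]
    · refine ⟨(Submodule.inclusion le_sup_right).lTensor V y, ?_⟩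
      rw [← LinearMap.lTensor_comp_apply, Submodule.subtype_comp_inclusion]

theorem sliceLeft_mem {Q : Submodule ℂ A} (φ : A →ₗ[ℂ] ℂ) {t : A ⊗[ℂ] A}
    (ht : Q.mkQ.lTensor A t = 0) : sliceLeft φ t ∈ Q := by
  obtain ⟨u, rfl⟩ := mem_range_subtype_lTensor Q t ht
  induction u using TensorProduct.induction_on with
  | zero => simp
  | add x y hx hy =>
    simp only [map_add]
    exact add_mem (hx (mkQ_lTensor_of_mem ⟨x, rfl⟩)) (hy (mkQ_lTensor_of_mem ⟨y, rfl⟩))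
  | tmul a q => simpa using Q.smul_mem _ q.2

/-- Q is any finite-dimensional space containing the second legs of T₁(a ⊗ b). The point is that
left multiplication of these legs by ε_t(p) stays in Q, whatever p is. -/
theorem exists_finiteDimensional_target_mul (a b : A) :
    ∃ Q : Submodule ℂ A, FiniteDimensional ℂ Q ∧ ∀ p, H.targetLeft p (a * b) ∈ Q := by
  obtain ⟨R₁, R₂, hR₁, hR₂, hl, hr⟩ := H.antipode_spec
  obtain ⟨Q, hQ, hQt⟩ := exists_finiteDimensional_lTensor (H.T₁ (a ⊗ₜ b))
  refine ⟨Q, hQ, fun p => ?_⟩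
  rw [← counit_left, ← sliceLeft_mul_right]
  refine sliceLeft_mem _ ?_
  refine eq_zero_of_rTensor_eq_zero (g := fun c : A => (H.antipode c).left)
    (fun v hv => eq_zero_of_antipode_left v hv) _ fun c => ?_
  have hc : ∀ c, H.antipodeLeft R₁ ∘ₗ TensorProduct.mk ℂ A A c = (H.antipode c).left :=
    fun c => LinearMap.ext fun b => (hl c b).symm
  -- Applying S(c) to the first leg moves ε_t(p) there: (S(c) ⊗ x)T₁(a ⊗ b) = (S(xc) ⊗ 1)T₁(a ⊗ b)
  -- with x = ε_t(p), and the second legs of the right side lie in Q.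
  have key := lTensor_targetLeft hR₁ p (c ⊗ₜ (a ⊗ₜ b))
  rw [op12_rTensor_tmul, op23_tmul, op23_tmul, rTensor_assoc_symm_tmul, rTensor_assoc_symm_tmul,
    hc, hc, ← LinearMap.comp_apply, LinearMap.lTensor_comp_rTensor,
    ← LinearMap.rTensor_comp_lTensor, LinearMap.comp_apply] at key
  rw [← LinearMap.comp_apply, LinearMap.rTensor_comp_lTensor, ← LinearMap.lTensor_comp_rTensor,
    LinearMap.comp_apply, key, ← LinearMap.comp_apply, LinearMap.lTensor_comp_rTensor,
    ← LinearMap.rTensor_comp_lTensor, LinearMap.comp_apply, mkQ_lTensor_of_mem hQt, map_zero]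

theorem finiteDimensional_range_targetAt (q : A) :
    FiniteDimensional ℂ (LinearMap.range (H.targetAt q)) := by
  have h : ∀ q, ∃ Q : Submodule ℂ A, FiniteDimensional ℂ Q ∧ ∀ p, H.targetLeft p q ∈ Q := by
    intro q
    have hq : q ∈ Submodule.span ℂ {x : A | ∃ a b, x = a * b} := H.idempotent ▸ trivial
    induction hq using Submodule.span_induction with
    | mem x hx =>
      obtain ⟨a, b, rfl⟩ := hx
      exact exists_finiteDimensional_target_mul a b
    | zero => exact ⟨⊥, inferInstance, fun p => by simp⟩
    | add x y _ _ hx hy =>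
      obtain ⟨Q, hQ, hx⟩ := hx
      obtain ⟨Q', hQ', hy⟩ := hy
      refine ⟨Q ⊔ Q', inferInstance, fun p => ?_⟩
      rw [map_add]
      exact Submodule.add_mem_sup (hx p) (hy p)
    | smul c x _ hx =>
      obtain ⟨Q, hQ, hx⟩ := hx
      exact ⟨Q, hQ, fun p => by rw [map_smul]; exact Q.smul_mem c (hx p)⟩
  obtain ⟨Q, hQ, hq⟩ := h q
  refine Submodule.finiteDimensional_of_le (S₂ := Q) ?_
  rintro _ ⟨p, rfl⟩
  exact hq p

/-- `E(p ⊗ q)` lies in `A ⊗ ε_t(A)q`. -/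
theorem E_left_tmul_mem (p q : A) :
    (LinearMap.range (H.targetAt q)).mkQ.lTensor A (H.E.left (p ⊗ₜ q)) = 0 := by
  refine eq_zero_of_rTensor_eq_zero (g := fun r : A => LinearMap.mulLeft ℂ r)
    (fun v hv => H.right_nondeg v hv) _ fun r => ?_
  have h : (LinearMap.mulLeft ℂ r).rTensor A (H.E.left (p ⊗ₜ q)) =
      (H.targetAt q).lTensor A (H.T₂ (r ⊗ₜ p)) := by
    rw [← lTensor_sliceLeft_op12_T₂, ← op23_tmul, ← op23_E_left_op12_T₂, lTensor_op23, op12_tmul,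
      lTensor_assoc_tmul]
    rfl
  rw [← LinearMap.comp_apply, LinearMap.rTensor_comp_lTensor, ← LinearMap.lTensor_comp_rTensor,
    LinearMap.comp_apply, h, ← LinearMap.lTensor_comp_apply, LinearMap.range_mkQ_comp]
  simp

/-- `(1 ⊗ d)E(a ⊗ q) = ∑ ε_s(d₍₁₎)a ⊗ d₍₂₎q`. -/
theorem lTensor_mulLeft_E_left (a d q : A) :
    (LinearMap.mulLeft ℂ d).lTensor A (H.E.left (a ⊗ₜ q)) =
      (sliceLeft H.ε ∘ₗ H.G₁ ∘ₗ (TensorProduct.mk ℂ A A).flip a).rTensor A (H.T₁ (d ⊗ₜ q)) := by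
  rw [← rTensor_sliceLeft_G₁]
  have : leg13 H.T₁ (d ⊗ₜ (a ⊗ₜ q)) = TensorProduct.leftComm ℂ A A A (a ⊗ₜ H.T₁ (d ⊗ₜ q)) := by
    simp [leg13]
  rw [this, rTensor_leftComm_tmul, LinearMap.comp_assoc]

/-- The functionals `φ` for which `(ι ⊗ φ)(E(1 ⊗ q))` is in the source algebra. -/
def sourceFunctionals (H : WeakMultiplierHopfAlgebra A) (q : A) : Submodule ℂ (A →ₗ[ℂ] ℂ) where
  carrier := {φ | ∃ p, ∀ a, sliceRight φ (H.E.left (a ⊗ₜ q)) = (H.source p).left a}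
  zero_mem' := ⟨0, fun a => by simp [sliceRight, source]⟩
  add_mem' := by
    rintro φ ψ ⟨p, hp⟩ ⟨r, hr⟩
    refine ⟨p + r, fun a => ?_⟩
    rw [show sliceRight (φ + ψ) = sliceRight φ + sliceRight ψ by
      simp [sliceRight, LinearMap.lTensor_add, LinearMap.comp_add], LinearMap.add_apply, hp, hr]
    simp only [source, Multiplier.mk_left, LinearMap.comp_apply, map_add, LinearMap.add_apply]
    rfl
  smul_mem' := by
    rintro c φ ⟨p, hp⟩
    refine ⟨c • p, fun a => ?_⟩
    rw [show sliceRight (c • φ) = c • sliceRight φ by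
      simp [sliceRight, LinearMap.lTensor_smul, LinearMap.comp_smul], LinearMap.smul_apply, hp]
    simp only [source, Multiplier.mk_left, LinearMap.comp_apply, map_smul, LinearMap.smul_apply]
    rfl

/-- Slicing (1 ⊗ d)E(a ⊗ q) = ∑ ε_s(d₍₁₎)a ⊗ d₍₂₎q by g gives ε_s(p)a with p = ∑ d₍₁₎ g(d₍₂₎q).
These functionals separate the points of A. -/
theorem comp_mulLeft_mem_sourceFunctionals (g : A →ₗ[ℂ] ℂ) (d q : A) :
    g ∘ₗ LinearMap.mulLeft ℂ d ∈ H.sourceFunctionals q := by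
  refine ⟨sliceRight g (H.T₁ (d ⊗ₜ q)), fun a => ?_⟩
  have h : sliceRight (g ∘ₗ LinearMap.mulLeft ℂ d) (H.E.left (a ⊗ₜ q)) =
      sliceRight g ((LinearMap.mulLeft ℂ d).lTensor A (H.E.left (a ⊗ₜ q))) := by
    simp [sliceRight, LinearMap.lTensor_comp]
  rw [h, lTensor_mulLeft_E_left, sliceRight_mul_left]
  rfl

/-- A space of functionals that separates the points of a finite-dimensional subspace contains
a dual basis of it. -/
theorem exists_dual_basis {V : Type*} [AddCommGroup V] [Module ℂ V] (F : Submodule ℂ V)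
    [FiniteDimensional ℂ F] (W : Submodule ℂ (V →ₗ[ℂ] ℂ))
    (h : ∀ v ∈ F, (∀ φ ∈ W, φ v = 0) → v = 0) :
    ∃ (n : ℕ) (b : Fin n → V) (φ : Fin n → V →ₗ[ℂ] ℂ), (∀ i, b i ∈ F) ∧ (∀ i, φ i ∈ W) ∧
      ∀ v ∈ F, v = ∑ i, φ i v • b i := by
  let W' : Submodule ℂ (Module.Dual ℂ F) := W.map F.subtype.dualMap
  have hW' : W' = ⊤ := by
    -- A subspace of the dual of a finite-dimensional space with no common zero except 0 is the
    -- whole dual.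
    have h0 : W'.dualCoannihilator = ⊥ := by
      rw [eq_bot_iff]
      intro v hv
      rw [Submodule.mem_dualCoannihilator] at hv
      exact (Submodule.mem_bot _).2 (Subtype.ext
        (h v v.2 fun φ hφ => hv _ (Submodule.mem_map_of_mem hφ)))
    rw [← Subspace.dualCoannihilator_dualAnnihilator_eq (W := W'), h0,
      Submodule.dualAnnihilator_bot]
  let b := Module.finBasis ℂ F
  have hφ : ∀ i, ∃ φ ∈ W, F.subtype.dualMap φ = b.coord i := fun i => by
    have : b.coord i ∈ W' := hW' ▸ trivial
    exact this
  choose φ hφW hφ using hφ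
  refine ⟨_, fun i => b i, φ, fun i => (b i).2, hφW, fun v hv => ?_⟩
  have h1 : v = ∑ i, (b.repr ⟨v, hv⟩ i • b i : F) := congrArg Subtype.val (b.sum_repr ⟨v, hv⟩).symm
  refine h1.trans ?_
  rw [Submodule.coe_sum]
  refine Finset.sum_congr rfl fun i _ => ?_
  rw [Submodule.coe_smul]
  exact congrArg (· • (b i : V)) (LinearMap.congr_fun (hφ i) ⟨v, hv⟩).symm

theorem sum_sliceRight_tmul {n : ℕ} {F : Submodule ℂ A} {b : Fin n → A} {φ : Fin n → A →ₗ[ℂ] ℂ}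
    (h : ∀ v ∈ F, v = ∑ i, φ i v • b i) {t : A ⊗[ℂ] A} (ht : F.mkQ.lTensor A t = 0) :
    t = ∑ i, sliceRight (φ i) t ⊗ₜ b i := by
  obtain ⟨u, rfl⟩ := mem_range_subtype_lTensor F t ht
  clear ht
  induction u using TensorProduct.induction_on with
  | zero => simp
  | add x y hx hy =>
    simp only [map_add, TensorProduct.add_tmul, Finset.sum_add_distrib]
    rw [← hx, ← hy]
  | tmul a v =>
    simp only [LinearMap.lTensor_tmul, Submodule.subtype_apply, sliceRight_tmul,
      TensorProduct.smul_tmul]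
    rw [← TensorProduct.tmul_sum, ← h v v.2]

/-- `q` is a combination of elements `S(y)v` with `y` in the source algebra and `v` in
`ε_t(A)q`. -/
theorem exists_eq_sum_antipodeM (q : A) :
    ∃ (n : ℕ) (p v : Fin n → A), (∀ i, v i ∈ LinearMap.range (H.targetAt q)) ∧
      q = ∑ i, (H.antipodeM (H.source (p i))).left (v i) := by
  have := finiteDimensional_range_targetAt (H := H) q
  obtain ⟨n, b, φ, hb, hφ, hsum⟩ := exists_dual_basis (LinearMap.range (H.targetAt q))
    (H.sourceFunctionals q) fun v _ hv => H.right_nondeg v fun d => by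
      rw [← Module.forall_dual_apply_eq_zero_iff ℂ]
      exact fun g => hv _ (comp_mulLeft_mem_sourceFunctionals g d q)
  choose p hp using hφ
  refine ⟨n, p, b, hb, ?_⟩
  rw [← sub_eq_zero]
  refine eq_zero_of_antipode_left (H := H) _ fun a => ?_
  rw [map_sub, map_sum, sub_eq_zero]
  obtain ⟨R₁, R₂, hR₁, hR₂, hl, hr⟩ := H.antipode_spec
  -- The dual basis expands E(a ⊗ q) as ∑ y_i a ⊗ v_i, with y_i independent of a, so S(a)q = ∑ S(y_i
  -- a)v_i = S(a) ∑ S(y_i)v_i.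
  have hE : H.antipodeLeft R₁ (a ⊗ₜ q) = H.antipodeLeft R₁ (H.E.left (a ⊗ₜ q)) :=
    (LinearMap.congr_fun (antipodeLeft_comp_E hR₁) _).symm
  rw [hl]
  refine hE.trans ?_
  rw [sum_sliceRight_tmul hsum (E_left_tmul_mem a q), map_sum]
  refine Finset.sum_congr rfl fun i _ => ?_
  rw [hp, ← Multiplier.mul_left, (antipodeM_source_spec (p i) a).2, hl]
  rfl

/-- `ε_t(A)q` is contained in `Aq`. -/
theorem targetAt_mem (p q : A) : H.targetAt q p ∈ LinearMap.range (LinearMap.mulRight ℂ q) := by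
  obtain ⟨R₁, R₂, hR₁, hR₂, hl, hr⟩ := H.antipode_spec
  let Q : Submodule ℂ A := LinearMap.range (LinearMap.mulRight ℂ q)
  -- N consists of the s with As contained in Aq. It contains every S(v)q, because aS(v) is in A
  -- even though S(v) is only a multiplier.
  let N : Submodule ℂ A := ⨅ a : A, Q.comap (LinearMap.mulLeft ℂ a)
  have hN : ∀ v, H.antipodeLeft R₁ (v ⊗ₜ q) ∈ N := fun v => by
    simp only [N, Submodule.mem_iInf, Submodule.mem_comap, LinearMap.mulLeft_apply]
    intro a
    rw [antipode_compat hR₁ hR₂]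
    exact ⟨_, rfl⟩
  have hR : N.mkQ.lTensor A (R₁ (p ⊗ₜ q)) = 0 := by
    refine eq_zero_of_rTensor_eq_zero (g := fun r : A => LinearMap.mulLeft ℂ r)
      (fun v hv => H.right_nondeg v hv) _ fun r => ?_
    have h : (LinearMap.mulLeft ℂ r).rTensor A (R₁ (p ⊗ₜ q)) =
        (H.antipodeLeft R₁ ∘ₗ (TensorProduct.mk ℂ A A).flip q).lTensor A (H.T₂ (r ⊗ₜ p)) := by
      rw [← lTensor_sliceLeft_op12_T₂, ← op23_tmul, ← op23_R₁_op12_T₂ hR₁, lTensor_op23, op12_tmul,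
        lTensor_assoc_tmul]
      rfl
    have h' : N.mkQ ∘ₗ H.antipodeLeft R₁ ∘ₗ (TensorProduct.mk ℂ A A).flip q = 0 :=
      LinearMap.ext fun v => (Submodule.Quotient.mk_eq_zero N).2 (hN v)
    rw [← LinearMap.comp_apply, LinearMap.rTensor_comp_lTensor, ← LinearMap.lTensor_comp_rTensor,
      LinearMap.comp_apply, h, ← LinearMap.lTensor_comp_apply, h']
    simp
  refine sliceLeft_mem _ ?_
  -- R₁(p ⊗ q) lies in A ⊗ N, and `T₁` maps A ⊗ N into A ⊗ Aq since (r ⊗ 1)Δ(a)(1 ⊗ s) = T₂(r ⊗ a)(1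
  -- ⊗ s).
  have hE : (H.E.left ∘ₗ (TensorProduct.mk ℂ A A).flip q) p = H.T₁ (R₁ (p ⊗ₜ q)) := by
    rw [← hR₁.1]
    rfl
  rw [hE]
  obtain ⟨u, hu⟩ := mem_range_subtype_lTensor N _ hR
  rw [← hu]
  clear hu
  induction u using TensorProduct.induction_on with
  | zero => simp
  | add x y hx hy => simp only [map_add, hx, hy, add_zero]
  | tmul a s =>
    refine eq_zero_of_rTensor_eq_zero (g := fun r : A => LinearMap.mulLeft ℂ r)
      (fun v hv => H.right_nondeg v hv) _ fun r => ?_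
    have h' : Q.mkQ ∘ₗ LinearMap.mulRight ℂ (s : A) = 0 :=
      LinearMap.ext fun v => (Submodule.Quotient.mk_eq_zero Q).2
        ((Submodule.mem_iInf _).1 s.2 v)
    rw [← LinearMap.comp_apply, LinearMap.rTensor_comp_lTensor, ← LinearMap.lTensor_comp_rTensor,
      LinearMap.comp_apply, LinearMap.lTensor_tmul, Submodule.subtype_apply, mulLeft_T₁,
      ← LinearMap.lTensor_comp_apply, h']
    simp

theorem exists_mul_eq_self (H : WeakMultiplierHopfAlgebra A) (q : A) : ∃ e, e * q = q := by
  obtain ⟨n, p, v, hv, hq⟩ := exists_eq_sum_antipodeM (H := H) q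
  suffices q ∈ LinearMap.range (LinearMap.mulRight ℂ q) from this
  refine Set.mem_of_eq_of_mem hq (Submodule.sum_mem _ fun i _ => ?_)
  obtain ⟨r, hr⟩ := hv i
  obtain ⟨a, ha⟩ := targetAt_mem (H := H) r q
  refine ⟨(H.antipodeM (H.source (p i))).left a, ?_⟩
  rw [← hr, ← ha, LinearMap.mulRight_apply, LinearMap.mulRight_apply, Multiplier.left_mul]

/-- A weak multiplier Hopf algebra has left local units. -/
theorem exists_left_unit (H : WeakMultiplierHopfAlgebra A) (s : Finset A) :
    ∃ e, ∀ q ∈ s, e * q = q := by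
  classical
  induction s using Finset.induction_on with
  | empty => exact ⟨0, by simp⟩
  | insert q s _ ih =>
    obtain ⟨e, he⟩ := ih
    obtain ⟨e', he'⟩ := H.exists_mul_eq_self (q - e * q)
    -- The new unit f satisfies 1 - f = (1 - e')(1 - e) formally, so it fixes whatever e fixes, and
    -- also q because e' fixes q - eq.
    refine ⟨e + e' - e' * e, fun x hx => ?_⟩
    rw [sub_mul, add_mul, mul_assoc]
    rcases Finset.mem_insert.1 hx with rfl | hx
    · rw [mul_sub] at he'
      rw [add_sub_assoc, he', add_sub_cancel]
    · rw [he x hx, add_sub_cancel_right]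

end LocalUnits

end WeakMultiplierHopfAlgebra

/-! ### Multipliers acting on modules with local units. -/

section UnitalModules

variable {B : Type*} [NonUnitalRing B] [Module ℂ B] [IsScalarTower ℂ B B] [SMulCommClass ℂ B B]
  {V : Type*} [AddCommGroup V] [Module ℂ V] {act : B →ₗ[ℂ] V →ₗ[ℂ] V}

/-- In a module with local units, the action extends to the multiplier algebra. -/
theorem multiplierAct_act (hmul : ∀ a b x, act (a * b) x = act a (act b x))
    (hunit : ∀ x, ∃ e, act e x = x) (m : Multiplier B) (b : B) (x : V) :
    multiplierAct act m (act b x) = act (m.left b) x := by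
  have hα : Function.Surjective (TensorProduct.lift act) := fun x => by
    obtain ⟨e, he⟩ := hunit x
    exact ⟨e ⊗ₜ x, by rw [TensorProduct.lift.tmul, he]⟩
  have key : ∀ e v, act e (TensorProduct.lift (act ∘ₗ m.left) v) =
      act (m.right e) (TensorProduct.lift act v) := fun e v => by
    induction v using TensorProduct.induction_on with
    | zero => simp
    | add x y hx hy => simp only [map_add, hx, hy]
    | tmul b x =>
      rw [TensorProduct.lift.tmul, TensorProduct.lift.tmul, LinearMap.comp_apply, ← hmul, ← hmul,
        Multiplier.right_mul_eq]
  -- If ∑ b_i x_i = 0, then e ∑ (m b_i)x_i = (em) ∑ b_i x_i = 0 for each e; one e fixes the sum, so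
  -- the sum is zero.
  obtain ⟨f, hf⟩ := exists_factor hα (β := TensorProduct.lift (act ∘ₗ m.left)) fun v hv => by
    obtain ⟨e, he⟩ := hunit (TensorProduct.lift (act ∘ₗ m.left) v)
    rw [← he, key, hv, map_zero]
  exact Classical.epsilon_spec (p := fun f : V →ₗ[ℂ] V => ∀ b x, f (act b x) = act (m.left b) x)
    ⟨f, fun b x => hf (b ⊗ₜ x)⟩ b x

theorem multiplierAct_mul (hmul : ∀ a b x, act (a * b) x = act a (act b x))
    (hunit : ∀ x, ∃ e, act e x = x) (m n : Multiplier B) (x : V) :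
    multiplierAct act (m * n) x = multiplierAct act m (multiplierAct act n x) := by
  obtain ⟨e, he⟩ := hunit x
  rw [← he, multiplierAct_act hmul hunit, multiplierAct_act hmul hunit,
    multiplierAct_act hmul hunit, Multiplier.mul_left]

end UnitalModules

/-! ### Module algebras and the two identities. -/

section ModuleAlgebras

variable {A : Type*} [NonUnitalRing A] [Module ℂ A] [IsScalarTower ℂ A A] [SMulCommClass ℂ A A]
  {R : Type*} [NonUnitalRing R] [Module ℂ R] [IsScalarTower ℂ R R] [SMulCommClass ℂ R R]
  {H : WeakMultiplierHopfAlgebra A} {act : A →ₗ[ℂ] R →ₗ[ℂ] R}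

@[simp] theorem tensorAct_tmul (act : A →ₗ[ℂ] R →ₗ[ℂ] R) (a b : A) (r s : R) :
    tensorAct act (a ⊗ₜ b) (r ⊗ₜ s) = act a r ⊗ₜ act b s := by
  simp [tensorAct]

theorem tensorAct_mul (hmul : ∀ a b x, act (a * b) x = act a (act b x)) (s t : A ⊗[ℂ] A)
    (x : R ⊗[ℂ] R) : tensorAct act (s * t) x = tensorAct act s (tensorAct act t x) := by
  induction x using TensorProduct.induction_on with
  | zero => simp
  | add x y hx hy => simp only [map_add, hx, hy]
  | tmul x y =>
    induction s using TensorProduct.induction_on with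
    | zero => simp
    | add s s' hs hs' => simp only [add_mul, map_add, LinearMap.add_apply, hs, hs']
    | tmul a b =>
      induction t using TensorProduct.induction_on with
      | zero => simp
      | add t t' ht ht' => simp only [mul_add, map_add, LinearMap.add_apply, ht, ht']
      | tmul c d => simp [hmul]

namespace IsModuleAlgebra

/-- Recording a finite set in A, rather than one unit, allows a common unit for several elements of
R, as needed for R ⊗ R. -/
theorem exists_finset_act (hR : IsModuleAlgebra H act) (x : R) :
    ∃ s : Finset A, ∀ e, (∀ q ∈ s, e * q = q) → act e x = x := by
  classical
  have hx : x ∈ Submodule.span ℂ {x : R | ∃ a r, x = act a r} := hR.unital ▸ trivial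
  induction hx using Submodule.span_induction with
  | mem x hx =>
    obtain ⟨a, r, rfl⟩ := hx
    exact ⟨{a}, fun e he => by rw [← hR.mul_act, he a (Finset.mem_singleton_self a)]⟩
  | zero => exact ⟨∅, fun e _ => map_zero _⟩
  | add x y _ _ hx hy =>
    obtain ⟨s, hs⟩ := hx
    obtain ⟨t, ht⟩ := hy
    exact ⟨s ∪ t, fun e he => by
      rw [map_add, hs e fun q hq => he q (Finset.mem_union_left t hq),
        ht e fun q hq => he q (Finset.mem_union_right s hq)]⟩
  | smul c x _ hx =>
    obtain ⟨s, hs⟩ := hx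
    exact ⟨s, fun e he => by rw [map_smul, hs e he]⟩

theorem exists_act_eq_self (hR : IsModuleAlgebra H act) (x : R) : ∃ e, act e x = x := by
  obtain ⟨s, hs⟩ := hR.exists_finset_act x
  obtain ⟨e, he⟩ := H.exists_left_unit s
  exact ⟨e, hs e he⟩

theorem exists_tensorAct_eq_self (hR : IsModuleAlgebra H act) (x : R ⊗[ℂ] R) :
    ∃ e, tensorAct act e x = x := by
  classical
  have h : ∃ s : Finset A, ∀ e, (∀ q ∈ s, e * q = q) → tensorAct act (e ⊗ₜ e) x = x := by
    induction x using TensorProduct.induction_on with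
    | zero => exact ⟨∅, fun e _ => map_zero _⟩
    | tmul x y =>
      obtain ⟨s, hs⟩ := hR.exists_finset_act x
      obtain ⟨t, ht⟩ := hR.exists_finset_act y
      exact ⟨s ∪ t, fun e he => by
        rw [tensorAct_tmul, hs e fun q hq => he q (Finset.mem_union_left t hq),
          ht e fun q hq => he q (Finset.mem_union_right s hq)]⟩
    | add x y hx hy =>
      obtain ⟨s, hs⟩ := hx
      obtain ⟨t, ht⟩ := hy
      exact ⟨s ∪ t, fun e he => by
        rw [map_add, hs e fun q hq => he q (Finset.mem_union_left t hq),
          ht e fun q hq => he q (Finset.mem_union_right s hq)]⟩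
  obtain ⟨s, hs⟩ := h
  obtain ⟨e, he⟩ := H.exists_left_unit s
  exact ⟨e ⊗ₜ e, hs e he⟩

theorem act_mul' (hR : IsModuleAlgebra H act) (a : A) (t : R ⊗[ℂ] R) :
    act a (LinearMap.mul' ℂ R t) =
      LinearMap.mul' ℂ R (multiplierAct (tensorAct act) (H.Δ a) t) := by
  induction t using TensorProduct.induction_on with
  | zero => simp
  | add x y hx hy => simp only [map_add, hx, hy]
  | tmul x y => rw [LinearMap.mul'_apply, hR.act_mul]

/-- `m(E ▷ (r ⊗ r')) = rr'`. -/
theorem mul'_E_act (hR : IsModuleAlgebra H act) (r r' : R) :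
    LinearMap.mul' ℂ R (multiplierAct (tensorAct act) H.E (r ⊗ₜ r')) = r * r' := by
  rw [← sub_eq_zero]
  -- The element e fixes the difference of the two sides but also kills it, because Δ(e)E = Δ(e).
  obtain ⟨e, he⟩ := hR.exists_act_eq_self
    (LinearMap.mul' ℂ R (multiplierAct (tensorAct act) H.E (r ⊗ₜ r')) - r * r')
  rw [← he, map_sub, hR.act_mul', hR.act_mul,
    ← multiplierAct_mul (tensorAct_mul hR.mul_act) hR.exists_tensorAct_eq_self, H.Δ_mul_E, sub_self]

/-- `(y ▷ r)r' = r(S(y) ▷ r')` for `y = ε_s(p)`. -/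
theorem source_act_mul (hR : IsModuleAlgebra H act) (p : A) (r r' : R) :
    multiplierAct act (H.source p) r * r' =
      r * multiplierAct act (H.antipodeM (H.source p)) r' := by
  obtain ⟨b, hb⟩ := hR.exists_act_eq_self r
  obtain ⟨c, hc⟩ := hR.exists_act_eq_self r'
  -- With r = b ▷ r and r' = c ▷ r', the identity E(yb ⊗ c) = E(b ⊗ S(y)c) in A ⊗ A becomes one in R
  -- ⊗ R.
  have h : multiplierAct (tensorAct act) H.E (act ((H.source p).left b) r ⊗ₜ act c r') =
      multiplierAct (tensorAct act) H.E
        (act b r ⊗ₜ act ((H.antipodeM (H.source p)).left c) r') := by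
    rw [← tensorAct_tmul, ← tensorAct_tmul,
      multiplierAct_act (tensorAct_mul hR.mul_act) hR.exists_tensorAct_eq_self,
      multiplierAct_act (tensorAct_mul hR.mul_act) hR.exists_tensorAct_eq_self,
      H.E_left_source_tmul_eq]
  rw [← multiplierAct_act hR.mul_act hR.exists_act_eq_self,
    ← multiplierAct_act hR.mul_act hR.exists_act_eq_self, hb, hc] at h
  rw [← hR.mul'_E_act, h, hR.mul'_E_act]

end IsModuleAlgebra

end ModuleAlgebras

end WMHA

end


theorem proposition3p3 {A : Type*} [NonUnitalRing A] [Module ℂ A] [IsScalarTower ℂ A A]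
    [SMulCommClass ℂ A A] {R : Type*} [NonUnitalRing R] [Module ℂ R] [IsScalarTower ℂ R R]
    [SMulCommClass ℂ R R] (H : WMHA.WeakMultiplierHopfAlgebra A) (act : A →ₗ[ℂ] R →ₗ[ℂ] R)
    (hR : WMHA.IsModuleAlgebra H act) :
    (∀ r r' : R, LinearMap.mul' ℂ R
      (WMHA.multiplierAct (WMHA.tensorAct act) H.E (r ⊗ₜ[ℂ] r')) = r * r') ∧
    ∀ y ∈ H.sourceAlgebra, ∀ r r' : R,
      WMHA.multiplierAct act y r * r' =
        r * WMHA.multiplierAct act (H.antipodeM y) r' := by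
  refine ⟨hR.mul'_E_act, ?_⟩
  rintro _ ⟨p, rfl⟩ r r'
  rw [H.sourceMap_eq]
  exact hR.source_act_mul p r r'
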